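/- Let $L_-,L_+>0$, $I=(-L_-,L_+)$, and let $q\in C^2(\overline I;\mathbb R)$ satisfy $q(0)=0$, $q'(0)>0$ and $q(x)\neq 0$ for all $x\in\overline I\setminus\{0\}$. For $\nu\in\mathbb C$ let $P_\nu=-\partial_x^2+\nu^2q(x)^2$ be the unbounded operator on $L^2(I)=L^2(I;\mathbb C)$ with domain $H^2(I)\cap H^1_0(I)$. For $\beta\in\mathbb C$ with $\operatorname{Re}\beta>0$ let $H_\beta=-\partial_x^2+\beta^2x^2$ be the unbounded operator on $L^2(\mathbb R)=L^2(\mathbb R;\mathbb C)$ with domain $\{u\in L^2(\mathbb R): -u''+\beta^2x^2u\in L^2(\mathbb R)\}$, where $-u''+\beta^2x^2u$ is understood in the sense of distributions. Write $\rho(\cdot)$ and $\mathrm{Sp}(\cdot)$ for the resolvent set and the spectrum. Let $1_I:L^2(I)\to L^2(\mathbb R)$ be extension by zero and $1_I^*:L^2(\mathbb R)\to L^2(I)$ its adjoint, the restriction to $I$. Let $\theta_0\in[0,\pi/2)$, $\gamma>0$ and $\varepsilon>0$. Set $\Sigma_{\theta_0}=\{\nu\in\mathbb C: |\nu|\ge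 1,\ |\arg\nu|\le\theta_0\}$ and, for $\nu\in\Sigma_{\theta_0}$, $$\tilde{\mathcal Z}_\nu=\{z\in\mathbb C:\ |z|\le\gamma q'(0)|\nu|,\ \operatorname{dist}(z,\mathrm{Sp}(H_{q'(0)\nu}))\ge\varepsilon q'(0)|\nu|\}.$$ Then there exists $\nu_0\ge 1$ such that $z\in\rho(P_\nu)$ for all $\nu\in\Sigma_{\theta_0}$ with $|\nu|\ge\nu_0$ and all $z\in\tilde{\mathcal Z}_\nu$. Moreover, $$\sup_{z\in\tilde{\mathcal Z}_\nu}\big\|(P_\nu-z)^{-1}-1_I^*(H_{q'(0)\nu}-z)^{-1}1_I\big\|_{\mathcal L(L^2(I))}=o\!\left(\frac1{|\nu|}\right)\qquad\text{as }|\nu|\to+\infty,\ \nu\in\Sigma_{\theta_0}.$$ That is, for every $\eta>0$ there is $\nu_1\ge\nu_0$ such that, for all $\nu\in\Sigma_{\theta_0}$ with $|\nu|\ge\nu_1$ and all $z\in\tilde{\mathcal Z}_\nu$, the norm above is at most $\eta/|\nu|$. -/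

import Mathlib

open MeasureTheory Set TopologicalSpace
open scoped Distributions ENNReal

noncomputable section

namespace Grushin

/-! ### Resolvents of unbounded operators -/

section Unbounded

variable {E : Type*} [NormedAddCommGroup E] [NormedSpace ℂ E]

/-- The bounded operator `R` is a two-sided inverse of `A - z : dom A → E`, where `A` is an
unbounded operator on `E`. -/
def IsResolventOp (A : E →ₗ.[ℂ] E) (z : ℂ) (R : E →L[ℂ] E) : Prop :=
  (∀ u : A.domain, R (A u - z • (u : E)) = u) ∧
    ∀ f : E, ∃ u : A.domain, (u : E) = R f ∧ A u - z • (u : E) = f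

/-- The resolvent set `ρ(A)`: the `z` such that `A - z : dom A → E` is bijective with bounded
inverse. -/
def opResolventSet (A : E →ₗ.[ℂ] E) : Set ℂ := {z | ∃ R : E →L[ℂ] E, IsResolventOp A z R}

/-- The spectrum `Sp(A)`. -/
def opSpectrum (A : E →ₗ.[ℂ] E) : Set ℂ := (opResolventSet A)ᶜ

open Classical in
/-- The resolvent `(A - z)⁻¹` for `z ∈ ρ(A)` (and `0` otherwise). -/
def opResolvent (A : E →ₗ.[ℂ] E) (z : ℂ) : E →L[ℂ] E :=
  if h : ∃ R : E →L[ℂ] E, IsResolventOp A z R then h.choose else 0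

theorem IsResolventOp.unique {A : E →ₗ.[ℂ] E} {z : ℂ} {R S : E →L[ℂ] E}
    (hR : IsResolventOp A z R) (hS : IsResolventOp A z S) : R = S := by
  ext f
  obtain ⟨u, hu, huf⟩ := hR.2 f
  rw [← hu, ← hS.1 u, huf]

theorem IsResolventOp.opResolvent_eq {A : E →ₗ.[ℂ] E} {z : ℂ} {R : E →L[ℂ] E}
    (hR : IsResolventOp A z R) : opResolvent A z = R := by
  have h : ∃ R : E →L[ℂ] E, IsResolventOp A z R := ⟨R, hR⟩
  rw [opResolvent, dif_pos h]
  exact h.choose_spec.unique hR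

end Unbounded

/-! ### Spaces, weak derivatives, extension and restriction -/

/-- `L²(Ω)`, complex valued. -/
abbrev L2 (Ω : Opens ℝ) : Type := Lp ℂ 2 (volume.restrict (Ω : Set ℝ))

/-- `L²(ℝ)`, complex valued. -/
abbrev L2R : Type := Lp ℂ 2 (volume : Measure ℝ)

/-- `v` is the derivative of `u` on `Ω` in the sense of distributions. -/
def HasWeakDeriv (Ω : Opens ℝ) (u v : L2 Ω) : Prop :=
  ∀ φ : 𝓓(Ω, ℂ), ∫ x in (Ω : Set ℝ), deriv φ x * u x = -∫ x in (Ω : Set ℝ), φ x * v x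

/-- Membership in `H²(Ω)`. -/
def MemH2 {Ω : Opens ℝ} (u : L2 Ω) : Prop :=
  ∃ u₁ u₂ : L2 Ω, HasWeakDeriv Ω u u₁ ∧ HasWeakDeriv Ω u₁ u₂

/-- Membership in `H¹₀(Ω)`, the closure of `C_c^∞(Ω)` in `H¹(Ω)`. -/
def MemH10 {Ω : Opens ℝ} (u : L2 Ω) : Prop :=
  ∃ u₁ : L2 Ω, HasWeakDeriv Ω u u₁ ∧ ∀ δ : ℝ≥0∞, 0 < δ → ∃ φ : 𝓓(Ω, ℂ),
    eLpNorm (fun x => u x - φ x) 2 (volume.restrict (Ω : Set ℝ)) < δ ∧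
    eLpNorm (fun x => u₁ x - deriv φ x) 2 (volume.restrict (Ω : Set ℝ)) < δ

/-- The extension by zero of `u ∈ L²(Ω)`, as an element of `L²(ℝ)`. -/
def extendZeroFun (Ω : Opens ℝ) (u : L2 Ω) : L2R :=
  ((memLp_indicator_iff_restrict Ω.isOpen.measurableSet).2 (Lp.memLp u)).toLp
    ((Ω : Set ℝ).indicator u)

theorem extendZeroFun_coeFn (Ω : Opens ℝ) (u : L2 Ω) :
    extendZeroFun Ω u =ᵐ[volume] (Ω : Set ℝ).indicator u := by
  rw [extendZeroFun]
  apply MemLp.coeFn_toLp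

/-- `1_Ω : L²(Ω) → L²(ℝ)`, extension by zero. -/
def extendZero (Ω : Opens ℝ) : L2 Ω →L[ℂ] L2R :=
  LinearMap.mkContinuous
    { toFun := extendZeroFun Ω
      map_add' := by
        intro u v
        apply Lp.ext
        have h := Lp.coeFn_add u v
        rw [Filter.EventuallyEq, ae_restrict_iff' Ω.isOpen.measurableSet] at h
        filter_upwards [h, extendZeroFun_coeFn Ω u, extendZeroFun_coeFn Ω v,
          extendZeroFun_coeFn Ω (u + v), Lp.coeFn_add (extendZeroFun Ω u) (extendZeroFun Ω v)]
          with x hx h1 h2 h3 h4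
        rw [h4, Pi.add_apply, h1, h2, h3]
        by_cases hxΩ : x ∈ (Ω : Set ℝ)
        · rw [indicator_of_mem hxΩ, indicator_of_mem hxΩ, indicator_of_mem hxΩ, hx hxΩ,
            Pi.add_apply]
        · simp [indicator_of_notMem hxΩ]
      map_smul' := by
        intro c u
        apply Lp.ext
        have h := Lp.coeFn_smul c u
        rw [Filter.EventuallyEq, ae_restrict_iff' Ω.isOpen.measurableSet] at h
        filter_upwards [h, extendZeroFun_coeFn Ω u, extendZeroFun_coeFn Ω (c • u),
          Lp.coeFn_smul c (extendZeroFun Ω u)] with x hx h1 h3 h4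
        rw [RingHom.id_apply, h4, Pi.smul_apply, h1, h3]
        by_cases hxΩ : x ∈ (Ω : Set ℝ)
        · rw [indicator_of_mem hxΩ, indicator_of_mem hxΩ, hx hxΩ, Pi.smul_apply]
        · simp [indicator_of_notMem hxΩ] }
    1 (by
      intro u
      simp only [LinearMap.coe_mk, AddHom.coe_mk, one_mul]
      rw [Lp.norm_def, eLpNorm_congr_ae (extendZeroFun_coeFn Ω u),
        eLpNorm_indicator_eq_eLpNorm_restrict Ω.isOpen.measurableSet, Lp.norm_def])

theorem extendZero_coeFn (Ω : Opens ℝ) (u : L2 Ω) :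
    extendZero Ω u =ᵐ[volume] (Ω : Set ℝ).indicator u :=
  extendZeroFun_coeFn Ω u

/-- `1_Ω^* : L²(ℝ) → L²(Ω)`, restriction to `Ω`. -/
def restrictTo (Ω : Opens ℝ) : L2R →L[ℂ] L2 Ω :=
  LpToLpRestrictCLM ℝ ℂ ℂ volume 2 (Ω : Set ℝ)

theorem restrictTo_coeFn (Ω : Opens ℝ) (u : L2R) :
    ⇑(restrictTo Ω u) =ᵐ[volume.restrict (Ω : Set ℝ)] u :=
    LpToLpRestrictCLM_coeFn ℂ (Ω : Set ℝ) u

/-- Restriction to `Ω` is the adjoint of extension by zero. -/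
theorem inner_restrictTo_left (Ω : Opens ℝ) (u : L2R) (v : L2 Ω) :
    inner ℂ (restrictTo Ω u) v = inner ℂ u (extendZero Ω v) := by
  have hu := restrictTo_coeFn Ω u
  have hv := extendZero_coeFn Ω v
  generalize restrictTo Ω u = u' at *
  generalize extendZero Ω v = v' at *
  rw [MeasureTheory.L2.inner_def, MeasureTheory.L2.inner_def]
  rw [← integral_indicator Ω.isOpen.measurableSet]
  rw [Filter.EventuallyEq, ae_restrict_iff' Ω.isOpen.measurableSet] at hu
  apply integral_congr_ae
  filter_upwards [hu, hv] with x hux hvx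
  by_cases hx : x ∈ (Ω : Set ℝ)
  · rw [indicator_of_mem hx, hvx, indicator_of_mem hx, hux hx]
  · rw [indicator_of_notMem hx, hvx, indicator_of_notMem hx, inner_zero_right]

theorem integrable_mul_L2 {μ : Measure ℝ} [IsLocallyFiniteMeasure μ] (u : Lp ℂ 2 μ)
    {g : ℝ → ℂ} (hg : Continuous g) (hc : HasCompactSupport g) :
    Integrable (fun x => g x * u x) μ :=
  ((Lp.memLp u).locallyIntegrable (by norm_num)).integrable_smul_left_of_hasCompactSupport hg hc

theorem testFunction_continuous_deriv {Ω : Opens ℝ} (φ : 𝓓(Ω, ℂ)) : Continuous (deriv φ) :=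
  φ.contDiff.continuous_deriv (by simp)

theorem testFunction_continuous_deriv2 {Ω : Opens ℝ} (φ : 𝓓(Ω, ℂ)) :
    Continuous (deriv (deriv φ)) := by
  have h : ContDiff ℝ 2 φ := φ.contDiff.of_le (WithTop.coe_le_coe.2 (le_top : (2 : ℕ∞) ≤ ⊤))
  exact ((contDiff_succ_iff_deriv (n := 1)).1 h).2.2.continuous_deriv le_rfl

/-- An `L²` function which vanishes as a distribution on `Ω` is zero almost everywhere on `Ω`. -/
theorem ae_eq_zero_of_testFunction {Ω : Opens ℝ} {μ : Measure ℝ} [IsLocallyFiniteMeasure μ]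
    (u : Lp ℂ 2 μ) (h : ∀ φ : 𝓓(Ω, ℂ), ∫ x, φ x * u x ∂μ = 0) :
    ∀ᵐ x ∂μ, x ∈ (Ω : Set ℝ) → u x = 0 := by
  have hli : LocallyIntegrableOn u (Ω : Set ℝ) μ :=
    ((Lp.memLp u).locallyIntegrable (by norm_num)).locallyIntegrableOn _
  refine Ω.isOpen.ae_eq_zero_of_integral_contDiff_smul_eq_zero hli ?_
  intro g hg hgc hgs
  have hψ : ContDiff ℝ ((⊤ : ℕ∞) : WithTop ℕ∞) (fun x => (g x : ℂ)) :=
    Complex.ofRealCLM.contDiff.comp hg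
  have hs : Function.support (fun x => (g x : ℂ)) = Function.support g := by
    ext x; simp
  have hψs : tsupport (fun x => (g x : ℂ)) = tsupport g := by
    rw [tsupport, hs, tsupport]
  let ψ : 𝓓(Ω, ℂ) := ⟨fun x => (g x : ℂ), hψ, by
    rw [HasCompactSupport, hψs]; exact hgc, by rw [hψs]; exact hgs⟩
  have := h ψ
  simpa [ψ, Complex.real_smul] using this

theorem L2_eq_zero {Ω : Opens ℝ} (u : L2 Ω)
    (h : ∀ φ : 𝓓(Ω, ℂ), ∫ x in (Ω : Set ℝ), φ x * u x = 0) : u = 0 := by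
  rw [Lp.eq_zero_iff_ae_eq_zero]
  filter_upwards [ae_eq_zero_of_testFunction u h, ae_restrict_mem Ω.isOpen.measurableSet]
    with x hx hxΩ
  exact hx hxΩ

theorem HasWeakDeriv.add {Ω : Opens ℝ} {u v u' v' : L2 Ω} (hu : HasWeakDeriv Ω u u')
    (hv : HasWeakDeriv Ω v v') : HasWeakDeriv Ω (u + v) (u' + v') := by
  intro φ
  have e1 : ∫ x in (Ω : Set ℝ), deriv φ x * (u + v) x =
      ∫ x in (Ω : Set ℝ), (deriv φ x * u x + deriv φ x * v x) := by
    apply integral_congr_ae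
    filter_upwards [Lp.coeFn_add u v] with x hx
    rw [hx, Pi.add_apply, mul_add]
  have e2 : ∫ x in (Ω : Set ℝ), φ x * (u' + v') x =
      ∫ x in (Ω : Set ℝ), (φ x * u' x + φ x * v' x) := by
    apply integral_congr_ae
    filter_upwards [Lp.coeFn_add u' v'] with x hx
    rw [hx, Pi.add_apply, mul_add]
  have hd := testFunction_continuous_deriv φ
  have hdc := φ.hasCompactSupport.deriv
  rw [e1, e2, integral_add (integrable_mul_L2 u hd hdc) (integrable_mul_L2 v hd hdc),
    integral_add (integrable_mul_L2 u' φ.contDiff.continuous φ.hasCompactSupport)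
      (integrable_mul_L2 v' φ.contDiff.continuous φ.hasCompactSupport), hu φ, hv φ]
  ring

theorem HasWeakDeriv.smul {Ω : Opens ℝ} {u u' : L2 Ω} (c : ℂ) (hu : HasWeakDeriv Ω u u') :
    HasWeakDeriv Ω (c • u) (c • u') := by
  intro φ
  have e1 : ∫ x in (Ω : Set ℝ), deriv φ x * (c • u) x =
      ∫ x in (Ω : Set ℝ), c * (deriv φ x * u x) := by
    apply integral_congr_ae
    filter_upwards [Lp.coeFn_smul c u] with x hx
    rw [hx, Pi.smul_apply, smul_eq_mul]; ring
  have e2 : ∫ x in (Ω : Set ℝ), φ x * (c • u') x =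
      ∫ x in (Ω : Set ℝ), c * (φ x * u' x) := by
    apply integral_congr_ae
    filter_upwards [Lp.coeFn_smul c u'] with x hx
    rw [hx, Pi.smul_apply, smul_eq_mul]; ring
  rw [e1, e2, integral_const_mul, integral_const_mul, hu φ]
  ring

/-- Weak derivatives in `L²` are unique. -/
theorem HasWeakDeriv.unique {Ω : Opens ℝ} {u v w : L2 Ω} (hv : HasWeakDeriv Ω u v)
    (hw : HasWeakDeriv Ω u w) : v = w := by
  have h := hv.add (hw.smul (-1))
  have hz : u + (-1 : ℂ) • u = 0 := by simp
  rw [hz] at h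
  have : v + (-1 : ℂ) • w = 0 := by
    apply L2_eq_zero
    intro φ
    have h1 := h φ
    have h2 : ∫ x in (Ω : Set ℝ), deriv φ x * (0 : L2 Ω) x = 0 := by
      rw [← integral_zero ℝ ℂ (μ := volume.restrict (Ω : Set ℝ))]
      apply integral_congr_ae
      filter_upwards [Lp.coeFn_zero ℂ 2 (volume.restrict (Ω : Set ℝ))] with x hx
      rw [hx]; simp
    rw [h2] at h1
    exact neg_eq_zero.1 h1.symm
  simpa [← sub_eq_add_neg, sub_eq_zero] using this

theorem MemH10.add {Ω : Opens ℝ} {u v : L2 Ω} (hu : MemH10 u) (hv : MemH10 v) :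
    MemH10 (u + v) := by
  obtain ⟨u₁, hu₁, hu⟩ := hu
  obtain ⟨v₁, hv₁, hv⟩ := hv
  have aux : ∀ (a b : L2 Ω) (f g h : ℝ → ℂ) (δ : ℝ≥0∞), Continuous f → Continuous g →
      (∀ x, h x = f x + g x) →
      eLpNorm (fun x => a x - f x) 2 (volume.restrict (Ω : Set ℝ)) < δ / 2 →
      eLpNorm (fun x => b x - g x) 2 (volume.restrict (Ω : Set ℝ)) < δ / 2 →
      eLpNorm (fun x => (a + b) x - h x) 2 (volume.restrict (Ω : Set ℝ)) < δ := by
    intro a b f g h δ hf hg hh ha hb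
    have e : (fun x => (a + b) x - h x) =ᵐ[volume.restrict (Ω : Set ℝ)]
        (fun x => a x - f x) + (fun x => b x - g x) := by
      filter_upwards [Lp.coeFn_add a b] with x hx
      rw [hx, Pi.add_apply, Pi.add_apply, hh]; ring
    rw [eLpNorm_congr_ae e]
    refine (eLpNorm_add_le ((Lp.aestronglyMeasurable a).sub hf.aestronglyMeasurable)
      ((Lp.aestronglyMeasurable b).sub hg.aestronglyMeasurable) (by norm_num)).trans_lt ?_
    exact (ENNReal.add_lt_add ha hb).trans_eq (ENNReal.add_halves δ)
  refine ⟨u₁ + v₁, hu₁.add hv₁, fun δ hδ => ?_⟩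
  obtain ⟨φ, h1, h2⟩ := hu (δ / 2) (ENNReal.half_pos hδ.ne')
  obtain ⟨ψ, h3, h4⟩ := hv (δ / 2) (ENNReal.half_pos hδ.ne')
  refine ⟨φ + ψ, aux u v φ ψ _ δ φ.contDiff.continuous ψ.contDiff.continuous
    (fun x => rfl) h1 h3, aux u₁ v₁ _ _ _ δ (testFunction_continuous_deriv φ)
    (testFunction_continuous_deriv ψ) (fun x => ?_) h2 h4⟩
  exact deriv_add (φ.contDiff.differentiable (by simp) x) (ψ.contDiff.differentiable (by simp) x)

theorem MemH10.zero {Ω : Opens ℝ} : MemH10 (0 : L2 Ω) := by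
  refine ⟨0, ?_, fun δ hδ => ⟨0, ?_⟩⟩
  · intro φ
    have e (g : ℝ → ℂ) : ∫ x in (Ω : Set ℝ), g x * (0 : L2 Ω) x = 0 := by
      rw [← integral_zero ℝ ℂ (μ := volume.restrict (Ω : Set ℝ))]
      apply integral_congr_ae
      filter_upwards [Lp.coeFn_zero ℂ 2 (volume.restrict (Ω : Set ℝ))] with x hx
      rw [hx]; simp
    rw [e, e, neg_zero]
  · have e (g : ℝ → ℂ) (hg : ∀ x, g x = 0) :
        eLpNorm (fun x => (0 : L2 Ω) x - g x) 2 (volume.restrict (Ω : Set ℝ)) < δ := by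
      have : (fun x => (0 : L2 Ω) x - g x) =ᵐ[volume.restrict (Ω : Set ℝ)] 0 := by
        filter_upwards [Lp.coeFn_zero ℂ 2 (volume.restrict (Ω : Set ℝ))] with x hx
        rw [hx, hg]; simp
      rw [eLpNorm_congr_ae this, eLpNorm_zero]; exact hδ
    refine ⟨e _ (fun x => rfl), e _ (fun x => ?_)⟩
    exact deriv_const x (0 : ℂ)

theorem MemH10.smul {Ω : Opens ℝ} {u : L2 Ω} (c : ℂ) (hu : MemH10 u) : MemH10 (c • u) := by
  rcases eq_or_ne c 0 with rfl | hc
  · rw [zero_smul]; exact MemH10.zero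
  obtain ⟨u₁, hu₁, hu⟩ := hu
  have hc0 : (‖c‖ₑ : ℝ≥0∞) ≠ 0 := by simpa using hc
  have aux : ∀ (a : L2 Ω) (f h : ℝ → ℂ) (δ : ℝ≥0∞), (∀ x, h x = c * f x) →
      eLpNorm (fun x => a x - f x) 2 (volume.restrict (Ω : Set ℝ)) < δ / ‖c‖ₑ →
      eLpNorm (fun x => (c • a) x - h x) 2 (volume.restrict (Ω : Set ℝ)) < δ := by
    intro a f h δ hh ha
    have e : (fun x => (c • a) x - h x) =ᵐ[volume.restrict (Ω : Set ℝ)]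
        c • (fun x => a x - f x) := by
      filter_upwards [Lp.coeFn_smul c a] with x hx
      rw [hx, Pi.smul_apply, Pi.smul_apply, hh, smul_eq_mul, smul_eq_mul]; ring
    rw [eLpNorm_congr_ae e, eLpNorm_const_smul, mul_comm]
    exact (ENNReal.lt_div_iff_mul_lt (Or.inl hc0) (Or.inl enorm_ne_top)).1 ha
  refine ⟨c • u₁, hu₁.smul c, fun δ hδ => ?_⟩
  obtain ⟨φ, h1, h2⟩ := hu (δ / ‖c‖ₑ) (ENNReal.div_pos hδ.ne' enorm_ne_top)
  refine ⟨c • φ, aux u _ _ δ (fun x => rfl) h1, aux u₁ _ _ δ (fun x => ?_) h2⟩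
  exact deriv_const_mul c (φ.contDiff.differentiable (by simp) x)

/-! ### The operators `P_ν` and `H_β` -/

/-- The graph of `P_ν = -∂² + ν² q²` on `L²(Ω)` with domain `H²(Ω) ∩ H¹₀(Ω)`. -/
def dirichletGraph (Ω : Opens ℝ) (q : ℝ → ℝ) (ν : ℂ) : Submodule ℂ (L2 Ω × L2 Ω) where
  carrier := {p | MemH10 p.1 ∧ ∃ u₁ u₂ : L2 Ω, HasWeakDeriv Ω p.1 u₁ ∧ HasWeakDeriv Ω u₁ u₂ ∧
    p.2 =ᵐ[volume.restrict (Ω : Set ℝ)] fun x => -u₂ x + ν ^ 2 * (q x : ℂ) ^ 2 * p.1 x}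
  add_mem' := by
    rintro ⟨u, f⟩ ⟨v, g⟩ ⟨hu, u₁, u₂, hu₁, hu₂, hf⟩ ⟨hv, v₁, v₂, hv₁, hv₂, hg⟩
    refine ⟨hu.add hv, u₁ + v₁, u₂ + v₂, hu₁.add hv₁, hu₂.add hv₂, ?_⟩
    dsimp only at hf hg ⊢
    filter_upwards [hf, hg, Lp.coeFn_add f g, Lp.coeFn_add u v, Lp.coeFn_add u₂ v₂]
      with x h1 h2 h3 h4 h5
    simp only [Prod.mk_add_mk]
    rw [h3, h4, h5, Pi.add_apply, Pi.add_apply, Pi.add_apply, h1, h2]; ring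
  zero_mem' := by
    have h0 : HasWeakDeriv Ω (0 : L2 Ω) 0 := by
      obtain ⟨w, hw, -⟩ := MemH10.zero (Ω := Ω)
      simpa using hw.smul 0
    refine ⟨MemH10.zero, 0, 0, h0, h0, ?_⟩
    filter_upwards [Lp.coeFn_zero ℂ 2 (volume.restrict (Ω : Set ℝ))] with x hx
    simp only [Prod.fst_zero, Prod.snd_zero]
    rw [hx]; simp
  smul_mem' := by
    rintro c ⟨u, f⟩ ⟨hu, u₁, u₂, hu₁, hu₂, hf⟩
    refine ⟨hu.smul c, c • u₁, c • u₂, hu₁.smul c, hu₂.smul c, ?_⟩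
    dsimp only at hf ⊢
    filter_upwards [hf, Lp.coeFn_smul c f, Lp.coeFn_smul c u, Lp.coeFn_smul c u₂]
      with x h1 h3 h4 h5
    simp only [Prod.smul_mk]
    rw [h3, h4, h5, Pi.smul_apply, Pi.smul_apply, Pi.smul_apply, h1]
    simp only [smul_eq_mul]; ring

theorem dirichletGraph_single_valued (Ω : Opens ℝ) (q : ℝ → ℝ) (ν : ℂ) (p : L2 Ω × L2 Ω)
    (hp : p ∈ dirichletGraph Ω q ν) (h0 : p.1 = 0) : p.2 = 0 := by
  obtain ⟨-, u₁, u₂, h₁, h₂, hf⟩ := hp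
  obtain ⟨w, hw, -⟩ := MemH10.zero (Ω := Ω)
  have hz : HasWeakDeriv Ω (0 : L2 Ω) 0 := by simpa using hw.smul 0
  rw [h0] at h₁ hf
  have e₁ : u₁ = 0 := h₁.unique hz
  rw [e₁] at h₂
  have e₂ : u₂ = 0 := h₂.unique hz
  rw [e₂] at hf
  rw [Lp.eq_zero_iff_ae_eq_zero]
  filter_upwards [hf, Lp.coeFn_zero ℂ 2 (volume.restrict (Ω : Set ℝ))] with x hx h
  rw [hx, h]; simp

/-- The unbounded operator `P_ν = -∂² + ν² q²` on `L²(Ω)`, with domain `H²(Ω) ∩ H¹₀(Ω)`. -/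
def dirichletOp (Ω : Opens ℝ) (q : ℝ → ℝ) (ν : ℂ) : L2 Ω →ₗ.[ℂ] L2 Ω :=
  (dirichletGraph Ω q ν).toLinearPMap

theorem dirichletOp_graph (Ω : Opens ℝ) (q : ℝ → ℝ) (ν : ℂ) :
    (dirichletOp Ω q ν).graph = dirichletGraph Ω q ν :=
  Submodule.toLinearPMap_graph_eq _ (dirichletGraph_single_valued Ω q ν)

/-- For `q` continuous on a compact set containing `Ω`, the domain is `H²(Ω) ∩ H¹₀(Ω)`. -/
theorem mem_dirichletOp_domain {Ω : Opens ℝ} {K : Set ℝ} (hK : IsCompact K)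
    (hΩ : (Ω : Set ℝ) ⊆ K) {q : ℝ → ℝ} (hq : ContinuousOn q K) (ν : ℂ) (u : L2 Ω) :
    u ∈ (dirichletOp Ω q ν).domain ↔ MemH2 u ∧ MemH10 u := by
  rw [LinearPMap.mem_domain_iff, dirichletOp_graph]
  constructor
  · rintro ⟨f, hu, u₁, u₂, h₁, h₂, -⟩
    exact ⟨⟨u₁, u₂, h₁, h₂⟩, hu⟩
  · rintro ⟨⟨u₁, u₂, h₁, h₂⟩, hu⟩
    obtain ⟨C, hC⟩ := hK.exists_bound_of_continuousOn hq
    have hm : MemLp (fun x => ν ^ 2 * (q x : ℂ) ^ 2 * u x) 2 (volume.restrict (Ω : Set ℝ)) := by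
      have hqm : AEStronglyMeasurable q (volume.restrict (Ω : Set ℝ)) :=
        (hq.mono hΩ).aestronglyMeasurable Ω.isOpen.measurableSet
      have hqm' : AEStronglyMeasurable (fun x => ν ^ 2 * (q x : ℂ) ^ 2)
          (volume.restrict (Ω : Set ℝ)) :=
        aestronglyMeasurable_const.mul ((Complex.continuous_ofReal.comp_aestronglyMeasurable
          hqm).pow 2)
      refine (Lp.memLp u).of_le_mul (c := ‖ν‖ ^ 2 * C ^ 2)
        (hqm'.mul (Lp.aestronglyMeasurable u)) ?_
      filter_upwards [ae_restrict_mem Ω.isOpen.measurableSet] with x hx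
      rw [norm_mul, norm_mul, norm_pow, norm_pow, Complex.norm_real]
      have := hC x (hΩ hx)
      gcongr
    refine ⟨(((Lp.memLp u₂).neg).add hm).toLp _, hu, u₁, u₂, h₁, h₂, ?_⟩
    exact MemLp.coeFn_toLp (((Lp.memLp u₂).neg).add hm)

theorem oscillator_testFunction {Ω : Opens ℝ} (β : ℂ) (φ : 𝓓(Ω, ℂ)) :
    Continuous (fun x : ℝ => -deriv (deriv φ) x + β ^ 2 * (x : ℂ) ^ 2 * φ x) ∧
      HasCompactSupport (fun x : ℝ => -deriv (deriv φ) x + β ^ 2 * (x : ℂ) ^ 2 * φ x) := by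
  constructor
  · exact (testFunction_continuous_deriv2 φ).neg.add
      ((continuous_const.mul (Complex.continuous_ofReal.pow 2)).mul φ.contDiff.continuous)
  · exact (φ.hasCompactSupport.deriv.deriv.comp_left neg_zero).add φ.hasCompactSupport.mul_left

/-- The graph of `H_β = -∂² + β² x²` on `L²(ℝ)`: the pairs `(u, f)` in `L²(ℝ)` with
`-u'' + β² x² u = f` in the sense of distributions. -/
def oscillatorGraph (β : ℂ) : Submodule ℂ (L2R × L2R) where
  carrier := {p | ∀ φ : 𝓓((⊤ : Opens ℝ), ℂ),
    ∫ x : ℝ, (-deriv (deriv φ) x + β ^ 2 * (x : ℂ) ^ 2 * φ x) * p.1 x = ∫ x : ℝ, φ x * p.2 x}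
  add_mem' := by
    rintro ⟨u, f⟩ ⟨v, g⟩ hu hv φ
    obtain ⟨hc, hs⟩ := oscillator_testFunction β φ
    have e1 : ∫ x : ℝ, (-deriv (deriv φ) x + β ^ 2 * (x : ℂ) ^ 2 * φ x) * (u + v) x =
        ∫ x : ℝ, ((-deriv (deriv φ) x + β ^ 2 * (x : ℂ) ^ 2 * φ x) * u x +
          (-deriv (deriv φ) x + β ^ 2 * (x : ℂ) ^ 2 * φ x) * v x) := by
      apply integral_congr_ae
      filter_upwards [Lp.coeFn_add u v] with x hx
      rw [hx, Pi.add_apply, mul_add]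
    have e2 : ∫ x : ℝ, φ x * (f + g) x = ∫ x : ℝ, (φ x * f x + φ x * g x) := by
      apply integral_congr_ae
      filter_upwards [Lp.coeFn_add f g] with x hx
      rw [hx, Pi.add_apply, mul_add]
    simp only [Prod.mk_add_mk]
    rw [e1, e2, integral_add (integrable_mul_L2 u hc hs) (integrable_mul_L2 v hc hs),
      integral_add (integrable_mul_L2 f φ.contDiff.continuous φ.hasCompactSupport)
        (integrable_mul_L2 g φ.contDiff.continuous φ.hasCompactSupport)]
    exact congrArg₂ (· + ·) (hu φ) (hv φ)
  zero_mem' := by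
    intro φ
    have e (g : ℝ → ℂ) : ∫ x : ℝ, g x * (0 : L2R) x = 0 := by
      rw [← integral_zero ℝ ℂ (μ := volume)]
      apply integral_congr_ae
      filter_upwards [Lp.coeFn_zero ℂ 2 (volume : Measure ℝ)] with x hx
      rw [hx]; simp
    simp only [Prod.fst_zero, Prod.snd_zero]
    rw [e, e]
  smul_mem' := by
    rintro c ⟨u, f⟩ hu φ
    have e (g : ℝ → ℂ) (w : L2R) : ∫ x : ℝ, g x * (c • w) x = c * ∫ x : ℝ, g x * w x := by
      rw [← integral_const_mul]
      apply integral_congr_ae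
      filter_upwards [Lp.coeFn_smul c w] with x hx
      rw [hx, Pi.smul_apply, smul_eq_mul]; ring
    simp only [Prod.smul_mk]
    rw [e, e]
    exact congrArg (c * ·) (hu φ)

theorem oscillatorGraph_single_valued (β : ℂ) (p : L2R × L2R)
    (hp : p ∈ oscillatorGraph β) (h0 : p.1 = 0) : p.2 = 0 := by
  rw [Lp.eq_zero_iff_ae_eq_zero]
  have h : ∀ φ : 𝓓((⊤ : Opens ℝ), ℂ), ∫ x : ℝ, φ x * p.2 x = 0 := by
    intro φ
    rw [← hp φ, h0, ← integral_zero ℝ ℂ (μ := volume)]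
    apply integral_congr_ae
    filter_upwards [Lp.coeFn_zero ℂ 2 (volume : Measure ℝ)] with x hx
    rw [hx]; simp
  filter_upwards [ae_eq_zero_of_testFunction p.2 h] with x hx
  exact hx (mem_univ x)

/-- The non-selfadjoint harmonic oscillator `H_β = -∂² + β² x²` on `L²(ℝ)`, with domain
`{u ∈ L²(ℝ) | -u'' + β² x² u ∈ L²(ℝ)}` (in the sense of distributions). -/
def oscillatorOp (β : ℂ) : L2R →ₗ.[ℂ] L2R :=
  (oscillatorGraph β).toLinearPMap

theorem oscillatorOp_graph (β : ℂ) : (oscillatorOp β).graph = oscillatorGraph β :=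
  Submodule.toLinearPMap_graph_eq _ (oscillatorGraph_single_valued β)

/-! ### The sector and the spectral region -/

/-- `Σ_{θ₀} = {ν ∈ ℂ : |ν| ≥ 1, |arg ν| ≤ θ₀}`. -/
def sector (θ₀ : ℝ) : Set ℂ := {ν | 1 ≤ ‖ν‖ ∧ |Complex.arg ν| ≤ θ₀}

/-- `Z_{β,ε,γ} = {z ∈ ℂ : |z| ≤ γ |β|, dist(z, Sp(H_β)) ≥ ε |β|}`. -/
def spectralRegion (β : ℂ) (ε γ : ℝ) : Set ℂ :=
  {z | ‖z‖ ≤ γ * ‖β‖ ∧ ENNReal.ofReal (ε * ‖β‖) ≤ Metric.infEDist z (opSpectrum (oscillatorOp β))}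

/-- The open interval `(-L₋, L₊)`. -/
def interval (Lminus Lplus : ℝ) : Opens ℝ := ⟨Ioo (-Lminus) Lplus, isOpen_Ioo⟩

end Grushin

end

/-! ### Polynomials times Gaussians, and the oscillator acting on them. -/

noncomputable section

namespace Grushin

open Polynomial Complex

/-! Write a = q'(0), β = aν, H = H_β, P = P_ν. The operators are not selfadjoint, so distance to the
spectrum does not by itself bound a resolvent. Multiplying the quadratic forms by the conjugate of β
makes both coercive at the base point -β, uniformly in the sector with constant c = cos θ₀. The
proof compares the resolvents at -β and then moves to z.

Oscillator. On polynomials times exp(-βx²/2), a dense subspace, H - z is triangular and everything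
is algebra. The annihilation operator A = ∂ + βx satisfies AH = (H + 2β)A, so an estimate at z - 2β,
applied to Au, gives one at z as long as z stays away from β (`LadderBound.step`). Finitely many
steps lead from z to the coercive region (`ladderBound_of_re_le`), and `exists_ladderBound` bounds
the resolvent by K/|β| with K independent of ν and z. Only the inclusion of the odd multiples of β
in the spectrum is needed (`odd_mul_mem_opSpectrum`).

Base point. If (H + β)u = p, the truncation χ(tx)u nearly solves (P + β)v = p on the interval. The
error, divided by νq, is controlled by p, u, u' and xu, and the coercive estimate accepts a
right-hand side νqG (`norm_le_of_mulBy`). The error q² - a²x² is at most ηx² near 0. With t fixed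
and |ν| large, the resolvents at -β differ by o(1/|ν|) (`exists_norm_resolvent_sub_le`).

Transfer. With S the resolvent of P at -β and ζ = z + β, the resolvent at z is (1 - ζS)⁻¹S. The
compressed oscillator resolvent T₁ makes 1 + ζT₁ an approximate right inverse of 1 - ζS, and a
Neumann series makes it exact. Injectivity follows because S is symmetric for the bilinear pairing
∫uv (`exists_isResolventOp_of_comparison`). -/

/-- The polynomial `p` times the complex Gaussian `exp (-β x² / 2)`. -/
def gaussPoly (β : ℂ) (p : ℂ[X]) (x : ℝ) : ℂ := p.eval (x : ℂ) * cexp (-(β / 2) * (x : ℂ) ^ 2)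

theorem gaussPoly_add (β : ℂ) (p r : ℂ[X]) (x : ℝ) :
    gaussPoly β (p + r) x = gaussPoly β p x + gaussPoly β r x := by
  simp [gaussPoly, add_mul]

theorem gaussPoly_smul (β c : ℂ) (p : ℂ[X]) (x : ℝ) :
    gaussPoly β (c • p) x = c * gaussPoly β p x := by
  simp [gaussPoly, mul_assoc]

theorem gaussPoly_X_mul (β : ℂ) (p : ℂ[X]) (x : ℝ) :
    gaussPoly β (X * p) x = x * gaussPoly β p x := by
  simp [gaussPoly, mul_assoc]

/-- The differentiation operator on polynomials times Gaussians. -/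
def gaussDeriv (β : ℂ) : ℂ[X] →ₗ[ℂ] ℂ[X] := derivative - β • LinearMap.mulLeft ℂ X

theorem gaussDeriv_apply (β : ℂ) (p : ℂ[X]) :
    gaussDeriv β p = derivative p - β • (X * p) := rfl

theorem hasDerivAt_gaussPoly (β : ℂ) (p : ℂ[X]) (x : ℝ) :
    HasDerivAt (gaussPoly β p) (gaussPoly β (gaussDeriv β p) x) x := by
  have h1 : HasDerivAt (fun z : ℂ => p.eval z * cexp (-(β / 2) * z ^ 2))
      ((derivative p).eval (x : ℂ) * cexp (-(β / 2) * (x : ℂ) ^ 2) +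
        p.eval (x : ℂ) * (cexp (-(β / 2) * (x : ℂ) ^ 2) * (-(β / 2) * (2 * (x : ℂ))))) (x : ℂ) := by
    refine (p.hasDerivAt _).mul ?_
    have := ((hasDerivAt_pow 2 (x : ℂ)).const_mul (-(β / 2))).cexp
    simpa using this
  refine h1.comp_ofReal.congr_deriv ?_
  simp only [gaussPoly, gaussDeriv_apply, eval_sub, eval_smul, eval_mul, eval_X, smul_eq_mul]
  ring

theorem contDiff_gaussPoly (β : ℂ) (p : ℂ[X]) {n : WithTop ℕ∞} :
    ContDiff ℝ n (gaussPoly β p) := by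
  have hx : ContDiff ℝ n (fun x : ℝ => (x : ℂ)) := ofRealCLM.contDiff
  have hp : ContDiff ℝ n (fun x : ℝ => p.eval (x : ℂ)) := by
    have : ContDiff ℂ n (fun x : ℂ => p.eval x) := by
      simpa using p.contDiff_aeval (𝕜 := ℂ) n
    exact (this.restrict_scalars ℝ).comp hx
  refine hp.mul ((contDiff_const.mul (hx.pow 2)).cexp)

theorem continuous_gaussPoly (β : ℂ) (p : ℂ[X]) : Continuous (gaussPoly β p) :=
  (contDiff_gaussPoly β p (n := 0)).continuous

theorem memLp_gaussPoly {β : ℂ} (hβ : 0 < β.re) (p : ℂ[X]) : MemLp (gaussPoly β p) 2 volume := by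
  induction p using Polynomial.induction_on' with
  | add p r hp hr => exact (hp.add hr).ae_eq (ae_of_all _ fun x => (gaussPoly_add β p r x).symm)
  | monomial n a =>
    rw [memLp_two_iff_integrable_sq_norm (continuous_gaussPoly β _).aestronglyMeasurable]
    have h := (integrable_rpow_mul_exp_neg_mul_sq hβ (s := (2 * n : ℕ))
      (by have : (0 : ℝ) ≤ (2 * n : ℕ) := Nat.cast_nonneg _
          linarith)).const_mul (‖a‖ ^ 2)
    refine h.congr (ae_of_all _ fun x => ?_)
    simp only [gaussPoly, eval_monomial, norm_mul, norm_pow, norm_exp, norm_real, mul_pow,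
      Real.rpow_natCast]
    rw [← Real.exp_nat_mul]
    have e : ((2 : ℕ) : ℝ) * (-(β / 2) * (x : ℂ) ^ 2).re = -β.re * x ^ 2 := by
      rw [← ofReal_pow, re_mul_ofReal]; simp; ring
    rw [e, ← pow_mul, mul_comm n 2, Real.norm_eq_abs, (even_two_mul n).pow_abs]
    ring

/-- `gaussPoly β p` as an element of `L²(ℝ)`. -/
def gaussLp {β : ℂ} (hβ : 0 < β.re) : ℂ[X] →ₗ[ℂ] L2R where
  toFun p := (memLp_gaussPoly hβ p).toLp _
  map_add' p r := by
    rw [← MemLp.toLp_add (memLp_gaussPoly hβ p) (memLp_gaussPoly hβ r)]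
    exact MemLp.toLp_congr _ _ (ae_of_all _ fun x => gaussPoly_add β p r x)
  map_smul' c p := by
    rw [RingHom.id_apply, ← MemLp.toLp_const_smul c (memLp_gaussPoly hβ p)]
    exact MemLp.toLp_congr _ _ (ae_of_all _ fun x => gaussPoly_smul β c p x)

theorem coeFn_gaussLp {β : ℂ} (hβ : 0 < β.re) (p : ℂ[X]) :
    gaussLp hβ p =ᵐ[volume] gaussPoly β p := MemLp.coeFn_toLp (memLp_gaussPoly hβ p)

theorem inner_gaussLp {β : ℂ} (hβ : 0 < β.re) (p r : ℂ[X]) :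
    inner ℂ (gaussLp hβ p) (gaussLp hβ r) =
      ∫ x, (starRingEnd ℂ) (gaussPoly β p x) * gaussPoly β r x := by
  rw [L2.inner_def]
  apply integral_congr_ae
  filter_upwards [coeFn_gaussLp hβ p, coeFn_gaussLp hβ r] with x h1 h2
  rw [h1, h2, RCLike.inner_apply, mul_comm]

theorem integrable_conj_mul_gaussPoly {β : ℂ} (hβ : 0 < β.re) (p r : ℂ[X]) :
    Integrable (fun x => (starRingEnd ℂ) (gaussPoly β p x) * gaussPoly β r x) := by
  exact (memLp_gaussPoly hβ p).star.integrable_mul (memLp_gaussPoly hβ r)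

/-- Integration by parts: the product of the two functions and its derivative are both integrable,
so there is no boundary term. -/
theorem inner_gaussDeriv_right {β : ℂ} (hβ : 0 < β.re) (p r : ℂ[X]) :
    inner ℂ (gaussLp hβ p) (gaussLp hβ (gaussDeriv β r)) =
      -inner ℂ (gaussLp hβ (gaussDeriv β p)) (gaussLp hβ r) := by
  rw [inner_gaussLp, inner_gaussLp, eq_neg_iff_add_eq_zero, add_comm,
    ← integral_add (integrable_conj_mul_gaussPoly hβ _ _) (integrable_conj_mul_gaussPoly hβ _ _)]
  refine integral_eq_zero_of_hasDerivAt_of_integrable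
    (f := fun x => (starRingEnd ℂ) (gaussPoly β p x) * gaussPoly β r x) (fun x => ?_)
    ((integrable_conj_mul_gaussPoly hβ _ _).add (integrable_conj_mul_gaussPoly hβ _ _))
    (integrable_conj_mul_gaussPoly hβ _ _)
  exact (hasDerivAt_gaussPoly β p x).star.mul (hasDerivAt_gaussPoly β r x)

theorem inner_X_mul_right {β : ℂ} (hβ : 0 < β.re) (p r : ℂ[X]) :
    inner ℂ (gaussLp hβ p) (gaussLp hβ (X * r)) = inner ℂ (gaussLp hβ (X * p)) (gaussLp hβ r) := by
  rw [inner_gaussLp, inner_gaussLp]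
  congr 1; ext x
  simp only [gaussPoly_X_mul, map_mul, conj_ofReal]
  ring

/-- The operator `-∂² + β² x²` conjugated by the Gaussian, acting on polynomials. -/
def oscPoly (β : ℂ) : ℂ[X] →ₗ[ℂ] ℂ[X] :=
  β ^ 2 • (LinearMap.mulLeft ℂ X ∘ₗ LinearMap.mulLeft ℂ X) - gaussDeriv β ∘ₗ gaussDeriv β

theorem oscPoly_apply (β : ℂ) (p : ℂ[X]) :
    oscPoly β p = β ^ 2 • (X * (X * p)) - gaussDeriv β (gaussDeriv β p) := rfl

theorem gaussPoly_oscPoly (β : ℂ) (p : ℂ[X]) (x : ℝ) :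
    gaussPoly β (oscPoly β p) x =
      β ^ 2 * (x : ℂ) ^ 2 * gaussPoly β p x - gaussPoly β (gaussDeriv β (gaussDeriv β p)) x := by
  simp only [gaussPoly, oscPoly_apply, eval_sub, eval_smul, eval_mul, eval_X, smul_eq_mul]
  ring

theorem oscPoly_eq (β : ℂ) (p : ℂ[X]) :
    oscPoly β p = -derivative (derivative p) + (2 * β) • (X * derivative p) + β • p := by
  simp only [oscPoly_apply, gaussDeriv_apply, map_sub, derivative_C, derivative_mul,
    derivative_X, smul_eq_C_mul, C_mul, map_pow, map_ofNat]
  ring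

/-- Conjugated by the Gaussian, `derivative` is the annihilation operator A = ∂ + βx. This is the
commutation relation AH = (H + 2β)A, which shifts the spectral parameter by 2β. -/
theorem derivative_oscPoly (β : ℂ) (p : ℂ[X]) :
    derivative (oscPoly β p) = oscPoly β (derivative p) + (2 * β) • derivative p := by
  simp only [oscPoly_eq, derivative_add, derivative_neg, derivative_C, derivative_mul,
    derivative_X, derivative_ofNat, smul_eq_C_mul, C_mul, map_ofNat]
  ring

/-- On monomials H - z is triangular with diagonal entries (2n + 1)β - z and one lower term in
degree n - 2, so strong induction on the degree inverts it. -/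
theorem oscPoly_surjective {β z : ℂ} (hz : ∀ k : ℕ, z ≠ (2 * k + 1) * β) (f : ℂ[X]) :
    ∃ u, oscPoly β u - z • u = f := by
  suffices h : LinearMap.range (oscPoly β - z • LinearMap.id) = ⊤ by
    obtain ⟨u, hu⟩ := LinearMap.range_eq_top.1 h f
    exact ⟨u, hu⟩
  have key : ∀ n : ℕ, (X ^ n : ℂ[X]) ∈ LinearMap.range (oscPoly β - z • LinearMap.id) := by
    intro n
    induction n using Nat.strong_induction_on with
    | _ n ih =>
    have e : oscPoly β (X ^ n) - z • X ^ n =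
        ((2 * n + 1) * β - z) • X ^ n - ((n * (n - 1 : ℕ) : ℕ) : ℂ) • X ^ (n - 2) := by
      rw [oscPoly_eq]
      rcases n with _ | _ | n
      · simp [smul_eq_C_mul]
      · simp [smul_eq_C_mul, C_mul]; ring
      · simp [smul_eq_C_mul, C_mul]; ring
    have h0 : (2 * n + 1) * β - z ≠ 0 := sub_ne_zero.2 (hz n).symm
    have h1 : ((2 * n + 1) * β - z) • (X ^ n : ℂ[X]) ∈
        LinearMap.range (oscPoly β - z • LinearMap.id) := by
      rw [sub_eq_iff_eq_add.1 e.symm]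
      refine add_mem ⟨X ^ n, rfl⟩ ?_
      -- For n < 2 the coefficient n(n - 1) vanishes, so the truncated exponent n - 2 does not
      -- matter.
      rcases Nat.lt_or_ge n 2 with hn | hn
      · interval_cases n <;> simp
      · exact Submodule.smul_mem _ _ (ih _ (by omega))
    exact (Submodule.smul_mem_iff _ h0).1 h1
  rw [eq_top_iff]
  intro p _
  induction p using Polynomial.induction_on' with
  | add p r hp hr => exact add_mem (hp trivial) (hr trivial)
  | monomial n a =>
    rw [← mul_one a, ← smul_eq_mul, ← smul_monomial, ← X_pow_eq_monomial]
    exact Submodule.smul_mem _ _ (key n)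

theorem inner_self_eq_ofReal (v : L2R) : inner ℂ v v = ((‖v‖ ^ 2 : ℝ) : ℂ) := by
  rw [inner_self_eq_norm_sq_to_K, ofReal_pow]; rfl

theorem inner_oscPoly {β : ℂ} (hβ : 0 < β.re) (u : ℂ[X]) :
    inner ℂ (gaussLp hβ u) (gaussLp hβ (oscPoly β u)) =
      (‖gaussLp hβ (gaussDeriv β u)‖ ^ 2 : ℝ) + β ^ 2 * (‖gaussLp hβ (X * u)‖ ^ 2 : ℝ) := by
  rw [oscPoly_apply, map_sub, map_smul, inner_sub_right, inner_smul_right, inner_X_mul_right,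
    inner_gaussDeriv_right, inner_self_eq_ofReal, inner_self_eq_ofReal]
  ring

end Grushin
end

/-! ### Uniform resolvent estimates for the oscillator by the ladder argument. -/

noncomputable section

namespace Grushin

open Polynomial Complex

theorem le_of_sq_sum_le {c X Y Z M : ℝ} (hc : 0 < c) (hX : 0 ≤ X) (hY : 0 ≤ Y) (hZ : 0 ≤ Z)
    (hM : 0 ≤ M) (h : c * (X ^ 2 + Y ^ 2 + Z ^ 2) ≤ (X + Y + Z) * M) :
    X + Y + Z ≤ 3 / c * M := by
  have h1 : c * (X + Y + Z) ^ 2 ≤ 3 * M * (X + Y + Z) := by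
    nlinarith [mul_nonneg hc.le (sq_nonneg (X - Y)), mul_nonneg hc.le (sq_nonneg (X - Z)),
      mul_nonneg hc.le (sq_nonneg (Y - Z))]
  rw [div_mul_eq_mul_div, le_div_iff₀ hc]
  rcases (add_nonneg (add_nonneg hX hY) hZ).eq_or_lt with h0 | h0
  · rw [← h0, zero_mul]; positivity
  · nlinarith

/-- Moving A = ∂ + βx off g leaves only u' and xu on the other side. This is why the energy norm can
absorb a right-hand side of the form Ag with only the L² norm of g. -/
theorem inner_derivative {β : ℂ} (hβ : 0 < β.re) (u g : ℂ[X]) :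
    inner ℂ (gaussLp hβ u) (gaussLp hβ (derivative g)) =
      -inner ℂ (gaussLp hβ (gaussDeriv β u)) (gaussLp hβ g) +
        β * inner ℂ (gaussLp hβ (X * u)) (gaussLp hβ g) := by
  have e : derivative g = gaussDeriv β g + β • (X * g) := by rw [gaussDeriv_apply]; abel
  rw [e, map_add, map_smul, inner_add_right, inner_smul_right, inner_X_mul_right,
    inner_gaussDeriv_right]

/-- The scaled graph norm of a polynomial times a Gaussian. -/
def energyNorm {β : ℂ} (hβ : 0 < β.re) (u : ℂ[X]) : ℝ :=
  ‖β‖ * ‖gaussLp hβ u‖ + √‖β‖ * ‖gaussLp hβ (gaussDeriv β u)‖ +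
    √‖β‖ * (‖β‖ * ‖gaussLp hβ (X * u)‖)

/-- The estimate for `(H_β - z) u = f + (∂ + β x) g`. -/
def LadderBound {β : ℂ} (hβ : 0 < β.re) (z : ℂ) (K : ℝ) : Prop :=
  ∀ u f g : ℂ[X], oscPoly β u - z • u = f + derivative g →
    energyNorm hβ u ≤ K * (‖gaussLp hβ f‖ + √‖β‖ * ‖gaussLp hβ g‖)

/-- Multiplication by the conjugate of β rotates the potential coefficient β² into |β|²β and the
kinetic coefficient 1 into the conjugate of β. Both then have positive real part when β does. -/
theorem re_conj_mul_sq (β : ℂ) : (starRingEnd ℂ β * β ^ 2).re = ‖β‖ ^ 2 * β.re := by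
  have : starRingEnd ℂ β * β ^ 2 = ((‖β‖ ^ 2 : ℝ) : ℂ) * β := by
    rw [← normSq_eq_norm_sq, ← mul_conj]; ring
  rw [this, re_ofReal_mul]

/-- Pair the equation with u, multiply by the conjugate of β and take real parts: the hypothesis on
z makes all three terms nonnegative. The weights in `energyNorm` are those for which the result is
homogeneous in |β|. -/
theorem ladderBound_of_re_le {β z : ℂ} (hβ : 0 < β.re) {c : ℝ} (hc : 0 < c) (hc1 : c ≤ 1)
    (hcβ : c * ‖β‖ ≤ β.re) (hz : (starRingEnd ℂ β * z).re ≤ -‖β‖ ^ 2) :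
    LadderBound hβ z (3 / c) := by
  intro u f g h
  have hb : 0 < ‖β‖ := hβ.trans_le (re_le_norm β)
  have hI : inner ℂ (gaussLp hβ u) (gaussLp hβ (f + derivative g)) =
      ((‖gaussLp hβ (gaussDeriv β u)‖ ^ 2 : ℝ) + β ^ 2 * (‖gaussLp hβ (X * u)‖ ^ 2 : ℝ) -
        z * (‖gaussLp hβ u‖ ^ 2 : ℝ) : ℂ) := by
    rw [← h, map_sub, map_smul, inner_sub_right, inner_smul_right, inner_oscPoly,
      inner_self_eq_ofReal]
  have hle : ‖inner ℂ (gaussLp hβ u) (gaussLp hβ (f + derivative g))‖ ≤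
      ‖gaussLp hβ u‖ * ‖gaussLp hβ f‖ + (‖gaussLp hβ (gaussDeriv β u)‖ +
        ‖β‖ * ‖gaussLp hβ (X * u)‖) * ‖gaussLp hβ g‖ := by
    rw [map_add, inner_add_right, inner_derivative]
    refine (norm_add_le _ _).trans (add_le_add (norm_inner_le_norm _ _) ?_)
    refine (norm_add_le _ _).trans ?_
    rw [norm_neg, norm_mul, add_mul, mul_assoc]
    gcongr <;> exact norm_inner_le_norm _ _
  have hre : (starRingEnd ℂ β * inner ℂ (gaussLp hβ u) (gaussLp hβ (f + derivative g))).re ≤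
      ‖β‖ * ‖inner ℂ (gaussLp hβ u) (gaussLp hβ (f + derivative g))‖ := by
    refine (re_le_norm _).trans ?_
    rw [norm_mul, norm_conj]
  have e2 : (starRingEnd ℂ β * inner ℂ (gaussLp hβ u) (gaussLp hβ (f + derivative g))).re =
      β.re * ‖gaussLp hβ (gaussDeriv β u)‖ ^ 2 + ‖β‖ ^ 2 * β.re * ‖gaussLp hβ (X * u)‖ ^ 2 -
        (starRingEnd ℂ β * z).re * ‖gaussLp hβ u‖ ^ 2 := by
    rw [hI, ← re_conj_mul_sq, mul_sub, mul_add, ← mul_assoc, ← mul_assoc, sub_re, add_re,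
      re_mul_ofReal, re_mul_ofReal, re_mul_ofReal, conj_re]
  rw [e2] at hre
  rw [energyNorm]
  set b := ‖β‖
  set U := ‖gaussLp hβ u‖
  set V := ‖gaussLp hβ (gaussDeriv β u)‖
  set W := ‖gaussLp hβ (X * u)‖
  set F := ‖gaussLp hβ f‖
  set G := ‖gaussLp hβ g‖
  have hU : 0 ≤ U := norm_nonneg _
  have hV : 0 ≤ V := norm_nonneg _
  have hW : 0 ≤ W := norm_nonneg _
  have hF : 0 ≤ F := norm_nonneg _
  have hG : 0 ≤ G := norm_nonneg _
  have hs : √b * √b = b := Real.mul_self_sqrt hb.le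
  have hs0 : 0 ≤ √b := Real.sqrt_nonneg _
  have h1 : c * (V ^ 2 + (b * W) ^ 2) + b * U ^ 2 ≤ U * F + (V + b * W) * G := by
    refine le_of_mul_le_mul_left ?_ hb
    have i1 : c * b * V ^ 2 ≤ β.re * V ^ 2 := by gcongr
    have i2 : c * b * (b * W) ^ 2 ≤ β.re * (b * W) ^ 2 := by gcongr
    have i3 : b ^ 2 * U ^ 2 ≤ -(starRingEnd ℂ β * z).re * U ^ 2 := by gcongr; linarith
    have i4 := mul_le_mul_of_nonneg_left hle hb.le
    linarith
  -- The three unknowns are |β|‖u‖, √|β|‖u'‖ and √|β||β|‖xu‖; multiplying the last estimate by |β|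
  -- gives the quadratic inequality in them, with c ≤ 1 absorbing the coefficient of the first.
  refine le_of_sq_sum_le hc (by positivity) (by positivity) (by positivity) (by positivity) ?_
  have h2 := mul_le_mul_of_nonneg_left h1 hb.le
  have e3 : (√b * V) ^ 2 = b * V ^ 2 := by rw [mul_pow, sq √b, hs]
  have e4 : (√b * (b * W)) ^ 2 = b * (b * W) ^ 2 := by rw [mul_pow, sq √b, hs]
  have e5 : b * ((V + b * W) * G) = (√b * V + √b * (b * W)) * (√b * G) := by
    calc _ = (√b * √b) * ((V + b * W) * G) := by rw [hs]
      _ = _ := by ring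
  have h3 : c * (b * U) ^ 2 ≤ 1 * (b * U) ^ 2 := by gcongr
  have h4 : 0 ≤ b * U * (√b * G) := by positivity
  have h5 : 0 ≤ (√b * V + √b * (b * W)) * F := by positivity
  rw [e3, e4]
  nlinarith

theorem energyNorm_add_le {β : ℂ} (hβ : 0 < β.re) (u v : ℂ[X]) :
    energyNorm hβ (u + v) ≤ energyNorm hβ u + energyNorm hβ v := by
  simp only [energyNorm, mul_add, map_add]
  have h1 := norm_add_le (gaussLp hβ u) (gaussLp hβ v)
  have h2 := norm_add_le (gaussLp hβ (gaussDeriv β u)) (gaussLp hβ (gaussDeriv β v))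
  have h3 := norm_add_le (gaussLp hβ (X * u)) (gaussLp hβ (X * v))
  calc _ ≤ ‖β‖ * (‖gaussLp hβ u‖ + ‖gaussLp hβ v‖) + √‖β‖ * (‖gaussLp hβ (gaussDeriv β u)‖ +
        ‖gaussLp hβ (gaussDeriv β v)‖) + √‖β‖ * (‖β‖ * (‖gaussLp hβ (X * u)‖ +
        ‖gaussLp hβ (X * v)‖)) := by gcongr
    _ = _ := by ring

theorem norm_mul_le_energyNorm {β : ℂ} (hβ : 0 < β.re) (u : ℂ[X]) :
    ‖β‖ * ‖gaussLp hβ u‖ ≤ energyNorm hβ u := by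
  rw [energyNorm, add_assoc]
  exact le_add_of_nonneg_right (by positivity)

theorem neg_ne_odd_mul {β : ℂ} (hβ : 0 < β.re) (k : ℕ) : -β ≠ (2 * k + 1) * β := by
  intro h
  have h1 : ((2 * k + 2 : ℕ) : ℂ) * β = 0 := by push_cast; linear_combination -h
  rcases mul_eq_zero.1 h1 with h2 | h2
  · exact absurd (Nat.cast_eq_zero.1 h2) (by omega)
  · rw [h2] at hβ; simp at hβ

theorem re_conj_mul_neg_self (β : ℂ) : (starRingEnd ℂ β * -β).re = -‖β‖ ^ 2 := by
  rw [mul_neg, mul_comm, mul_conj, normSq_eq_norm_sq, neg_re, ofReal_re]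

/-- One step down the ladder: an estimate at `z - 2β` yields one at `z`. -/
theorem LadderBound.step {β z : ℂ} (hβ : 0 < β.re) {c ε Γ K : ℝ} (hc : 0 < c) (hc1 : c ≤ 1)
    (hcβ : c * ‖β‖ ≤ β.re) (hε : 0 < ε) (hK : 0 ≤ K) (hΓ : 0 ≤ Γ)
    (h : LadderBound hβ (z - 2 * β) K) (hz : ε * ‖β‖ ≤ ‖z - β‖) (hzΓ : ‖z‖ ≤ Γ * ‖β‖) :
    LadderBound hβ z (3 / c * (1 + (1 + (Γ + 1) * ((K + 1) / ε)) * (1 + (Γ + 1) * (3 / c)))) := by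
  intro u f g hu
  have hb : 0 < ‖β‖ := hβ.trans_le (re_le_norm β)
  have hs : √‖β‖ * √‖β‖ = ‖β‖ := Real.mul_self_sqrt hb.le
  have hs0 : 0 < √‖β‖ := Real.sqrt_pos.2 hb
  have hbase : LadderBound hβ (-β) (3 / c) :=
    ladderBound_of_re_le hβ hc hc1 hcβ (re_conj_mul_neg_self β).le
  have hzβ : ‖z + β‖ ≤ (Γ + 1) * ‖β‖ := (norm_add_le _ _).trans (by linarith)
  -- The part Ag of the right-hand side is solved at -β, where coercivity needs no spectral gap.
  -- What remains for v = u - w is an L² right-hand side f'.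
  obtain ⟨w, hw⟩ := oscPoly_surjective (neg_ne_odd_mul hβ) (derivative g)
  have hwE := hbase w 0 g (by rw [hw, zero_add])
  rw [map_zero, norm_zero, zero_add] at hwE
  obtain ⟨v, rfl⟩ : ∃ v, u = v + w := ⟨u - w, by abel⟩
  set f' := f + (z + β) • w with hf'
  have hv : oscPoly β v - z • v = f' := by
    have e : oscPoly β v - z • v = oscPoly β (v + w) - z • (v + w) - (oscPoly β w - -β • w) +
        (z + β) • w := by
      rw [map_add]; module
    rw [e, hu, hw, hf']
    abel
  have hf'N : ‖gaussLp hβ f'‖ ≤ (1 + (Γ + 1) * (3 / c)) *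
      (‖gaussLp hβ f‖ + √‖β‖ * ‖gaussLp hβ g‖) := by
    have i1 : ‖gaussLp hβ f'‖ ≤ ‖gaussLp hβ f‖ + ‖z + β‖ * ‖gaussLp hβ w‖ := by
      rw [hf', map_add, map_smul, ← norm_smul]; exact norm_add_le _ _
    have i2 : ‖z + β‖ * ‖gaussLp hβ w‖ ≤ (Γ + 1) * (3 / c * (√‖β‖ * ‖gaussLp hβ g‖)) := by
      calc _ ≤ (Γ + 1) * ‖β‖ * ‖gaussLp hβ w‖ := by gcongr
        _ = (Γ + 1) * (‖β‖ * ‖gaussLp hβ w‖) := by ring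
        _ ≤ _ := mul_le_mul_of_nonneg_left ((norm_mul_le_energyNorm hβ w).trans hwE)
          (by positivity)
    have i3 : 0 ≤ (Γ + 1) * (3 / c) * ‖gaussLp hβ f‖ := by positivity
    nlinarith [norm_nonneg (gaussLp hβ g), mul_nonneg hs0.le (norm_nonneg (gaussLp hβ g))]
  -- Apply A to (H - z)v = f'. The new right-hand side is Af', which is why `LadderBound` must allow
  -- a derivative on the right.
  have hlow : oscPoly β (derivative v) - (z - 2 * β) • derivative v = 0 + derivative f' := by
    rw [← hv, map_sub, derivative_smul, derivative_oscPoly, sub_smul]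
    abel
  have hd := h _ _ _ hlow
  rw [map_zero, norm_zero, zero_add, energyNorm] at hd
  -- The factorization H = (-∂ + βx)A + β recovers v from Av. The gap |z - β| ≥ ε|β| is used here.
  have hzv : (z - β) • v = -gaussDeriv β (derivative v) + β • (X * derivative v) - f' := by
    rw [← hv, oscPoly_eq, gaussDeriv_apply, sub_smul]
    module
  have hvN : ε * (‖β‖ * ‖gaussLp hβ v‖) ≤ (K + 1) * ‖gaussLp hβ f'‖ := by
    have i1 : ‖z - β‖ * ‖gaussLp hβ v‖ ≤ ‖gaussLp hβ (gaussDeriv β (derivative v))‖ +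
        ‖β‖ * ‖gaussLp hβ (X * derivative v)‖ + ‖gaussLp hβ f'‖ := by
      rw [← norm_smul, ← map_smul, hzv, map_sub, map_add, map_neg, map_smul, ← norm_smul]
      refine (norm_sub_le _ _).trans (add_le_add_left ((norm_add_le _ _).trans ?_) _)
      rw [norm_neg]
    have i2 : √‖β‖ * (‖gaussLp hβ (gaussDeriv β (derivative v))‖ +
        ‖β‖ * ‖gaussLp hβ (X * derivative v)‖) ≤ √‖β‖ * (K * ‖gaussLp hβ f'‖) := by
      have : 0 ≤ ‖β‖ * ‖gaussLp hβ (derivative v)‖ := by positivity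
      linarith
    have i3 := le_of_mul_le_mul_left i2 hs0
    have i4 : ε * ‖β‖ * ‖gaussLp hβ v‖ ≤ ‖z - β‖ * ‖gaussLp hβ v‖ := by gcongr
    linarith
  have hvN' : ‖β‖ * ‖gaussLp hβ v‖ ≤ (K + 1) / ε * ‖gaussLp hβ f'‖ := by
    rw [div_mul_eq_mul_div, le_div_iff₀ hε]; linarith
  -- Once ‖v‖ is bounded, writing the equation at -β with right-hand side f' + (z + β)v upgrades the
  -- bound to the full energy norm.
  have hvE := hbase v (f' + (z + β) • v) 0 (by
    rw [derivative_zero, add_zero, ← hv]; module)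
  rw [map_zero, norm_zero, mul_zero, add_zero, map_add, map_smul] at hvE
  have hvE' : energyNorm hβ v ≤ 3 / c * ((1 + (Γ + 1) * ((K + 1) / ε)) * ‖gaussLp hβ f'‖) := by
    refine hvE.trans ?_
    gcongr
    refine (norm_add_le _ _).trans ?_
    rw [norm_smul]
    calc _ ≤ ‖gaussLp hβ f'‖ + (Γ + 1) * ‖β‖ * ‖gaussLp hβ v‖ := by gcongr
      _ = ‖gaussLp hβ f'‖ + (Γ + 1) * (‖β‖ * ‖gaussLp hβ v‖) := by ring
      _ ≤ ‖gaussLp hβ f'‖ + (Γ + 1) * ((K + 1) / ε * ‖gaussLp hβ f'‖) := by gcongr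
      _ = _ := by ring
  have hF : 0 ≤ ‖gaussLp hβ f‖ := norm_nonneg _
  calc _ ≤ energyNorm hβ v + energyNorm hβ w := energyNorm_add_le hβ _ _
    _ ≤ 3 / c * ((1 + (Γ + 1) * ((K + 1) / ε)) * ((1 + (Γ + 1) * (3 / c)) *
        (‖gaussLp hβ f‖ + √‖β‖ * ‖gaussLp hβ g‖))) +
        3 / c * (‖gaussLp hβ f‖ + √‖β‖ * ‖gaussLp hβ g‖) := by
      refine add_le_add (hvE'.trans ?_) (hwE.trans ?_)
      · gcongr
      · gcongr; linarith
    _ = _ := by ring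

/-- A bound on the resolvent of the oscillator, uniform on the region of the theorem. -/
theorem exists_ladderBound {c ε γ : ℝ} (hc : 0 < c) (hc1 : c ≤ 1) (hε : 0 < ε) (hγ : 0 < γ) :
    ∃ K : ℝ, 0 < K ∧ ∀ {β : ℂ} (hβ : 0 < β.re) (z : ℂ), c * ‖β‖ ≤ β.re → ‖z‖ ≤ γ * ‖β‖ →
      (∀ k : ℕ, ε * ‖β‖ ≤ ‖z - (2 * k + 1) * β‖) → LadderBound hβ z K := by
  -- After N shifts by 2β, the real part of the rotated parameter is at most (γ - 2N)|β|² ≤ -|β|²,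
  -- and the coercive case applies.
  obtain ⟨N, hN⟩ := exists_nat_ge (γ + 1)
  -- Induction on the number m of shifts left to make: the point z - 2jβ is treated with j = N - m,
  -- ending at j = 0.
  have key : ∀ m : ℕ, ∃ K : ℝ, 0 < K ∧ ∀ {β : ℂ} (hβ : 0 < β.re) (z : ℂ), c * ‖β‖ ≤ β.re →
      ‖z‖ ≤ γ * ‖β‖ → (∀ k : ℕ, ε * ‖β‖ ≤ ‖z - (2 * k + 1) * β‖) → ∀ j : ℕ, j + m = N →
      LadderBound hβ (z - 2 * j * β) K := by
    intro m
    induction m with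
    | zero =>
      refine ⟨3 / c, by positivity, fun {β} hβ z hcβ hz _ j hj => ?_⟩
      refine ladderBound_of_re_le hβ hc hc1 hcβ ?_
      have hb : 0 < ‖β‖ := hβ.trans_le (re_le_norm β)
      have e1 : (starRingEnd ℂ β * z).re ≤ ‖β‖ * (γ * ‖β‖) := by
        refine (re_le_norm _).trans ?_
        rw [norm_mul, norm_conj]; gcongr
      have e2 : (starRingEnd ℂ β * (z - 2 * j * β)).re =
          (starRingEnd ℂ β * z).re - 2 * j * ‖β‖ ^ 2 := by
        have : starRingEnd ℂ β * (z - 2 * j * β) =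
            starRingEnd ℂ β * z - ((2 * j * ‖β‖ ^ 2 : ℝ) : ℂ) := by
          push_cast
          rw [← ofReal_pow, ← normSq_eq_norm_sq, ← mul_conj]; ring
        rw [this, sub_re, ofReal_re]
      have e3 : (γ + 1) ≤ (j : ℝ) := by
        rw [add_zero] at hj; rwa [hj]
      rw [e2]
      nlinarith [sq_nonneg ‖β‖, mul_le_mul_of_nonneg_right e3 (sq_nonneg ‖β‖),
        mul_nonneg hγ.le (sq_nonneg ‖β‖)]
    | succ m ih =>
      obtain ⟨K, hK, ih⟩ := ih
      refine ⟨_, ?_, fun {β} hβ z hcβ hz hk j hj =>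
        LadderBound.step (K := K) (Γ := γ + 2 * N) hβ hc hc1 hcβ hε hK.le (by positivity) ?_ ?_ ?_⟩
      · positivity
      · have := ih hβ z hcβ hz hk (j + 1) (by omega)
        convert this using 1
        push_cast; ring
      · convert hk j using 2
        ring
      · have hjN : (j : ℝ) ≤ N := by exact_mod_cast (by omega : j ≤ N)
        have hb : 0 ≤ ‖β‖ := norm_nonneg β
        calc _ ≤ ‖z‖ + ‖2 * (j : ℂ) * β‖ := norm_sub_le _ _
          _ = ‖z‖ + 2 * j * ‖β‖ := by simp
          _ ≤ γ * ‖β‖ + 2 * N * ‖β‖ := by gcongr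
          _ = _ := by ring
  obtain ⟨K, hK, h⟩ := key N
  refine ⟨K, hK, fun {β} hβ z hcβ hz hk => ?_⟩
  simpa using h hβ z hcβ hz hk 0 (zero_add N)

end Grushin
end

/-! ### Density of polynomials times Gaussians, and the bilinear pairing. -/

noncomputable section

namespace Grushin

open Polynomial Complex Filter
open scoped FourierTransform Topology

/-- Write a test function as the Fourier transform of a Schwartz function and move the transform
onto K. -/
theorem ae_eq_zero_of_fourier_eq_zero {K : ℝ → ℂ} (hK : Integrable K) (h : ∀ ξ, 𝓕 K ξ = 0) :
    K =ᵐ[volume] 0 := by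
  refine ae_eq_zero_of_integral_contDiff_smul_eq_zero hK.locallyIntegrable fun g hg hgc => ?_
  have hG : ContDiff ℝ ((⊤ : ℕ∞) : WithTop ℕ∞) (fun x => (g x : ℂ)) := ofRealCLM.contDiff.comp hg
  have hGc : HasCompactSupport (fun x => (g x : ℂ)) := hgc.comp_left (g := ofReal) rfl
  let φ : SchwartzMap ℝ ℂ := hGc.toSchwartzMap hG
  have e : 𝓕 ((𝓕⁻ φ : SchwartzMap ℝ ℂ) : ℝ → ℂ) = φ := by
    rw [← SchwartzMap.fourier_coe, FourierTransform.fourier_fourierInv_eq]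
  have h1 : ∫ x, 𝓕 ((𝓕⁻ φ : SchwartzMap ℝ ℂ) : ℝ → ℂ) x • K x =
      ∫ x, (𝓕⁻ φ : SchwartzMap ℝ ℂ) x • 𝓕 K x := by
    have := VectorFourier.integral_fourierIntegral_smul_eq_flip (L := innerₗ ℝ)
      Real.continuous_fourierChar continuous_inner
      ((𝓕⁻ φ : SchwartzMap ℝ ℂ).integrable (μ := volume)) hK
    rwa [flip_innerₗ] at this
  rw [e] at h1
  simp only [h, smul_zero, integral_zero] at h1
  rw [← h1]
  rfl

/-- Completing the square: the Gaussian absorbs any exponential of |x| at the cost of a constant.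
This provides the dominating functions for exponential series. -/
theorem memLp_exp_abs_mul_gaussian {r : ℝ} (hr : 0 < r) (a : ℝ) :
    MemLp (fun x : ℝ => Real.exp (a * |x|) * Real.exp (-(r / 2) * x ^ 2)) 2 volume := by
  have hc : Continuous (fun x : ℝ => Real.exp (a * |x|) * Real.exp (-(r / 2) * x ^ 2)) := by
    fun_prop
  rw [memLp_two_iff_integrable_sq_norm hc.aestronglyMeasurable]
  have hi := (integrable_exp_neg_mul_sq (half_pos hr)).const_mul (Real.exp (2 * a ^ 2 / r))
  refine hi.mono' (hc.norm.pow 2).aestronglyMeasurable (ae_of_all _ fun x => ?_)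
  rw [← Real.exp_add, ← Real.exp_add, Real.norm_eq_abs, Real.norm_eq_abs, abs_pow, abs_abs,
    Real.abs_exp, ← Real.exp_nat_mul]
  apply Real.exp_le_exp.2
  have h0 : 0 ≤ (r * |x| - 2 * a) ^ 2 / (2 * r) := by positivity
  have h1 : (r * |x| - 2 * a) ^ 2 / (2 * r) =
      r / 2 * |x| ^ 2 - 2 * a * |x| + 2 * a ^ 2 / r := by
    field_simp; ring
  rw [h1, sq_abs] at h0
  push_cast
  linarith

theorem norm_cexp_gaussian (β : ℂ) (x : ℝ) :
    ‖cexp (-(β / 2) * (x : ℂ) ^ 2)‖ = Real.exp (-(β.re / 2) * x ^ 2) := by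
  rw [norm_exp, ← ofReal_pow, re_mul_ofReal]
  simp

/-- An `L²` function whose moments against a Gaussian all vanish is zero. -/
theorem ae_eq_zero_of_moments {β : ℂ} (hβ : 0 < β.re) {k : ℝ → ℂ} (hk : MemLp k 2 volume)
    (h : ∀ p : ℂ[X], ∫ x, gaussPoly β p x * k x = 0) : k =ᵐ[volume] 0 := by
  set K : ℝ → ℂ := fun x => cexp (-(β / 2) * (x : ℂ) ^ 2) * k x with hKdef
  have hdom : ∀ a : ℝ, Integrable (fun x => Real.exp (a * |x|) * ‖K x‖) := by
    intro a
    refine ((memLp_exp_abs_mul_gaussian hβ a).integrable_mul hk.norm).congr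
      (ae_of_all _ fun x => ?_)
    simp only [hKdef, Pi.mul_apply, norm_mul, norm_cexp_gaussian]
    ring
  have hKm : AEStronglyMeasurable K volume :=
    (by fun_prop : Continuous fun x : ℝ => cexp (-(β / 2) * (x : ℂ) ^ 2)).aestronglyMeasurable.mul
      hk.1
  have hKi : Integrable K := (integrable_norm_iff hKm).1 (by simpa using hdom 0)
  have hF : ∀ ξ, 𝓕 K ξ = 0 := by
    intro ξ
    rw [Real.fourier_real_eq_integral_exp_smul]
    set c : ℂ := -2 * Real.pi * ξ * I with hc
    -- The Fourier exponential is expanded in its Taylor series. The partial sums are dominated by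
    -- exp(‖c‖|x|), and each integrates to a combination of vanishing moments.
    have hlim : Tendsto (fun N : ℕ => ∫ x : ℝ, (∑ n ∈ Finset.range N,
        (c * x) ^ n / (n.factorial : ℂ)) * K x) atTop (𝓝 (∫ x : ℝ, cexp (c * x) * K x)) := by
      refine tendsto_integral_of_dominated_convergence
        (fun x => Real.exp (‖c‖ * |x|) * ‖K x‖) (fun N => ?_) (hdom _) (fun N => ?_) ?_
      · exact (by fun_prop : Continuous fun x : ℝ => ∑ n ∈ Finset.range N,
          (c * x) ^ n / (n.factorial : ℂ)).aestronglyMeasurable.mul hKm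
      · refine ae_of_all _ fun x => ?_
        rw [norm_mul]
        gcongr
        refine (norm_sum_le _ _).trans ?_
        refine le_trans (le_of_eq ?_) (Real.sum_le_exp_of_nonneg (by positivity) N)
        refine Finset.sum_congr rfl fun n _ => ?_
        simp
      · refine ae_of_all _ fun x => ?_
        refine Tendsto.mul_const _ ?_
        have := (NormedSpace.expSeries_div_hasSum_exp (c * x : ℂ)).tendsto_sum_nat
        rwa [← Complex.exp_eq_exp_ℂ] at this
    have hzero : ∀ N : ℕ, ∫ x : ℝ, (∑ n ∈ Finset.range N,
        (c * x) ^ n / (n.factorial : ℂ)) * K x = 0 := by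
      intro N
      rw [← h (∑ n ∈ Finset.range N, C (c ^ n / (n.factorial : ℂ)) * X ^ n)]
      congr 1; ext x
      simp only [gaussPoly, eval_finsetSum, eval_mul, eval_C, eval_pow, eval_X, hKdef]
      rw [← mul_assoc]
      congr 3
      ext n
      ring
    simp only [hzero] at hlim
    rw [tendsto_nhds_unique tendsto_const_nhds hlim]
    congr 1; ext x
    rw [smul_eq_mul, hc]
    congr 2
    push_cast
    ring
  filter_upwards [ae_eq_zero_of_fourier_eq_zero hKi hF] with x hx
  simpa [hKdef, exp_ne_zero] using hx

/-- An element of the orthogonal complement has a complex conjugate with vanishing moments; the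
conjugate appears because the moments are bilinear. -/
theorem denseRange_gaussLp {β : ℂ} (hβ : 0 < β.re) : DenseRange (gaussLp hβ) := by
  have : (LinearMap.range (gaussLp hβ)).topologicalClosure = ⊤ := by
    rw [Submodule.topologicalClosure_eq_top_iff, Submodule.eq_bot_iff]
    intro k hk
    rw [Submodule.mem_orthogonal'] at hk
    have h0 : star (k : ℝ → ℂ) =ᵐ[volume] 0 := by
      refine ae_eq_zero_of_moments hβ (Lp.memLp k).star fun p => ?_
      have := hk (gaussLp hβ p) ⟨p, rfl⟩
      rw [L2.inner_def] at this
      rw [← this]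
      apply integral_congr_ae
      filter_upwards [coeFn_gaussLp hβ p] with x hx
      rw [hx, RCLike.inner_apply]
      rfl
    rw [Lp.eq_zero_iff_ae_eq_zero]
    filter_upwards [h0] with x hx
    simpa using hx
  have hd := Submodule.dense_iff_topologicalClosure_eq_top.2 this
  rwa [LinearMap.coe_range] at hd

/-- The bilinear pairing `∫ u v` on `L²`. -/
def pairing (μ : Measure ℝ) : Lp ℂ 2 μ →L[ℂ] Lp ℂ 2 μ →L[ℂ] ℂ :=
  (ContinuousLinearMap.mul ℂ ℂ).lpPairing μ 2 2

theorem pairing_apply {μ : Measure ℝ} (u v : Lp ℂ 2 μ) : pairing μ u v = ∫ x, u x * v x ∂μ := by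
  rw [pairing, ContinuousLinearMap.lpPairing_eq_integral]; rfl

theorem pairing_comm {μ : Measure ℝ} (u v : Lp ℂ 2 μ) : pairing μ u v = pairing μ v u := by
  simp_rw [pairing_apply, mul_comm]

theorem pairing_toLp {μ : Measure ℝ} {f : ℝ → ℂ} (hf : MemLp f 2 μ) (v : Lp ℂ 2 μ) :
    pairing μ (hf.toLp f) v = ∫ x, f x * v x ∂μ := by
  rw [pairing_apply]
  apply integral_congr_ae
  filter_upwards [hf.coeFn_toLp] with x hx
  rw [hx]

theorem eq_zero_of_pairing_gaussLp {β : ℂ} (hβ : 0 < β.re) {k : L2R}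
    (h : ∀ p : ℂ[X], pairing volume (gaussLp hβ p) k = 0) : k = 0 := by
  rw [Lp.eq_zero_iff_ae_eq_zero]
  refine ae_eq_zero_of_moments hβ (Lp.memLp k) fun p => ?_
  rw [← h p]
  exact (pairing_toLp (memLp_gaussPoly hβ p) k).symm

end Grushin
end

/-! ### The oscillator on its distributional domain: resolvent and eigenvalues. -/

noncomputable section

namespace Grushin

open Polynomial Complex Filter
open scoped Topology ContDiff

/-! ### Cutoffs -/

/-- A smooth cutoff which is `1` on `[-1, 1]` and `0` outside of `(-2, 2)`. -/
def cutoff : ContDiffBump (0 : ℝ) := ⟨1, 2, one_pos, one_lt_two⟩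

theorem exists_cutoff_bound : ∃ M : ℝ, 0 < M ∧ ∀ x, |deriv cutoff x| ≤ M ∧
    |deriv (deriv cutoff) x| ≤ M := by
  have h : ContDiff ℝ 2 cutoff := cutoff.contDiff
  have h1 : ContDiff ℝ 1 (deriv cutoff) := ((contDiff_succ_iff_deriv (n := 1)).1 h).2.2
  obtain ⟨A, hA⟩ := h1.continuous.bounded_above_of_compact_support cutoff.hasCompactSupport.deriv
  obtain ⟨B, hB⟩ := (h1.continuous_deriv le_rfl).bounded_above_of_compact_support
    cutoff.hasCompactSupport.deriv.deriv
  refine ⟨max 1 (max A B), by positivity, fun x => ⟨(hA x).trans ?_, (hB x).trans ?_⟩⟩ <;> simp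

/-- The function `G` truncated to `|x| ≤ 2 / t`. -/
def truncate (t : ℝ) (G : ℝ → ℂ) (x : ℝ) : ℂ := (cutoff (t * x) : ℝ) * G x

theorem hasDerivAt_cutoff_mul (t x : ℝ) :
    HasDerivAt (fun y : ℝ => ((cutoff (t * y) : ℝ) : ℂ)) ((t * deriv cutoff (t * x) : ℝ) : ℂ) x := by
  have h := (cutoff.contDiff (n := 1)).differentiable one_ne_zero (t * x)
  have h2 := h.hasDerivAt.comp x ((hasDerivAt_id x).const_mul t)
  rw [mul_one, mul_comm] at h2
  exact h2.ofReal_comp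

theorem hasDerivAt_deriv_cutoff_mul (t x : ℝ) :
    HasDerivAt (fun y : ℝ => ((t * deriv cutoff (t * y) : ℝ) : ℂ))
      ((t ^ 2 * deriv (deriv cutoff) (t * x) : ℝ) : ℂ) x := by
  have hc : ContDiff ℝ 1 (deriv cutoff) :=
    ((contDiff_succ_iff_deriv (n := 1)).1 (cutoff.contDiff (n := 2))).2.2
  have h := hc.differentiable one_ne_zero (t * x)
  have h2 := (h.hasDerivAt.comp x ((hasDerivAt_id x).const_mul t)).const_mul t
  have h3 : t * (deriv (deriv cutoff) (t * x) * (t * 1)) = t ^ 2 * deriv (deriv cutoff) (t * x) := by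
    ring
  rw [h3] at h2
  exact h2.ofReal_comp

theorem hasDerivAt_truncate {t : ℝ} {G : ℝ → ℂ} {G' : ℂ} {x : ℝ} (hG : HasDerivAt G G' x) :
    HasDerivAt (truncate t G)
      ((t * deriv cutoff (t * x) : ℝ) * G x + (cutoff (t * x) : ℝ) * G') x :=
  (hasDerivAt_cutoff_mul t x).mul hG

theorem deriv_truncate_gaussPoly (t : ℝ) (β : ℂ) (p : ℂ[X]) :
    deriv (truncate t (gaussPoly β p)) = fun x => (t * deriv cutoff (t * x) : ℝ) * gaussPoly β p x +
      (cutoff (t * x) : ℝ) * gaussPoly β (gaussDeriv β p) x :=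
  funext fun x => (hasDerivAt_truncate (hasDerivAt_gaussPoly β p x)).deriv

theorem deriv_deriv_truncate_gaussPoly (t : ℝ) (β : ℂ) (p : ℂ[X]) (x : ℝ) :
    deriv (deriv (truncate t (gaussPoly β p))) x =
      (t ^ 2 * deriv (deriv cutoff) (t * x) : ℝ) * gaussPoly β p x +
      2 * ((t * deriv cutoff (t * x) : ℝ) * gaussPoly β (gaussDeriv β p) x) +
      (cutoff (t * x) : ℝ) * gaussPoly β (gaussDeriv β (gaussDeriv β p)) x := by
  rw [deriv_truncate_gaussPoly]
  have h := ((hasDerivAt_deriv_cutoff_mul t x).mul (hasDerivAt_gaussPoly β p x)).add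
    (hasDerivAt_truncate (t := t) (hasDerivAt_gaussPoly β (gaussDeriv β p) x))
  refine h.deriv.trans ?_
  ring

theorem contDiff_truncate {t : ℝ} {G : ℝ → ℂ} (hG : ContDiff ℝ ∞ G) :
    ContDiff ℝ ∞ (truncate t G) :=
  (ofRealCLM.contDiff.comp (cutoff.contDiff.comp (contDiff_const.mul contDiff_id))).mul hG

theorem tsupport_truncate_subset {t : ℝ} (ht : 0 < t) (G : ℝ → ℂ) :
    tsupport (truncate t G) ⊆ Icc (-(2 / t)) (2 / t) := by
  refine closure_minimal (fun x hx => ?_) isClosed_Icc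
  rw [mem_Icc, ← abs_le]
  by_contra! h
  refine hx ?_
  have : cutoff (t * x) = 0 := cutoff.zero_of_le_dist (by
    rw [Real.dist_eq, sub_zero, abs_mul, abs_of_pos ht, mul_comm]
    exact ((div_lt_iff₀ ht).1 h).le)
  simp [truncate, this]

theorem hasCompactSupport_truncate {t : ℝ} (ht : 0 < t) (G : ℝ → ℂ) :
    HasCompactSupport (truncate t G) :=
  isCompact_Icc.of_isClosed_subset (isClosed_tsupport _) (tsupport_truncate_subset ht G)

/-- A truncated Gaussian as a test function. -/
def truncTest {Ω : Opens ℝ} {t : ℝ} (ht : 0 < t) (hΩ : Icc (-(2 / t)) (2 / t) ⊆ (Ω : Set ℝ)) (β : ℂ)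
    (p : ℂ[X]) : 𝓓(Ω, ℂ) :=
  ⟨truncate t (gaussPoly β p), contDiff_truncate (contDiff_gaussPoly β p),
    hasCompactSupport_truncate ht _, (tsupport_truncate_subset ht _).trans hΩ⟩

/-! ### Resolvents in terms of graphs -/

/-- Both operators are defined through their graphs, so this form lets resolvent identities be
checked without elements of the domain. -/
theorem isResolventOp_iff {E : Type*} [NormedAddCommGroup E] [NormedSpace ℂ E] (A : E →ₗ.[ℂ] E)
    (z : ℂ) (R : E →L[ℂ] E) : IsResolventOp A z R ↔
      (∀ u f, (u, f) ∈ A.graph → R (f - z • u) = u) ∧ ∀ f, (R f, f + z • R f) ∈ A.graph := by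
  constructor
  · rintro ⟨h1, h2⟩
    refine ⟨fun u f h => ?_, fun f => ?_⟩
    · obtain ⟨y, hy, hf⟩ := (LinearPMap.mem_graph_iff A).1 h
      have := h1 y
      rwa [hf, hy] at this
    · obtain ⟨u, hu, hf⟩ := h2 f
      refine (LinearPMap.mem_graph_iff A).2 ⟨u, hu, ?_⟩
      simp only
      rw [← hu]
      exact sub_eq_iff_eq_add.1 hf
  · rintro ⟨h1, h2⟩
    refine ⟨fun u => h1 _ _ (A.mem_graph u), fun f => ?_⟩
    obtain ⟨u, hu, hf⟩ := (LinearPMap.mem_graph_iff A).1 (h2 f)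
    refine ⟨u, hu, ?_⟩
    simp only at hu hf
    rw [hf, hu, add_sub_cancel_right]

/-! ### The resolvent of the oscillator -/

/-- The integrand difference is the derivative of φ'G - φG', which has compact support. -/
theorem integral_deriv_deriv_mul_comm {φ G G' G'' : ℝ → ℂ} (hφ : ContDiff ℝ 2 φ)
    (hφc : HasCompactSupport φ) (hG : ∀ x, HasDerivAt G (G' x) x)
    (hG' : ∀ x, HasDerivAt G' (G'' x) x) (hG'' : Continuous G'') :
    ∫ x, deriv (deriv φ) x * G x = ∫ x, φ x * G'' x := by
  have hφ1 : ContDiff ℝ 1 (deriv φ) := ((contDiff_succ_iff_deriv (n := 1)).1 hφ).2.2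
  have hGc : Continuous G := continuous_iff_continuousAt.2 fun x => (hG x).continuousAt
  have hGc' : Continuous G' := continuous_iff_continuousAt.2 fun x => (hG' x).continuousAt
  have i1 : Integrable (fun x => deriv (deriv φ) x * G x) :=
    ((hφ1.continuous_deriv le_rfl).mul hGc).integrable_of_hasCompactSupport
      hφc.deriv.deriv.mul_right
  have i2 : Integrable (fun x => φ x * G'' x) :=
    (hφ.continuous.mul hG'').integrable_of_hasCompactSupport hφc.mul_right
  have i3 : Integrable (fun x => deriv φ x * G x - φ x * G' x) :=
    ((hφ1.continuous.mul hGc).integrable_of_hasCompactSupport hφc.deriv.mul_right).sub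
      ((hφ.continuous.mul hGc').integrable_of_hasCompactSupport hφc.mul_right)
  have := integral_eq_zero_of_hasDerivAt_of_integrable (fun x => ?_) (i1.sub i2) i3
  · simp only [Pi.sub_apply] at this
    rwa [integral_sub i1 i2, sub_eq_zero] at this
  · have h1 := ((hφ1.differentiable one_ne_zero x).hasDerivAt.mul (hG x)).sub
      ((hφ.differentiable (by norm_num) x).hasDerivAt.mul (hG' x))
    refine h1.congr_deriv ?_
    simp only [Pi.sub_apply]
    ring

theorem contDiff_two_testFunction {Ω : Opens ℝ} (φ : 𝓓(Ω, ℂ)) : ContDiff ℝ 2 φ :=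
  φ.contDiff.of_le (WithTop.coe_le_coe.2 (le_top : (2 : ℕ∞) ≤ ⊤))

theorem gaussLp_mem_oscillatorGraph {β : ℂ} (hβ : 0 < β.re) (p : ℂ[X]) :
    (gaussLp hβ p, gaussLp hβ (oscPoly β p)) ∈ oscillatorGraph β := by
  intro φ
  have hφ := contDiff_two_testFunction φ
  have e1 : ∫ x : ℝ, (-deriv (deriv φ) x + β ^ 2 * (x : ℂ) ^ 2 * φ x) * gaussLp hβ p x =
      ∫ x : ℝ, (β ^ 2 * (x : ℂ) ^ 2 * φ x * gaussPoly β p x -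
        deriv (deriv φ) x * gaussPoly β p x) := by
    apply integral_congr_ae
    filter_upwards [coeFn_gaussLp hβ p] with x hx
    rw [hx]; ring
  have e2 : ∫ x : ℝ, φ x * gaussLp hβ (oscPoly β p) x =
      ∫ x : ℝ, (β ^ 2 * (x : ℂ) ^ 2 * φ x * gaussPoly β p x -
        φ x * gaussPoly β (gaussDeriv β (gaussDeriv β p)) x) := by
    apply integral_congr_ae
    filter_upwards [coeFn_gaussLp hβ (oscPoly β p)] with x hx
    rw [hx, gaussPoly_oscPoly]
    ring
  have i1 : Integrable (fun x : ℝ => β ^ 2 * (x : ℂ) ^ 2 * φ x * gaussPoly β p x) := by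
    refine Continuous.integrable_of_hasCompactSupport ?_
      (φ.hasCompactSupport.mul_left.mul_right)
    have := continuous_gaussPoly β p
    have := φ.continuous
    fun_prop
  have i2 : Integrable (fun x : ℝ => deriv (deriv φ) x * gaussPoly β p x) :=
    ((testFunction_continuous_deriv2 φ).mul
      (continuous_gaussPoly β p)).integrable_of_hasCompactSupport
      φ.hasCompactSupport.deriv.deriv.mul_right
  have i3 : Integrable (fun x : ℝ => φ x * gaussPoly β (gaussDeriv β (gaussDeriv β p)) x) :=
    (φ.continuous.mul (continuous_gaussPoly β _)).integrable_of_hasCompactSupport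
      φ.hasCompactSupport.mul_right
  simp only
  rw [e1, e2, integral_sub i1 i2, integral_sub i1 i3,
    integral_deriv_deriv_mul_comm hφ φ.hasCompactSupport (hasDerivAt_gaussPoly β p)
      (hasDerivAt_gaussPoly β _) (continuous_gaussPoly β _)]

theorem integrable_gaussPoly_mul {β : ℂ} (hβ : 0 < β.re) (p : ℂ[X]) (u : L2R) :
    Integrable (fun x => gaussPoly β p x * u x) :=
  (memLp_gaussPoly hβ p).integrable_mul (Lp.memLp u)

theorem tendsto_cutoff (x : ℝ) :
    Tendsto (fun n : ℕ => ((cutoff (1 / (n + 1 : ℝ) * x) : ℝ) : ℂ)) atTop (𝓝 1) := by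
  have h1 : Tendsto (fun n : ℕ => 1 / (n + 1 : ℝ) * x) atTop (𝓝 (0 * x)) :=
    tendsto_one_div_add_atTop_nhds_zero_nat.mul_const x
  rw [zero_mul] at h1
  have h2 := ((continuous_ofReal.comp cutoff.continuous).tendsto 0).comp h1
  have h3 : (cutoff 0 : ℝ) = 1 := cutoff.one_of_mem_closedBall (by simp [cutoff])
  simpa [Function.comp_def, h3] using h2

theorem abs_cutoff_le_one (x : ℝ) : |cutoff x| ≤ 1 := by
  rw [abs_of_nonneg cutoff.nonneg]; exact cutoff.le_one

/-- Test functions in the definition of the oscillator may be replaced by polynomials times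
Gaussians. -/
theorem pairing_oscPoly {β : ℂ} (hβ : 0 < β.re) {u f : L2R} (h : (u, f) ∈ oscillatorGraph β)
    (p : ℂ[X]) : pairing volume (gaussLp hβ (oscPoly β p)) u = pairing volume (gaussLp hβ p) f := by
  obtain ⟨M, hM, hMb⟩ := exists_cutoff_bound
  have ht : ∀ n : ℕ, (0 : ℝ) < 1 / (n + 1 : ℝ) := fun n => Nat.one_div_pos_of_nat
  have ht1 : ∀ n : ℕ, 1 / (n + 1 : ℝ) ≤ 1 := fun n => by
    rw [div_le_one (by positivity)]; linarith [(Nat.cast_nonneg n : (0 : ℝ) ≤ n)]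
  have hlim0 := tendsto_one_div_add_atTop_nhds_zero_nat (𝕜 := ℝ)
  let φ : ℕ → 𝓓((⊤ : Opens ℝ), ℂ) := fun n => truncTest (ht n) (subset_univ _) β p
  have hφ : ∀ n, ⇑(φ n) = truncate (1 / (n + 1 : ℝ)) (gaussPoly β p) := fun n => rfl
  have e1 : pairing volume (gaussLp hβ (oscPoly β p)) u =
      ∫ x, gaussPoly β (oscPoly β p) x * u x := pairing_toLp (memLp_gaussPoly hβ _) u
  have e2 : pairing volume (gaussLp hβ p) f = ∫ x, gaussPoly β p x * f x :=
    pairing_toLp (memLp_gaussPoly hβ _) f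
  have l2 : Tendsto (fun n => ∫ x : ℝ, φ n x * f x) atTop (𝓝 (∫ x, gaussPoly β p x * f x)) := by
    refine tendsto_integral_of_dominated_convergence (fun x => ‖gaussPoly β p x * f x‖)
      (fun n => ((φ n).continuous.aestronglyMeasurable.mul (Lp.aestronglyMeasurable f)))
      (integrable_gaussPoly_mul hβ p f).norm (fun n => ae_of_all _ fun x => ?_)
      (ae_of_all _ fun x => ?_)
    · rw [hφ, truncate, mul_assoc, norm_mul, norm_real]
      exact mul_le_of_le_one_left (norm_nonneg _) (abs_cutoff_le_one _)
    · have := (tendsto_cutoff x).mul_const (gaussPoly β p x * f x)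
      rw [one_mul] at this
      simpa only [hφ, truncate, mul_assoc] using this
  have l1 : Tendsto (fun n => ∫ x : ℝ,
      (-deriv (deriv (φ n)) x + β ^ 2 * (x : ℂ) ^ 2 * φ n x) * u x) atTop
      (𝓝 (∫ x, gaussPoly β (oscPoly β p) x * u x)) := by
    set D1 := gaussDeriv β p with hD1
    -- The commutator of the oscillator with the cutoff produces only the terms t²χ''(tx) and
    -- 2tχ'(tx), with t = 1/(n + 1). They tend to zero under a fixed integrable bound.
    have e : ∀ (n : ℕ) (x : ℝ), (-deriv (deriv (φ n)) x + β ^ 2 * (x : ℂ) ^ 2 * φ n x) * u x =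
        (cutoff (1 / (n + 1 : ℝ) * x) : ℝ) * (gaussPoly β (oscPoly β p) x * u x) -
        ((1 / (n + 1 : ℝ)) ^ 2 * deriv (deriv cutoff) (1 / (n + 1 : ℝ) * x) : ℝ) *
          (gaussPoly β p x * u x) -
        (2 * (1 / (n + 1 : ℝ) * deriv cutoff (1 / (n + 1 : ℝ) * x)) : ℝ) *
          (gaussPoly β D1 x * u x) := by
      intro n x
      rw [hφ, deriv_deriv_truncate_gaussPoly, truncate, gaussPoly_oscPoly, ← hD1]
      push_cast
      ring
    refine tendsto_integral_of_dominated_convergence (fun x =>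
      ‖gaussPoly β (oscPoly β p) x * u x‖ + M * ‖gaussPoly β p x * u x‖ +
        2 * M * ‖gaussPoly β D1 x * u x‖)
      (fun n => (oscillator_testFunction β (φ n)).1.aestronglyMeasurable.mul
        (Lp.aestronglyMeasurable u)) ?_ (fun n => ae_of_all _ fun x => ?_) (ae_of_all _ fun x => ?_)
    · exact ((integrable_gaussPoly_mul hβ _ u).norm.add
        ((integrable_gaussPoly_mul hβ _ u).norm.const_mul M)).add
        ((integrable_gaussPoly_mul hβ _ u).norm.const_mul (2 * M))
    · rw [e]
      refine (norm_sub_le _ _).trans (add_le_add ((norm_sub_le _ _).trans (add_le_add ?_ ?_)) ?_)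
      · rw [norm_mul, norm_real]
        exact mul_le_of_le_one_left (norm_nonneg _) (abs_cutoff_le_one _)
      · rw [norm_mul, norm_real, Real.norm_eq_abs, abs_mul, abs_of_pos (pow_pos (ht n) 2)]
        refine mul_le_mul_of_nonneg_right ?_ (norm_nonneg _)
        exact (mul_le_of_le_one_left (abs_nonneg _) (pow_le_one₀ (ht n).le (ht1 n))).trans
          (hMb _).2
      · rw [norm_mul, norm_real, Real.norm_eq_abs, abs_mul, abs_mul, abs_of_pos (ht n),
          abs_of_pos two_pos]
        refine mul_le_mul_of_nonneg_right (mul_le_mul_of_nonneg_left ?_ zero_le_two) (norm_nonneg _)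
        exact (mul_le_of_le_one_left (abs_nonneg _) (ht1 n)).trans (hMb _).1
    · simp only [e]
      have a1 := (tendsto_cutoff x).mul_const (gaussPoly β (oscPoly β p) x * u x)
      have b2 : Tendsto (fun n : ℕ => (1 / (n + 1 : ℝ)) ^ 2 *
          deriv (deriv cutoff) (1 / (n + 1 : ℝ) * x)) atTop (𝓝 0) := by
        refine bdd_le_mul_tendsto_zero' M (Eventually.of_forall fun n => (hMb _).2) ?_ |>.congr
          fun n => mul_comm _ _
        simpa using hlim0.pow 2
      have b3 : Tendsto (fun n : ℕ => 2 * (1 / (n + 1 : ℝ) *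
          deriv cutoff (1 / (n + 1 : ℝ) * x))) atTop (𝓝 (2 * 0)) := by
        refine (bdd_le_mul_tendsto_zero' M (Eventually.of_forall fun n => (hMb _).1) ?_ |>.congr
          fun n => mul_comm _ _).const_mul 2
        simpa using hlim0
      have a2 := ((continuous_ofReal.tendsto 0).comp b2).mul_const (gaussPoly β p x * u x)
      have a3 := ((continuous_ofReal.tendsto _).comp b3).mul_const (gaussPoly β D1 x * u x)
      have := (a1.sub a2).sub a3
      simpa [Function.comp_def] using this
  rw [e1, e2]
  refine tendsto_nhds_unique l1 (l2.congr fun n => ?_)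
  exact (h (φ n)).symm

theorem isClosed_oscillatorGraph (β : ℂ) : IsClosed (oscillatorGraph β : Set (L2R × L2R)) := by
  have : (oscillatorGraph β : Set (L2R × L2R)) = ⋂ φ : 𝓓((⊤ : Opens ℝ), ℂ),
      {p | pairing volume (((oscillator_testFunction β φ).1.memLp_of_hasCompactSupport
        (oscillator_testFunction β φ).2).toLp _) p.1 =
        pairing volume ((φ.continuous.memLp_of_hasCompactSupport
          φ.hasCompactSupport).toLp _) p.2} := by
    ext p
    simp only [mem_iInter, mem_ofPred_eq, pairing_toLp]
    rfl
  rw [this]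
  exact isClosed_iInter fun φ => isClosed_eq (by fun_prop) (by fun_prop)

/-- The resolvent of the oscillator exists, with the bound coming from the ladder estimate. -/
theorem LadderBound.exists_isResolventOp {β z : ℂ} (hβ : 0 < β.re) {K : ℝ} (hK : 0 < K)
    (h : LadderBound hβ z K) (hz : ∀ k : ℕ, z ≠ (2 * k + 1) * β) :
    ∃ R : L2R →L[ℂ] L2R, IsResolventOp (oscillatorOp β) z R ∧ ‖R‖ ≤ K / ‖β‖ := by
  have hb : 0 < ‖β‖ := hβ.trans_le (re_le_norm β)
  set e : ℂ[X] →ₗ[ℂ] L2R := gaussLp hβ ∘ₗ (oscPoly β - z • LinearMap.id) with he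
  have heq : ∀ p, e p = gaussLp hβ (oscPoly β p) - z • gaussLp hβ p := fun p => by simp [he]
  have hsurj : ∀ p, ∃ r, e r = gaussLp hβ p := fun p => by
    obtain ⟨u, hu⟩ := oscPoly_surjective hz p
    exact ⟨u, by rw [heq, ← hu, map_sub, map_smul]⟩
  have hdense : DenseRange e := by
    refine (denseRange_gaussLp hβ).mono ?_
    rintro _ ⟨p, rfl⟩
    exact hsurj p
  have hnorm : ∀ p, ‖gaussLp hβ p‖ ≤ K / ‖β‖ * ‖e p‖ := fun p => by
    have h1 := h p (oscPoly β p - z • p) 0 (by simp)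
    rw [map_zero, norm_zero, mul_zero, add_zero, map_sub, map_smul, ← heq] at h1
    rw [div_mul_eq_mul_div, le_div_iff₀ hb, mul_comm]
    exact (norm_mul_le_energyNorm hβ p).trans h1
  -- The inverse is defined on the dense range of H - z over polynomials times Gaussians, where the
  -- ladder estimate bounds it, and extended by continuity. Closedness of the graph makes it a right
  -- inverse.
  set R : L2R →L[ℂ] L2R := (gaussLp hβ).extendOfNorm e with hR
  have hRe : ∀ p, R (e p) = gaussLp hβ p := LinearMap.extendOfNorm_eq hdense ⟨_, hnorm⟩
  have hgraph : ∀ f, (R f, f + z • R f) ∈ oscillatorGraph β := by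
    intro f
    refine hdense.induction_on (p := fun f => (R f, f + z • R f) ∈ oscillatorGraph β) f ?_ ?_
    · exact (isClosed_oscillatorGraph β).preimage (by fun_prop)
    · intro p
      rw [hRe, heq, sub_add_cancel]
      exact gaussLp_mem_oscillatorGraph hβ p
  refine ⟨R, (isResolventOp_iff _ _ _).2 ⟨fun u f huf => ?_, ?_⟩,
    LinearMap.opNorm_extendOfNorm_le hdense (by positivity) hnorm⟩
  · rw [oscillatorOp_graph] at huf
    set v := R (f - z • u) with hv
    -- For the left inverse, u - v solves the homogeneous equation. By symmetry it pairs to zero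
    -- with the range of H - z, which contains every polynomial times Gaussian.
    have hw := (oscillatorGraph β).sub_mem huf (hgraph (f - z • u))
    rw [← hv, Prod.mk_sub_mk] at hw
    have hw2 : f - (f - z • u + z • v) = z • (u - v) := by module
    rw [hw2] at hw
    refine (sub_eq_zero.1 (eq_zero_of_pairing_gaussLp hβ fun p => ?_)).symm
    obtain ⟨r, hr⟩ := hsurj p
    rw [← hr, heq, map_sub (pairing volume), map_smul (pairing volume), sub_apply, smul_apply,
      pairing_oscPoly hβ hw, map_smul, sub_self]
  · rw [oscillatorOp_graph]; exact hgraph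

theorem gaussLp_injective {β : ℂ} (hβ : 0 < β.re) : Function.Injective (gaussLp hβ) := by
  rw [injective_iff_map_eq_zero]
  intro p hp
  have h1 : gaussPoly β p =ᵐ[volume] fun _ => 0 := by
    filter_upwards [coeFn_gaussLp hβ p, (Lp.eq_zero_iff_ae_eq_zero).1 hp] with x h1 h2
    rw [← h1, h2]; rfl
  have h2 := (Continuous.ae_eq_iff_eq volume (continuous_gaussPoly β p) continuous_const).1 h1
  refine p.eq_zero_of_infinite_isRoot ((infinite_range_of_injective ofReal_injective).mono ?_)
  rintro _ ⟨x, rfl⟩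
  have h3 := congrFun h2 x
  simpa [gaussPoly, exp_ne_zero] using h3

/-- The creation operator p ↦ 2βXp - p' raises the eigenvalue by 2β. It does not kill p, because
differentiating its value returns (2k + 2)βp. -/
theorem exists_oscPoly_eigenvector {β : ℂ} (hβ : 0 < β.re) (k : ℕ) :
    ∃ p : ℂ[X], p ≠ 0 ∧ oscPoly β p = ((2 * k + 1) * β) • p := by
  have hβ0 : β ≠ 0 := fun h => by simp [h] at hβ
  induction k with
  | zero => exact ⟨1, one_ne_zero, by simp [oscPoly_eq]⟩
  | succ k ih =>
    obtain ⟨p, hp, h⟩ := ih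
    have hd : derivative ((2 * β) • (X * p) - derivative p) = oscPoly β p + β • p := by
      rw [oscPoly_eq, derivative_sub, derivative_smul, derivative_mul, derivative_X, one_mul]
      module
    refine ⟨(2 * β) • (X * p) - derivative p, fun h0 => hp ?_, ?_⟩
    · rw [h0, derivative_zero, h, ← add_smul] at hd
      refine (smul_eq_zero.1 hd.symm).resolve_left ?_
      have : (2 * k + 1) * β + β = ((2 * k + 2 : ℕ) : ℂ) * β := by push_cast; ring
      rw [this]
      exact mul_ne_zero (Nat.cast_ne_zero.2 (by omega)) hβ0
    · rw [oscPoly_eq, hd, derivative_add, h, derivative_smul, derivative_smul]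
      push_cast
      simp only [mul_add, mul_smul_comm, smul_add, smul_sub, smul_smul]
      module

theorem odd_mul_mem_opSpectrum {β : ℂ} (hβ : 0 < β.re) (k : ℕ) :
    (2 * k + 1) * β ∈ opSpectrum (oscillatorOp β) := by
  rintro ⟨R, hR⟩
  obtain ⟨p, hp, h⟩ := exists_oscPoly_eigenvector hβ k
  have hg := gaussLp_mem_oscillatorGraph hβ p
  rw [h, map_smul, ← oscillatorOp_graph] at hg
  have := ((isResolventOp_iff _ _ _).1 hR).1 _ _ hg
  rw [sub_self, map_zero] at this
  exact hp (gaussLp_injective hβ (by rw [← this, map_zero]))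

end Grushin
end

/-! ### The Dirichlet operator: weak form, energy estimate and base resolvent. -/

noncomputable section

namespace Grushin

open Complex Filter
open scoped Topology ContDiff

/-! ### A complex Lax–Milgram lemma -/

/-- V plays the role of H¹₀, as pairs of a function and its derivative. The form is coercive after
rotation by τ: the derivative part by `hτc`, the order-zero part by `hM`. The compression of M × id
to V is therefore invertible. -/
theorem exists_variational_solution {E : Type*} [NormedAddCommGroup E] [InnerProductSpace ℂ E]
    [CompleteSpace E] (V : Submodule ℂ (E × E)) (hV : IsClosed (V : Set (E × E))) (M : E →L[ℂ] E)
    {τ : ℂ} {c : ℝ} (hτ : ‖τ‖ ≤ 1) (hc : 0 < c) (hτc : c ≤ τ.re)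
    (hM : ∀ u, c * ‖u‖ ^ 2 ≤ (τ * inner ℂ u (M u)).re) :
    ∃ T : E →L[ℂ] E × E, ∀ f, T f ∈ V ∧
      ∀ w ∈ V, inner ℂ w.2 (T f).2 + inner ℂ w.1 (M (T f).1) = inner ℂ w.1 f := by
  -- The product norm on E × E is a supremum; adjoints need the Hilbert norm.
  let L := WithLp.prodContinuousLinearEquiv 2 ℂ E E
  let V' : Submodule ℂ (WithLp 2 (E × E)) := V.comap (L : WithLp 2 (E × E) →ₗ[ℂ] E × E)
  have hV' : IsClosed (V' : Set (WithLp 2 (E × E))) := hV.preimage L.continuous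
  have : CompleteSpace V' := hV'.completeSpace_coe
  let J : V' →L[ℂ] WithLp 2 (E × E) := V'.subtypeL
  let N : WithLp 2 (E × E) →L[ℂ] WithLp 2 (E × E) :=
    (L.symm : E × E →L[ℂ] WithLp 2 (E × E)) ∘L
      ((M.prodMap (ContinuousLinearMap.id ℂ E)) ∘L (L : WithLp 2 (E × E) →L[ℂ] E × E))
  let A : V' →L[ℂ] V' := (ContinuousLinearMap.adjoint J) ∘L (N ∘L J)
  have hA : ∀ w u : V', inner ℂ w (A u) = inner ℂ (w : WithLp 2 (E × E)).fst
      (M (u : WithLp 2 (E × E)).fst) + inner ℂ (w : WithLp 2 (E × E)).snd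
      (u : WithLp 2 (E × E)).snd := by
    intro w u
    change inner ℂ w (ContinuousLinearMap.adjoint J (N (J u))) = _
    rw [ContinuousLinearMap.adjoint_inner_right, WithLp.prod_inner_apply]
    rfl
  have hunit : IsUnit A := by
    refine ContinuousLinearMap.isUnit_of_forall_le_norm_inner_map A (c := ⟨c, hc.le⟩) hc
      fun u => ?_
    rw [norm_inner_symm]
    have e1 : ‖u‖ ^ 2 = ‖(u : WithLp 2 (E × E)).fst‖ ^ 2 + ‖(u : WithLp 2 (E × E)).snd‖ ^ 2 :=
      WithLp.prod_norm_sq_eq_of_L2 _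
    have e2 : c * ‖u‖ ^ 2 ≤ (τ * inner ℂ u (A u)).re := by
      rw [hA, mul_add, add_re, e1, mul_add]
      refine add_le_add (hM _) ?_
      rw [inner_self_eq_norm_sq_to_K]
      have : ((‖(u : WithLp 2 (E × E)).snd‖ : ℝ) : ℂ) ^ 2 =
        ((‖(u : WithLp 2 (E × E)).snd‖ ^ 2 : ℝ) : ℂ) := by push_cast; rfl
      change _ ≤ (τ * ((‖(u : WithLp 2 (E × E)).snd‖ : ℝ) : ℂ) ^ 2).re
      rw [this, re_mul_ofReal]
      gcongr
    calc _ = c * ‖u‖ ^ 2 := mul_comm _ _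
      _ ≤ _ := e2
      _ ≤ _ := re_le_norm _
      _ ≤ _ := by rw [norm_mul]; exact mul_le_of_le_one_left (norm_nonneg _) hτ
  obtain ⟨B, hB⟩ := hunit.exists_right_inv
  let T : E →L[ℂ] E × E := (L : WithLp 2 (E × E) →L[ℂ] E × E) ∘L (J ∘L (B ∘L
    ((ContinuousLinearMap.adjoint J) ∘L ((L.symm : E × E →L[ℂ] WithLp 2 (E × E)) ∘L
      (ContinuousLinearMap.inl ℂ E E)))))
  refine ⟨T, fun f => ⟨(B (ContinuousLinearMap.adjoint J (L.symm (f, 0)))).2, fun w hw => ?_⟩⟩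
  set y := ContinuousLinearMap.adjoint J (L.symm (f, 0)) with hy
  have h1 : A (B y) = y := by
    have := congrArg (fun Z : V' →L[ℂ] V' => Z y) hB
    simpa using this
  have h2 := hA ⟨L.symm w, by simpa [V'] using hw⟩ (B y)
  rw [h1, hy, ContinuousLinearMap.adjoint_inner_right, WithLp.prod_inner_apply] at h2
  change inner ℂ w.1 f + inner ℂ w.2 0 = inner ℂ w.1 (M (T f).1) + inner ℂ w.2 (T f).2 at h2
  rw [inner_zero_right, add_zero] at h2
  rw [h2, add_comm]

/-! ### Test functions in `L²` and the closure of their graph -/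

/-- A test function as an element of `L²`. -/
def testLp {Ω : Opens ℝ} (φ : 𝓓(Ω, ℂ)) : L2 Ω :=
  (φ.continuous.memLp_of_hasCompactSupport φ.hasCompactSupport).toLp φ

/-- The derivative of a test function as an element of `L²`. -/
def derivTestLp {Ω : Opens ℝ} (φ : 𝓓(Ω, ℂ)) : L2 Ω :=
  ((testFunction_continuous_deriv φ).memLp_of_hasCompactSupport φ.hasCompactSupport.deriv).toLp
    (deriv φ)

variable {Ω : Opens ℝ}

theorem coeFn_testLp (φ : 𝓓(Ω, ℂ)) : testLp φ =ᵐ[volume.restrict (Ω : Set ℝ)] φ :=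
  MemLp.coeFn_toLp (φ.continuous.memLp_of_hasCompactSupport φ.hasCompactSupport)

theorem coeFn_derivTestLp (φ : 𝓓(Ω, ℂ)) :
    derivTestLp φ =ᵐ[volume.restrict (Ω : Set ℝ)] deriv φ :=
  MemLp.coeFn_toLp ((testFunction_continuous_deriv φ).memLp_of_hasCompactSupport
    φ.hasCompactSupport.deriv)

theorem pairing_testLp (φ : 𝓓(Ω, ℂ)) (v : L2 Ω) :
    pairing _ (testLp φ) v = ∫ x in (Ω : Set ℝ), φ x * v x := pairing_toLp _ v

theorem pairing_derivTestLp (φ : 𝓓(Ω, ℂ)) (v : L2 Ω) :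
    pairing _ (derivTestLp φ) v = ∫ x in (Ω : Set ℝ), deriv φ x * v x := pairing_toLp _ v

theorem hasWeakDeriv_iff {u v : L2 Ω} : HasWeakDeriv Ω u v ↔
    ∀ φ : 𝓓(Ω, ℂ), pairing _ (derivTestLp φ) u = -pairing _ (testLp φ) v := by
  simp only [pairing_testLp, pairing_derivTestLp]; rfl

/-- A test function together with its derivative. -/
def testGraph (Ω : Opens ℝ) : 𝓓(Ω, ℂ) →ₗ[ℂ] L2 Ω × L2 Ω where
  toFun φ := (testLp φ, derivTestLp φ)
  map_add' φ ψ := by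
    refine Prod.ext (Lp.ext ?_) (Lp.ext ?_)
    · filter_upwards [coeFn_testLp φ, coeFn_testLp ψ, coeFn_testLp (φ + ψ),
        Lp.coeFn_add (testLp φ) (testLp ψ)] with x h1 h2 h3 h4
      simp only [Prod.mk_add_mk]
      rw [h3, h4, Pi.add_apply, h1, h2]; rfl
    · filter_upwards [coeFn_derivTestLp φ, coeFn_derivTestLp ψ, coeFn_derivTestLp (φ + ψ),
        Lp.coeFn_add (derivTestLp φ) (derivTestLp ψ)] with x h1 h2 h3 h4
      simp only [Prod.mk_add_mk]
      rw [h3, h4, Pi.add_apply, h1, h2]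
      exact deriv_add (φ.contDiff.differentiable (by simp) x)
        (ψ.contDiff.differentiable (by simp) x)
  map_smul' c φ := by
    refine Prod.ext (Lp.ext ?_) (Lp.ext ?_)
    · filter_upwards [coeFn_testLp φ, coeFn_testLp (c • φ), Lp.coeFn_smul c (testLp φ)]
        with x h1 h3 h4
      simp only [RingHom.id_apply, Prod.smul_mk]
      rw [h3, h4, Pi.smul_apply, h1]; rfl
    · filter_upwards [coeFn_derivTestLp φ, coeFn_derivTestLp (c • φ),
        Lp.coeFn_smul c (derivTestLp φ)] with x h1 h3 h4
      simp only [RingHom.id_apply, Prod.smul_mk]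
      rw [h3, h4, Pi.smul_apply, h1]
      exact deriv_const_mul c (φ.contDiff.differentiable (by simp) x)

/-- The closure of the pairs `(φ, φ')`, that is, `H¹₀(Ω)` as a closed subspace of `L² × L²`. -/
def sobolevZero (Ω : Opens ℝ) : Submodule ℂ (L2 Ω × L2 Ω) :=
  (LinearMap.range (testGraph Ω)).topologicalClosure

theorem testGraph_mem_sobolevZero (φ : 𝓓(Ω, ℂ)) : (testLp φ, derivTestLp φ) ∈ sobolevZero Ω :=
  Submodule.le_topologicalClosure _ ⟨φ, rfl⟩

/-- Identities continuous in the pair (w, w') pass from test functions to H¹₀ by closure. -/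
theorem sobolevZero_induction {p : L2 Ω × L2 Ω → Prop} (hp : IsClosed {w | p w})
    (h : ∀ φ : 𝓓(Ω, ℂ), p (testLp φ, derivTestLp φ)) {w : L2 Ω × L2 Ω} (hw : w ∈ sobolevZero Ω) :
    p w := by
  refine closure_minimal (t := {w | p w}) ?_ hp hw
  rintro _ ⟨φ, rfl⟩
  exact h φ

theorem mem_sobolevZero_iff {u u₁ : L2 Ω} : (u, u₁) ∈ sobolevZero Ω ↔
    ∀ δ : ℝ≥0∞, 0 < δ → ∃ φ : 𝓓(Ω, ℂ),
      eLpNorm (fun x => u x - φ x) 2 (volume.restrict (Ω : Set ℝ)) < δ ∧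
      eLpNorm (fun x => u₁ x - deriv φ x) 2 (volume.restrict (Ω : Set ℝ)) < δ := by
  have e1 : ∀ φ : 𝓓(Ω, ℂ), edist u (testLp φ) =
      eLpNorm (fun x => u x - φ x) 2 (volume.restrict (Ω : Set ℝ)) := fun φ => by
    rw [Lp.edist_def]
    refine eLpNorm_congr_ae ?_
    filter_upwards [coeFn_testLp φ] with x hx
    rw [Pi.sub_apply, hx]
  have e2 : ∀ φ : 𝓓(Ω, ℂ), edist u₁ (derivTestLp φ) =
      eLpNorm (fun x => u₁ x - deriv φ x) 2 (volume.restrict (Ω : Set ℝ)) := fun φ => by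
    rw [Lp.edist_def]
    refine eLpNorm_congr_ae ?_
    filter_upwards [coeFn_derivTestLp φ] with x hx
    rw [Pi.sub_apply, hx]
  change (u, u₁) ∈ closure (LinearMap.range (testGraph Ω) : Set (L2 Ω × L2 Ω)) ↔ _
  rw [EMetric.mem_closure_iff]
  constructor
  · intro h δ hδ
    obtain ⟨_, ⟨φ, rfl⟩, hφ⟩ := h δ hδ
    rw [Prod.edist_eq, max_lt_iff] at hφ
    exact ⟨φ, by rw [← e1]; exact hφ.1, by rw [← e2]; exact hφ.2⟩
  · intro h δ hδ
    obtain ⟨φ, h1, h2⟩ := h δ hδ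
    refine ⟨_, ⟨φ, rfl⟩, ?_⟩
    rw [Prod.edist_eq, max_lt_iff]
    exact ⟨by rw [← e1] at h1; exact h1, by rw [← e2] at h2; exact h2⟩

theorem hasWeakDeriv_testLp (φ : 𝓓(Ω, ℂ)) : HasWeakDeriv Ω (testLp φ) (derivTestLp φ) := by
  intro ψ
  have hφ : ContDiff ℝ 1 φ := φ.contDiff.of_le (by simp)
  have hψ : ContDiff ℝ 1 ψ := ψ.contDiff.of_le (by simp)
  have e1 : ∫ x in (Ω : Set ℝ), deriv ψ x * testLp φ x = ∫ x, deriv ψ x * φ x := by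
    rw [← setIntegral_eq_integral_of_forall_compl_eq_zero (s := (Ω : Set ℝ))
      (f := fun x => deriv ψ x * φ x)]
    · apply integral_congr_ae
      filter_upwards [coeFn_testLp φ] with x hx
      rw [hx]
    · intro x hx
      rw [image_eq_zero_of_notMem_tsupport fun h => hx (φ.tsupport_subset h), mul_zero]
  have e2 : ∫ x in (Ω : Set ℝ), ψ x * derivTestLp φ x = ∫ x, ψ x * deriv φ x := by
    rw [← setIntegral_eq_integral_of_forall_compl_eq_zero (s := (Ω : Set ℝ))
      (f := fun x => ψ x * deriv φ x)]
    · apply integral_congr_ae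
      filter_upwards [coeFn_derivTestLp φ] with x hx
      rw [hx]
    · intro x hx
      rw [image_eq_zero_of_notMem_tsupport fun h => hx (ψ.tsupport_subset h), zero_mul]
  have i1 : Integrable (fun x => deriv ψ x * φ x) :=
    ((hψ.continuous_deriv le_rfl).mul hφ.continuous).integrable_of_hasCompactSupport
      ψ.hasCompactSupport.deriv.mul_right
  have i2 : Integrable (fun x => ψ x * deriv φ x) :=
    (hψ.continuous.mul (hφ.continuous_deriv le_rfl)).integrable_of_hasCompactSupport
      ψ.hasCompactSupport.mul_right
  rw [e1, e2, eq_neg_iff_add_eq_zero, ← integral_add i1 i2]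
  exact integral_eq_zero_of_hasDerivAt_of_integrable (f := fun x => ψ x * φ x)
    (fun x => (hψ.differentiable one_ne_zero x).hasDerivAt.mul
      (hφ.differentiable one_ne_zero x).hasDerivAt) (i1.add i2)
    ((hψ.continuous.mul hφ.continuous).integrable_of_hasCompactSupport
      ψ.hasCompactSupport.mul_right)

theorem hasWeakDeriv_of_mem_sobolevZero {w : L2 Ω × L2 Ω} (hw : w ∈ sobolevZero Ω) :
    HasWeakDeriv Ω w.1 w.2 := by
  refine sobolevZero_induction (p := fun w => HasWeakDeriv Ω w.1 w.2) ?_ hasWeakDeriv_testLp hw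
  simp only [hasWeakDeriv_iff, ofPred_forall]
  exact isClosed_iInter fun φ => isClosed_eq (by fun_prop) (by fun_prop)

theorem memH10_iff {u : L2 Ω} : MemH10 u ↔ ∃ u₁, (u, u₁) ∈ sobolevZero Ω := by
  simp only [mem_sobolevZero_iff]
  constructor
  · rintro ⟨u₁, -, h⟩
    exact ⟨u₁, h⟩
  · rintro ⟨u₁, h⟩
    exact ⟨u₁, hasWeakDeriv_of_mem_sobolevZero (mem_sobolevZero_iff.2 h), h⟩

/-- The complex conjugate of a test function. -/
def conjTest (φ : 𝓓(Ω, ℂ)) : 𝓓(Ω, ℂ) :=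
  ⟨fun x => starRingEnd ℂ (φ x), conjCLE.contDiff.comp φ.contDiff,
    φ.hasCompactSupport.comp_left (g := starRingEnd ℂ) (map_zero _),
    (closure_mono (fun x hx => by
      rw [Function.mem_support] at hx ⊢
      exact fun h => hx (by rw [h, map_zero]))).trans φ.tsupport_subset⟩

theorem conjTest_apply (φ : 𝓓(Ω, ℂ)) (x : ℝ) : conjTest φ x = starRingEnd ℂ (φ x) := rfl

theorem deriv_conjTest (φ : 𝓓(Ω, ℂ)) (x : ℝ) :
    deriv (conjTest φ) x = starRingEnd ℂ (deriv φ x) :=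
  ((φ.contDiff.differentiable (by simp) x).hasDerivAt.star).deriv

theorem inner_testLp (φ : 𝓓(Ω, ℂ)) (v : L2 Ω) :
    inner ℂ (testLp φ) v = pairing _ (testLp (conjTest φ)) v := by
  rw [pairing_testLp, L2.inner_def]
  apply integral_congr_ae
  filter_upwards [coeFn_testLp φ] with x hx
  rw [hx, RCLike.inner_apply, conjTest_apply, mul_comm]

theorem inner_derivTestLp (φ : 𝓓(Ω, ℂ)) (v : L2 Ω) :
    inner ℂ (derivTestLp φ) v = pairing _ (derivTestLp (conjTest φ)) v := by
  rw [pairing_derivTestLp, L2.inner_def]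
  apply integral_congr_ae
  filter_upwards [coeFn_derivTestLp φ] with x hx
  rw [hx, RCLike.inner_apply, deriv_conjTest, mul_comm]

theorem conjTest_conjTest (φ : 𝓓(Ω, ℂ)) : conjTest (conjTest φ) = φ := by
  ext x; simp [conjTest_apply]

/-! ### Weak formulation of the Dirichlet operator -/

/-- `B` is the operator of multiplication by `q`. -/
def IsMulBy (q : ℝ → ℝ) (B : L2 Ω →L[ℂ] L2 Ω) : Prop :=
  ∀ u : L2 Ω, B u =ᵐ[volume.restrict (Ω : Set ℝ)] fun x => (q x : ℂ) * u x

theorem exists_isMulBy {q : ℝ → ℝ} {K : Set ℝ} (hK : IsCompact K) (hΩ : (Ω : Set ℝ) ⊆ K)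
    (hq : ContinuousOn q K) : ∃ B : L2 Ω →L[ℂ] L2 Ω, IsMulBy q B := by
  obtain ⟨C, hC⟩ := hK.exists_bound_of_continuousOn hq
  have hqm : AEStronglyMeasurable (fun x => (q x : ℂ)) (volume.restrict (Ω : Set ℝ)) :=
    continuous_ofReal.comp_aestronglyMeasurable
      ((hq.mono hΩ).aestronglyMeasurable Ω.isOpen.measurableSet)
  have hm : MemLp (fun x => (q x : ℂ)) ∞ (volume.restrict (Ω : Set ℝ)) := by
    refine memLp_top_of_bound hqm C ?_
    filter_upwards [ae_restrict_mem Ω.isOpen.measurableSet] with x hx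
    rw [norm_real]
    exact hC x (hΩ hx)
  refine ⟨(ContinuousLinearMap.mul ℂ ℂ).holderL (volume.restrict (Ω : Set ℝ)) ∞ 2 2
    (hm.toLp _), fun u => ?_⟩
  filter_upwards [(ContinuousLinearMap.mul ℂ ℂ).coeFn_holder (r := 2) (hm.toLp _) u,
    hm.coeFn_toLp] with x h1 h2
  rw [← h2]
  exact h1

theorem IsMulBy.inner_comm {q : ℝ → ℝ} {B : L2 Ω →L[ℂ] L2 Ω} (hB : IsMulBy q B) (u v : L2 Ω) :
    inner ℂ u (B v) = inner ℂ (B u) v := by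
  rw [L2.inner_def, L2.inner_def]
  apply integral_congr_ae
  filter_upwards [hB u, hB v] with x h1 h2
  rw [h1, h2, RCLike.inner_apply, RCLike.inner_apply, map_mul, conj_ofReal]
  ring

theorem IsMulBy.pairing_comm {q : ℝ → ℝ} {B : L2 Ω →L[ℂ] L2 Ω} (hB : IsMulBy q B) (u v : L2 Ω) :
    pairing _ u (B v) = pairing _ (B u) v := by
  rw [pairing_apply, pairing_apply]
  apply integral_congr_ae
  filter_upwards [hB u, hB v] with x h1 h2
  rw [h1, h2]
  ring

/-- One integration by parts removes the second derivative. Conversely, the weak equation shows that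
ν²q²u - g is the weak derivative of u₁, so H² regularity is automatic. -/
theorem mem_dirichletGraph_iff {q : ℝ → ℝ} {B : L2 Ω →L[ℂ] L2 Ω} (hB : IsMulBy q B) {ν : ℂ}
    {u g : L2 Ω} : (u, g) ∈ dirichletGraph Ω q ν ↔ ∃ u₁, (u, u₁) ∈ sobolevZero Ω ∧
      ∀ φ : 𝓓(Ω, ℂ), pairing _ (derivTestLp φ) u₁ + ν ^ 2 * pairing _ (testLp φ) (B (B u)) =
        pairing _ (testLp φ) g := by
  have hae : ∀ u₂ : L2 Ω, (g =ᵐ[volume.restrict (Ω : Set ℝ)]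
      fun x => -u₂ x + ν ^ 2 * (q x : ℂ) ^ 2 * u x) ↔ g = -u₂ + ν ^ 2 • B (B u) := by
    intro u₂
    have e : ⇑(-u₂ + ν ^ 2 • B (B u)) =ᵐ[volume.restrict (Ω : Set ℝ)]
        fun x => -u₂ x + ν ^ 2 * (q x : ℂ) ^ 2 * u x := by
      filter_upwards [Lp.coeFn_add (-u₂) (ν ^ 2 • B (B u)), Lp.coeFn_neg u₂,
        Lp.coeFn_smul (ν ^ 2) (B (B u)), hB u, hB (B u)] with x h1 h2 h3 h4 h5
      rw [h1, Pi.add_apply, h2, h3, Pi.neg_apply, Pi.smul_apply, h5, h4, smul_eq_mul]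
      ring
    exact ⟨fun h => Lp.ext (h.trans e.symm), fun h => by rw [h]; exact e⟩
  constructor
  · rintro ⟨hu, u₁, u₂, h1, h2, hg⟩
    obtain ⟨v, hv⟩ := memH10_iff.1 hu
    obtain rfl : v = u₁ := (hasWeakDeriv_of_mem_sobolevZero hv).unique h1
    refine ⟨v, hv, fun φ => ?_⟩
    simp only at hg
    rw [hasWeakDeriv_iff.1 h2 φ, (hae u₂).1 hg, map_add, map_neg, map_smul, smul_eq_mul]
  · rintro ⟨u₁, hu, h⟩
    refine ⟨memH10_iff.2 ⟨u₁, hu⟩, u₁, ν ^ 2 • B (B u) - g, hasWeakDeriv_of_mem_sobolevZero hu,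
      hasWeakDeriv_iff.2 fun φ => ?_, (hae _).2 (by abel)⟩
    rw [map_sub, map_smul, smul_eq_mul, ← h φ]
    ring

theorem pairing_eq_of_weak {Q : L2 Ω →L[ℂ] L2 Ω} {ν : ℂ} {u u₁ g : L2 Ω}
    (h : ∀ φ : 𝓓(Ω, ℂ), pairing _ (derivTestLp φ) u₁ + ν ^ 2 * pairing _ (testLp φ) (Q u) =
        pairing _ (testLp φ) g) {w : L2 Ω × L2 Ω} (hw : w ∈ sobolevZero Ω) :
    pairing _ w.2 u₁ + ν ^ 2 * pairing _ w.1 (Q u) = pairing _ w.1 g := by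
  refine sobolevZero_induction (p := fun w => pairing _ w.2 u₁ + ν ^ 2 * pairing _ w.1 (Q u) =
    pairing _ w.1 g) ?_ h hw
  exact isClosed_eq (by fun_prop) (by fun_prop)

theorem inner_eq_of_weak {Q : L2 Ω →L[ℂ] L2 Ω} {ν : ℂ} {u u₁ g : L2 Ω}
    (h : ∀ φ : 𝓓(Ω, ℂ), pairing _ (derivTestLp φ) u₁ + ν ^ 2 * pairing _ (testLp φ) (Q u) =
        pairing _ (testLp φ) g) {w : L2 Ω × L2 Ω} (hw : w ∈ sobolevZero Ω) :
    inner ℂ w.2 u₁ + ν ^ 2 * inner ℂ w.1 (Q u) = inner ℂ w.1 g := by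
  refine sobolevZero_induction (p := fun w => inner ℂ w.2 u₁ + ν ^ 2 * inner ℂ w.1 (Q u) =
    inner ℂ w.1 g) ?_ (fun φ => ?_) hw
  · exact isClosed_eq (by fun_prop) (by fun_prop)
  · simp only [inner_testLp, inner_derivTestLp]
    exact h (conjTest φ)

/-- The Dirichlet operator is symmetric for the bilinear pairing. -/
theorem pairing_dirichletGraph_comm {q : ℝ → ℝ} {B : L2 Ω →L[ℂ] L2 Ω} (hB : IsMulBy q B) {ν : ℂ}
    {u g v k : L2 Ω} (hu : (u, g) ∈ dirichletGraph Ω q ν) (hv : (v, k) ∈ dirichletGraph Ω q ν) :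
    pairing _ v g = pairing _ u k := by
  obtain ⟨u₁, hu₁, hu⟩ := (mem_dirichletGraph_iff hB).1 hu
  obtain ⟨v₁, hv₁, hv⟩ := (mem_dirichletGraph_iff hB).1 hv
  have h1 := pairing_eq_of_weak (Q := B ∘L B) hu hv₁
  have h2 := pairing_eq_of_weak (Q := B ∘L B) hv hu₁
  simp only [ContinuousLinearMap.comp_apply] at h1 h2
  rw [← h1, ← h2, pairing_comm v₁ u₁, hB.pairing_comm v, hB.pairing_comm u, pairing_comm (B v)]

theorem re_conj_mul_sq_ofReal_mul (a : ℝ) (ν : ℂ) :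
    (starRingEnd ℂ (a * ν) * ν ^ 2).re = ‖ν‖ ^ 2 * (a * ν).re := by
  have : starRingEnd ℂ (a * ν) * ν ^ 2 = ((‖ν‖ ^ 2 : ℝ) : ℂ) * (a * ν) := by
    rw [← normSq_eq_norm_sq, ← mul_conj, map_mul, conj_ofReal]; ring
  rw [this, re_ofReal_mul]

theorem inner_self_eq_ofReal' (v : L2 Ω) : inner ℂ v v = ((‖v‖ ^ 2 : ℝ) : ℂ) := by
  rw [inner_self_eq_norm_sq_to_K, ofReal_pow]; rfl

/-- The energy estimate for `(P_ν + β) u = f`, with `β = a ν`. -/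
theorem energy_le {q : ℝ → ℝ} {B : L2 Ω →L[ℂ] L2 Ω} (hB : IsMulBy q B) {ν : ℂ} {a c : ℝ}
    (hν : 0 < ‖(a : ℂ) * ν‖) (hc : 0 ≤ c) (hcν : c * ‖(a : ℂ) * ν‖ ≤ ((a : ℂ) * ν).re) {u g : L2 Ω}
    (hu : (u, g) ∈ dirichletGraph Ω q ν) :
    c * (‖ν‖ * ‖B u‖) ^ 2 + ‖(a : ℂ) * ν‖ * ‖u‖ ^ 2 ≤ ‖inner ℂ u (g + ((a : ℂ) * ν) • u)‖ := by
  obtain ⟨u₁, hu₁, hu⟩ := (mem_dirichletGraph_iff hB).1 hu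
  have h := inner_eq_of_weak (Q := B ∘L B) hu hu₁
  simp only [ContinuousLinearMap.comp_apply] at h
  rw [inner_add_right, inner_smul_right, ← h, hB.inner_comm, inner_self_eq_ofReal',
    inner_self_eq_ofReal', inner_self_eq_ofReal']
  set β : ℂ := (a : ℂ) * ν with hβ
  set Y : ℂ := ((‖u₁‖ ^ 2 : ℝ) : ℂ) + ν ^ 2 * ((‖B u‖ ^ 2 : ℝ) : ℂ) + β * ((‖u‖ ^ 2 : ℝ) : ℂ)
  -- Since a is real, the conjugate of β = aν rotates ν² to have real part |ν|² Re β, as for the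
  -- oscillator. The term with u₁ is nonnegative and is then dropped.
  have e1 : (starRingEnd ℂ β * Y).re =
      β.re * ‖u₁‖ ^ 2 + ‖ν‖ ^ 2 * β.re * ‖B u‖ ^ 2 + ‖β‖ ^ 2 * ‖u‖ ^ 2 := by
    have e2 : starRingEnd ℂ β * β = ((‖β‖ ^ 2 : ℝ) : ℂ) := by
      rw [mul_comm, mul_conj, normSq_eq_norm_sq]
    rw [mul_add, mul_add, ← mul_assoc, ← mul_assoc, add_re, add_re, re_mul_ofReal, re_mul_ofReal,
      re_mul_ofReal, e2, ofReal_re, conj_re, ← re_conj_mul_sq_ofReal_mul]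
  have e3 : (starRingEnd ℂ β * Y).re ≤ ‖β‖ * ‖Y‖ := by
    refine (re_le_norm _).trans ?_
    rw [norm_mul, norm_conj]
  rw [e1] at e3
  refine le_of_mul_le_mul_left (le_trans ?_ e3) hν
  have i1 : 0 ≤ β.re * ‖u₁‖ ^ 2 :=
    mul_nonneg ((mul_nonneg hc hν.le).trans hcν) (sq_nonneg _)
  have i2 : c * ‖β‖ * (‖ν‖ ^ 2 * ‖B u‖ ^ 2) ≤ β.re * (‖ν‖ ^ 2 * ‖B u‖ ^ 2) := by gcongr
  nlinarith

/-- The resolvent of the Dirichlet operator at `-β = -a ν`. -/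
theorem exists_isResolventOp_dirichletOp {q : ℝ → ℝ} {B : L2 Ω →L[ℂ] L2 Ω} (hB : IsMulBy q B)
    {ν : ℂ} {a c : ℝ} (hν : 0 < ‖(a : ℂ) * ν‖) (hc : 0 < c)
    (hcν : c * ‖(a : ℂ) * ν‖ ≤ ((a : ℂ) * ν).re) :
    ∃ S : L2 Ω →L[ℂ] L2 Ω, IsResolventOp (dirichletOp Ω q ν) (-((a : ℂ) * ν)) S := by
  set β : ℂ := (a : ℂ) * ν with hβ
  -- The unit phase of the conjugate of β; the sector condition is exactly Re τ ≥ c.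
  set τ : ℂ := ((‖β‖⁻¹ : ℝ) : ℂ) * starRingEnd ℂ β with hτ
  have hτre : c ≤ τ.re := by
    rw [hτ, re_ofReal_mul, conj_re, inv_mul_eq_div, le_div_iff₀ hν]; exact hcν
  have hτ1 : ‖τ‖ ≤ 1 := by
    rw [hτ, norm_mul, norm_conj, norm_real, norm_inv, norm_norm, inv_mul_cancel₀ hν.ne']
  have hM : ∀ u, min c ‖β‖ * ‖u‖ ^ 2 ≤ (τ * inner ℂ u
      ((ν ^ 2 • (B ∘L B) + β • ContinuousLinearMap.id ℂ (L2 Ω)) u)).re := by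
    intro u
    have e : inner ℂ u ((ν ^ 2 • (B ∘L B) + β • ContinuousLinearMap.id ℂ (L2 Ω)) u) =
        ν ^ 2 * ((‖B u‖ ^ 2 : ℝ) : ℂ) + β * ((‖u‖ ^ 2 : ℝ) : ℂ) := by
      change inner ℂ u (ν ^ 2 • B (B u) + β • u) = _
      rw [inner_add_right, inner_smul_right, inner_smul_right, hB.inner_comm,
        inner_self_eq_ofReal', inner_self_eq_ofReal']
    have e2 : starRingEnd ℂ β * β = ((‖β‖ ^ 2 : ℝ) : ℂ) := by
      rw [mul_comm, mul_conj, normSq_eq_norm_sq]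
    rw [e, hτ, mul_assoc, re_ofReal_mul, mul_add, ← mul_assoc, ← mul_assoc, add_re, re_mul_ofReal,
      re_mul_ofReal, e2, ofReal_re, re_conj_mul_sq_ofReal_mul]
    have i1 : 0 ≤ ‖β‖⁻¹ * (‖ν‖ ^ 2 * ((a : ℂ) * ν).re * ‖B u‖ ^ 2) := by
      have : 0 ≤ ((a : ℂ) * ν).re := (mul_nonneg hc.le hν.le).trans hcν
      positivity
    have i2 : ‖β‖⁻¹ * (‖β‖ ^ 2 * ‖u‖ ^ 2) = ‖β‖ * ‖u‖ ^ 2 := by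
      field_simp
    rw [mul_add, i2]
    have i3 : min c ‖β‖ * ‖u‖ ^ 2 ≤ ‖β‖ * ‖u‖ ^ 2 := by gcongr; exact min_le_right _ _
    linarith
  obtain ⟨T, hT⟩ := exists_variational_solution (sobolevZero Ω)
    (Submodule.isClosed_topologicalClosure _) _ hτ1 (lt_min hc hν) ((min_le_left _ _).trans hτre) hM
  set S : L2 Ω →L[ℂ] L2 Ω := (ContinuousLinearMap.fst ℂ (L2 Ω) (L2 Ω)) ∘L T with hS
  have hgraph : ∀ f, (S f, f + (-β) • S f) ∈ dirichletGraph Ω q ν := by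
    intro f
    refine (mem_dirichletGraph_iff hB).2 ⟨(T f).2, (hT f).1, fun φ => ?_⟩
    have h := (hT f).2 _ (testGraph_mem_sobolevZero (conjTest φ))
    simp only [inner_testLp, inner_derivTestLp, conjTest_conjTest] at h
    change _ + pairing _ (testLp φ) (ν ^ 2 • B (B (S f)) + β • S f) = _ at h
    rw [map_add, map_smul, map_smul, smul_eq_mul, smul_eq_mul] at h
    rw [map_add, map_smul, smul_eq_mul, ← h]
    ring
  refine ⟨S, (isResolventOp_iff _ _ _).2 ⟨fun u f huf => ?_, fun f => ?_⟩⟩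
  · rw [dirichletOp_graph] at huf
    -- The difference of two solutions has zero right-hand side, and the energy estimate forces it
    -- to vanish.
    have hw := (dirichletGraph Ω q ν).sub_mem (hgraph (f - (-β) • u)) huf
    rw [Prod.mk_sub_mk] at hw
    have h := energy_le hB hν hc.le hcν hw
    have e : (f - -β • u + -β • S (f - -β • u) - f) + β • (S (f - -β • u) - u) = 0 := by module
    rw [← hβ, e, inner_zero_right, norm_zero] at h
    have h0 : 0 ≤ c * (‖ν‖ * ‖B (S (f - -β • u) - u)‖) ^ 2 := by positivity
    have h1 : ‖S (f - -β • u) - u‖ ^ 2 ≤ 0 := by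
      by_contra! h2
      have := mul_pos hν h2
      linarith
    have h2 : ‖S (f - -β • u) - u‖ = 0 := by
      have := sq_nonneg ‖S (f - -β • u) - u‖
      exact pow_eq_zero_iff two_ne_zero |>.1 (le_antisymm h1 this)
    exact sub_eq_zero.1 (norm_eq_zero.1 h2)
  · rw [dirichletOp_graph]; exact hgraph f

/-- The energy estimate for a right-hand side which contains the factor `q`. -/
theorem norm_le_of_mulBy {q : ℝ → ℝ} {B : L2 Ω →L[ℂ] L2 Ω} (hB : IsMulBy q B)
    {ν : ℂ} {a c : ℝ} (hν : 0 < ‖(a : ℂ) * ν‖) (hc : 0 < c)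
    (hcν : c * ‖(a : ℂ) * ν‖ ≤ ((a : ℂ) * ν).re) {u g G : L2 Ω}
    (hu : (u, g) ∈ dirichletGraph Ω q ν) (hG : g + ((a : ℂ) * ν) • u = ν • B G) :
    4 * c * ‖(a : ℂ) * ν‖ * ‖u‖ ^ 2 ≤ ‖G‖ ^ 2 := by
  have h := energy_le hB hν hc.le hcν hu
  rw [hG, inner_smul_right, hB.inner_comm, norm_mul ν] at h
  have h1 : ‖ν‖ * ‖inner ℂ (B u) G‖ ≤ ‖ν‖ * ‖B u‖ * ‖G‖ := by
    rw [mul_assoc]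
    gcongr
    exact norm_inner_le_norm _ _
  -- Moving q onto u bounds the pairing by |ν|‖qu‖‖G‖. By Young's inequality the factor |ν|‖qu‖ is
  -- absorbed into the energy, leaving only ‖G‖².
  have h2 := mul_le_mul_of_nonneg_left (h.trans h1) (by positivity : 0 ≤ 4 * c)
  nlinarith [sq_nonneg (2 * c * (‖ν‖ * ‖B u‖) - ‖G‖)]

end Grushin
end

/-! ### Comparison of the two resolvents at the base point. -/

noncomputable section

namespace Grushin

open Polynomial Complex Filter
open scoped Topology ContDiff

variable {Ω : Opens ℝ}

theorem restrict_gaussLp_ae {β : ℂ} (hβ : 0 < β.re) (p : ℂ[X]) :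
    restrictTo Ω (gaussLp hβ p) =ᵐ[volume.restrict (Ω : Set ℝ)] gaussPoly β p :=
  (restrictTo_coeFn Ω _).trans (ae_restrict_of_ae (coeFn_gaussLp hβ p))

theorem norm_restrictTo_le (v : L2R) : ‖restrictTo Ω v‖ ≤ ‖v‖ := by
  rw [Lp.norm_def, Lp.norm_def, eLpNorm_congr_ae (restrictTo_coeFn Ω v)]
  exact ENNReal.toReal_mono (Lp.eLpNorm_ne_top v) (eLpNorm_restrict_le _ _ _ _)

theorem norm_extendZero (v : L2 Ω) : ‖extendZero Ω v‖ = ‖v‖ := by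
  rw [Lp.norm_def, Lp.norm_def, eLpNorm_congr_ae (extendZero_coeFn Ω v),
    eLpNorm_indicator_eq_eLpNorm_restrict Ω.isOpen.measurableSet]

theorem restrictTo_extendZero (v : L2 Ω) : restrictTo Ω (extendZero Ω v) = v := by
  refine Lp.ext ?_
  filter_upwards [restrictTo_coeFn Ω (extendZero Ω v), ae_restrict_of_ae (extendZero_coeFn Ω v),
    ae_restrict_mem Ω.isOpen.measurableSet] with x h1 h2 h3
  rw [h1, h2, indicator_of_mem h3]

/-- Products of bounded functions with polynomials times Gaussians. -/
theorem exists_mul_gaussPoly {β : ℂ} (hβ : 0 < β.re) (p : ℂ[X]) {m : ℝ → ℂ} {C : ℝ}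
    (hm : AEStronglyMeasurable m (volume.restrict (Ω : Set ℝ))) (hC : 0 ≤ C)
    (hmC : ∀ x ∈ (Ω : Set ℝ), ‖m x‖ ≤ C) :
    ∃ v : L2 Ω, v =ᵐ[volume.restrict (Ω : Set ℝ)] (fun x => m x * gaussPoly β p x) ∧
      ‖v‖ ≤ C * ‖gaussLp hβ p‖ := by
  have hle : ∀ᵐ x ∂(volume.restrict (Ω : Set ℝ)),
      ‖m x * gaussPoly β p x‖ ≤ C * ‖restrictTo Ω (gaussLp hβ p) x‖ := by
    filter_upwards [restrict_gaussLp_ae hβ p, ae_restrict_mem Ω.isOpen.measurableSet] with x h1 h2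
    rw [h1, norm_mul]
    exact mul_le_mul_of_nonneg_right (hmC x h2) (norm_nonneg _)
  have hv : MemLp (fun x => m x * gaussPoly β p x) 2 (volume.restrict (Ω : Set ℝ)) :=
    (Lp.memLp (restrictTo Ω (gaussLp hβ p))).of_le_mul
      (hm.mul (continuous_gaussPoly β p).aestronglyMeasurable) hle
  refine ⟨hv.toLp _, hv.coeFn_toLp, ?_⟩
  refine (Lp.norm_le_mul_norm_of_ae_le_mul (g := restrictTo Ω (gaussLp hβ p)) (c := C) ?_).trans
    (mul_le_mul_of_nonneg_left (norm_restrictTo_le _) hC)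
  filter_upwards [hv.coeFn_toLp, hle] with x h1 h2
  rw [h1]; exact h2

/-- The derivative of a test function, as a test function. -/
def derivTest (φ : 𝓓(Ω, ℂ)) : 𝓓(Ω, ℂ) :=
  ⟨deriv φ, (contDiff_infty_iff_deriv.1 φ.contDiff).2, φ.hasCompactSupport.deriv,
    (tsupport_deriv_subset).trans φ.tsupport_subset⟩

theorem testLp_mem_dirichletGraph {q : ℝ → ℝ} {ν : ℂ} (φ : 𝓓(Ω, ℂ)) {h : L2 Ω}
    (hh : h =ᵐ[volume.restrict (Ω : Set ℝ)]
      fun x => -deriv (deriv φ) x + ν ^ 2 * (q x : ℂ) ^ 2 * φ x) :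
    (testLp φ, h) ∈ dirichletGraph Ω q ν := by
  refine ⟨memH10_iff.2 ⟨_, testGraph_mem_sobolevZero φ⟩, derivTestLp φ,
    derivTestLp (derivTest φ), hasWeakDeriv_testLp φ, hasWeakDeriv_testLp (derivTest φ), ?_⟩
  filter_upwards [hh, coeFn_testLp φ, coeFn_derivTestLp (derivTest φ)] with x h1 h2 h3
  rw [h1, h2, h3]
  rfl

theorem cutoff_eq_one {x : ℝ} (hx : |x| ≤ 1) : cutoff x = 1 :=
  cutoff.one_of_mem_closedBall (by simpa [cutoff, Real.dist_eq] using hx)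

theorem deriv_cutoff_eq_zero {x : ℝ} (hx : |x| < 1) :
    deriv cutoff x = 0 ∧ deriv (deriv cutoff) x = 0 := by
  have h : cutoff =ᶠ[𝓝 x] fun _ => (1 : ℝ) :=
    cutoff.eventuallyEq_one_of_mem_ball (by simpa [cutoff, Real.dist_eq] using hx)
  refine ⟨by rw [h.deriv_eq, deriv_const], ?_⟩
  have h2 := h.deriv
  rw [h2.deriv_eq]
  simp

theorem cutoff_eq_zero {x : ℝ} (hx : 2 ≤ |x|) : cutoff x = 0 :=
  cutoff.zero_of_le_dist (by simpa [cutoff, Real.dist_eq] using hx)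

/-- Numerators from 1 - χ, χ' and χ'' vanish for |tx| < 1; where |x| ≥ 1/t, |q| is at least c₁/t and
the division by νq is harmless. -/
theorem norm_div_le_of_cutoff {q : ℝ → ℝ} {ν : ℂ} (hν : 0 < ‖ν‖) {c₁ t A x : ℝ} (hc₁ : 0 < c₁)
    (ht : 0 < t) (hA : 0 ≤ A) {y : ℂ} (hq : c₁ * |x| ≤ |q x|) (hy : ‖y‖ ≤ A)
    (hy0 : |t * x| < 1 → y = 0) : ‖y / (ν * q x)‖ ≤ A * t / (c₁ * ‖ν‖) := by
  rcases lt_or_ge |t * x| 1 with h | h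
  · rw [hy0 h, zero_div, norm_zero]; positivity
  · rw [abs_mul, abs_of_pos ht] at h
    have hx : 0 < |x| := by
      by_contra! h0
      have : |x| = 0 := le_antisymm h0 (abs_nonneg _)
      rw [this] at h; linarith
    have hq0 : 0 < |q x| := (mul_pos hc₁ hx).trans_le hq
    rw [norm_div, norm_mul, norm_real, Real.norm_eq_abs, div_le_div_iff₀ (by positivity)
      (by positivity)]
    calc ‖y‖ * (c₁ * ‖ν‖) ≤ A * (c₁ * ‖ν‖) * 1 := by rw [mul_one]; gcongr
      _ ≤ A * (c₁ * ‖ν‖) * (t * |x|) := by gcongr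
      _ = A * t * (‖ν‖ * (c₁ * |x|)) := by ring
      _ ≤ _ := by gcongr

/-- Comparison of the two resolvents at `-β = -a ν` on a polynomial times a Gaussian. -/
theorem norm_resolvent_sub_le {q : ℝ → ℝ} (hq : ContinuousOn q (Ω : Set ℝ))
    {B : L2 Ω →L[ℂ] L2 Ω} (hB : IsMulBy q B)
    {ν : ℂ} {a c c₁ t η M : ℝ} (hβ : 0 < ((a : ℂ) * ν).re) (hν : 0 < ‖ν‖) (hc : 0 < c)
    (hcν : c * ‖(a : ℂ) * ν‖ ≤ ((a : ℂ) * ν).re) (hc₁ : 0 < c₁)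
    (hqc : ∀ x ∈ (Ω : Set ℝ), c₁ * |x| ≤ |q x|) (ht : 0 < t) (hη : 0 ≤ η)
    (htΩ : Icc (-(2 / t)) (2 / t) ⊆ (Ω : Set ℝ))
    (htq : ∀ x, |t * x| < 2 → |q x ^ 2 - a ^ 2 * x ^ 2| ≤ η * x ^ 2)
    (hM : ∀ x, |deriv cutoff x| ≤ M ∧ |deriv (deriv cutoff) x| ≤ M)
    {S : L2 Ω →L[ℂ] L2 Ω} (hS : IsResolventOp (dirichletOp Ω q ν) (-((a : ℂ) * ν)) S)
    {p u : ℂ[X]} (hu : oscPoly ((a : ℂ) * ν) u - (-((a : ℂ) * ν)) • u = p) :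
    2 * √(c * ‖(a : ℂ) * ν‖) * ‖S (restrictTo Ω (gaussLp hβ p)) - restrictTo Ω (gaussLp hβ u)‖ ≤
      t / (c₁ * ‖ν‖) * (‖gaussLp hβ p‖ + t ^ 2 * M * ‖gaussLp hβ u‖ +
        2 * t * M * ‖gaussLp hβ (gaussDeriv ((a : ℂ) * ν) u)‖) +
      (η * ‖ν‖ / c₁ + 2 * √(c * ‖(a : ℂ) * ν‖) * t) * ‖gaussLp hβ (X * u)‖ := by
  set β : ℂ := (a : ℂ) * ν with hβdef
  have hν0 : ν ≠ 0 := norm_pos_iff.1 hν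
  have hb : 0 < ‖β‖ := hβ.trans_le (re_le_norm β)
  have hM0 : 0 ≤ M := (abs_nonneg _).trans (hM 0).1
  have hqm : AEMeasurable (fun x => ν * (q x : ℂ)) (volume.restrict (Ω : Set ℝ)) :=
    (continuous_ofReal.comp_aestronglyMeasurable
      (hq.aestronglyMeasurable Ω.isOpen.measurableSet)).aemeasurable.const_mul ν
  have hcut : Continuous (cutoff : ℝ → ℝ) := cutoff.continuous
  have hC2 : ContDiff ℝ 1 (deriv cutoff) :=
    ((contDiff_succ_iff_deriv (n := 1)).1 (cutoff.contDiff (n := 2))).2.2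
  have hcut1 : Continuous (deriv cutoff) := hC2.continuous
  have hcut2 : Continuous (deriv (deriv cutoff)) := hC2.continuous_deriv le_rfl
  -- the four contributions to the remainder, divided by `ν q`
  obtain ⟨v₁, hv₁, hv₁n⟩ := exists_mul_gaussPoly (Ω := Ω) hβ p
    (m := fun x => ((1 - cutoff (t * x) : ℝ) : ℂ) / (ν * q x)) (C := 1 * t / (c₁ * ‖ν‖))
    (AEMeasurable.div (by fun_prop : Continuous fun x : ℝ =>
      ((1 - cutoff (t * x) : ℝ) : ℂ)).aemeasurable hqm).aestronglyMeasurable (by positivity)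
    (fun x hx => norm_div_le_of_cutoff hν hc₁ ht zero_le_one (hqc x hx)
      (by rw [norm_real, Real.norm_eq_abs, abs_of_nonneg (sub_nonneg.2 cutoff.le_one)]
          linarith [cutoff.nonneg (x := t * x)])
      (fun h => by rw [cutoff_eq_one h.le]; simp))
  obtain ⟨v₂, hv₂, hv₂n⟩ := exists_mul_gaussPoly (Ω := Ω) hβ u
    (m := fun x => ((t ^ 2 * deriv (deriv cutoff) (t * x) : ℝ) : ℂ) / (ν * q x))
    (C := t ^ 2 * M * t / (c₁ * ‖ν‖))
    (AEMeasurable.div (by fun_prop : Continuous fun x : ℝ =>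
      ((t ^ 2 * deriv (deriv cutoff) (t * x) : ℝ) : ℂ)).aemeasurable hqm).aestronglyMeasurable
    (by positivity)
    (fun x hx => norm_div_le_of_cutoff hν hc₁ ht (by positivity) (hqc x hx)
      (by rw [norm_real, Real.norm_eq_abs, abs_mul, abs_of_pos (pow_pos ht 2)]
          exact mul_le_mul_of_nonneg_left (hM _).2 (by positivity))
      (fun h => by rw [(deriv_cutoff_eq_zero h).2]; simp))
  obtain ⟨v₃, hv₃, hv₃n⟩ := exists_mul_gaussPoly (Ω := Ω) hβ (gaussDeriv β u)
    (m := fun x => ((2 * t * deriv cutoff (t * x) : ℝ) : ℂ) / (ν * q x))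
    (C := 2 * t * M * t / (c₁ * ‖ν‖))
    (AEMeasurable.div (by fun_prop : Continuous fun x : ℝ =>
      ((2 * t * deriv cutoff (t * x) : ℝ) : ℂ)).aemeasurable hqm).aestronglyMeasurable
    (by positivity)
    (fun x hx => norm_div_le_of_cutoff hν hc₁ ht (by positivity) (hqc x hx)
      (by rw [norm_real, Real.norm_eq_abs, abs_mul, abs_of_pos (by positivity : 0 < 2 * t)]
          exact mul_le_mul_of_nonneg_left (hM _).1 (by positivity))
      (fun h => by rw [(deriv_cutoff_eq_zero h).1]; simp))
  -- The potential error ηx² divided by q loses one power of x, so only ‖xu‖, already in the energy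
  -- norm, is needed.
  obtain ⟨v₄, hv₄, hv₄n⟩ := exists_mul_gaussPoly (Ω := Ω) hβ (X * u)
    (m := fun x => ν ^ 2 * ((cutoff (t * x) * (a ^ 2 * x ^ 2 - q x ^ 2) : ℝ) : ℂ) /
      (ν * q x * x)) (C := η * ‖ν‖ / c₁)
    (by
      refine (AEMeasurable.div (AEMeasurable.const_mul ?_ _) (hqm.mul
        (by fun_prop : Continuous fun x : ℝ => (x : ℂ)).aemeasurable)).aestronglyMeasurable
      refine Complex.measurable_ofReal.comp_aemeasurable (AEMeasurable.mul ?_ ?_)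
      · exact (by fun_prop : Continuous fun x : ℝ => cutoff (t * x)).aemeasurable
      · exact ((by fun_prop : Continuous fun x : ℝ => a ^ 2 * x ^ 2).aemeasurable).sub
          ((hq.aestronglyMeasurable Ω.isOpen.measurableSet).aemeasurable.pow_const 2))
    (by positivity) (fun x hx => by
      rcases eq_or_ne x 0 with rfl | hx0
      · simp only [ofReal_zero, mul_zero, div_zero, norm_zero]; positivity
      have hxa : 0 < |x| := abs_pos.2 hx0
      have hq0 : 0 < |q x| := (mul_pos hc₁ hxa).trans_le (hqc x hx)
      rcases le_or_gt 2 |t * x| with h2 | h2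
      · rw [cutoff_eq_zero h2]
        simp only [zero_mul, ofReal_zero, mul_zero, zero_div, norm_zero]; positivity
      have h3 : |cutoff (t * x) * (a ^ 2 * x ^ 2 - q x ^ 2)| ≤ η * x ^ 2 := by
        rw [abs_mul, abs_sub_comm]
        exact (mul_le_of_le_one_left (abs_nonneg _) (abs_cutoff_le_one _)).trans (htq x h2)
      rw [norm_div, norm_mul, norm_mul, norm_mul, norm_pow, norm_real, norm_real, norm_real,
        Real.norm_eq_abs, Real.norm_eq_abs, Real.norm_eq_abs,
        div_le_div_iff₀ (by positivity) hc₁]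
      calc _ ≤ ‖ν‖ ^ 2 * (η * x ^ 2) * c₁ := by gcongr
        _ = η * ‖ν‖ * (‖ν‖ * (c₁ * |x|) * |x|) := by rw [← sq_abs x]; ring
        _ ≤ _ := by gcongr; exact hqc x hx)
  -- The discarded tail (1 - χ)u is written with xu: since (1 - χ(tx))/x is at most t in modulus, it
  -- inherits the better decay of ‖xu‖ in |β|.
  obtain ⟨v₅, hv₅, hv₅n⟩ := exists_mul_gaussPoly (Ω := Ω) hβ (X * u)
    (m := fun x => ((1 - cutoff (t * x) : ℝ) : ℂ) / x) (C := t)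
    (AEMeasurable.div (by fun_prop : Continuous fun x : ℝ =>
      ((1 - cutoff (t * x) : ℝ) : ℂ)).aemeasurable
      (by fun_prop : Continuous fun x : ℝ => (x : ℂ)).aemeasurable).aestronglyMeasurable ht.le
    (fun x hx => by
      have := norm_div_le_of_cutoff (q := fun x => x) (ν := 1) (by simp) one_pos ht zero_le_one
        (x := x) (y := ((1 - cutoff (t * x) : ℝ) : ℂ)) (by simp)
        (by rw [norm_real, Real.norm_eq_abs, abs_of_nonneg (sub_nonneg.2 cutoff.le_one)]
            linarith [cutoff.nonneg (x := t * x)])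
        (fun h => by rw [cutoff_eq_one h.le]; simp)
      simpa using this)
  set ψ : 𝓓(Ω, ℂ) := truncTest ht htΩ β u with hψ
  have hψc : ⇑ψ = truncate t (gaussPoly β u) := rfl
  set f₀ := restrictTo Ω (gaussLp hβ p) with hf₀
  set G := v₁ + v₂ + v₃ + v₄ with hG
  have hx0 : ∀ᵐ x ∂(volume.restrict (Ω : Set ℝ)), x ≠ 0 :=
    ae_restrict_of_ae (Measure.ae_ne volume 0)
  have hfu : ∀ x, gaussPoly β p x = β ^ 2 * (x : ℂ) ^ 2 * gaussPoly β u x -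
      gaussPoly β (gaussDeriv β (gaussDeriv β u)) x + β * gaussPoly β u x := by
    intro x
    rw [← hu, neg_smul, sub_neg_eq_add, gaussPoly_add, gaussPoly_smul, gaussPoly_oscPoly]
  -- This says (P + β)ψ = p - νqG: expanding the truncated Gaussian gives exactly the four
  -- contributions in G.
  have hh : ⇑(f₀ - ν • B G - β • testLp ψ) =ᵐ[volume.restrict (Ω : Set ℝ)]
      fun x => -deriv (deriv ψ) x + ν ^ 2 * (q x : ℂ) ^ 2 * ψ x := by
    filter_upwards [Lp.coeFn_sub (f₀ - ν • B G) (β • testLp ψ), Lp.coeFn_sub f₀ (ν • B G),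
      Lp.coeFn_smul ν (B G), Lp.coeFn_smul β (testLp ψ), hB G, coeFn_testLp ψ,
      restrict_gaussLp_ae (Ω := Ω) hβ p, Lp.coeFn_add (v₁ + v₂ + v₃) v₄, Lp.coeFn_add (v₁ + v₂) v₃,
      Lp.coeFn_add v₁ v₂, hv₁, hv₂, hv₃, hv₄, hx0, ae_restrict_mem Ω.isOpen.measurableSet]
      with x e1 e2 e3 e4 e5 e6 e7 e8 e9 e10 f1 f2 f3 f4 hx hxΩ
    have hq0 : (q x : ℂ) ≠ 0 := by
      have : 0 < |q x| := (mul_pos hc₁ (abs_pos.2 hx)).trans_le (hqc x hxΩ)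
      exact ofReal_ne_zero.2 (abs_pos.1 this)
    have hxc : (x : ℂ) ≠ 0 := ofReal_ne_zero.2 hx
    rw [e1, Pi.sub_apply, e2, Pi.sub_apply, e3, e4, Pi.smul_apply, Pi.smul_apply, e5, e6, e7, hG,
      e8, Pi.add_apply, e9, Pi.add_apply, e10, Pi.add_apply, f1, f2, f3, f4, hψc,
      deriv_deriv_truncate_gaussPoly, truncate, hfu, gaussPoly_X_mul, smul_eq_mul, smul_eq_mul,
      hβdef]
    push_cast
    field_simp
    ring
  have hmem := testLp_mem_dirichletGraph (ν := ν) ψ hh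
  have hSg := ((isResolventOp_iff _ _ _).1 hS).2 f₀
  rw [dirichletOp_graph] at hSg
  have hsub := (dirichletGraph Ω q ν).sub_mem hSg hmem
  rw [Prod.mk_sub_mk] at hsub
  have hkey := norm_le_of_mulBy hB hb hc hcν hsub (G := G) (by rw [← hβdef]; module)
  have hres : restrictTo Ω (gaussLp hβ u) = testLp ψ + v₅ := by
    refine Lp.ext ?_
    filter_upwards [restrict_gaussLp_ae (Ω := Ω) hβ u, Lp.coeFn_add (testLp ψ) v₅, coeFn_testLp ψ,
      hv₅, hx0] with x e1 e2 e3 e4 hx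
    have hxc : (x : ℂ) ≠ 0 := ofReal_ne_zero.2 hx
    rw [e1, e2, Pi.add_apply, e3, e4, hψc, truncate, gaussPoly_X_mul]
    push_cast
    field_simp
    ring
  have hkey2 : 2 * √(c * ‖β‖) * ‖S f₀ - testLp ψ‖ ≤ ‖G‖ := by
    refine (pow_le_pow_iff_left₀ (by positivity) (norm_nonneg _) two_ne_zero).1 ?_
    rw [mul_pow, mul_pow, Real.sq_sqrt (by positivity)]
    linarith
  have hGn : ‖G‖ ≤ ‖v₁‖ + ‖v₂‖ + ‖v₃‖ + ‖v₄‖ := by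
    refine (norm_add_le _ _).trans (add_le_add_left ((norm_add_le _ _).trans
      (add_le_add_left (norm_add_le _ _) _)) _)
  have hfin : ‖S f₀ - restrictTo Ω (gaussLp hβ u)‖ ≤ ‖S f₀ - testLp ψ‖ + ‖v₅‖ := by
    rw [hres, ← sub_sub]; exact norm_sub_le _ _
  calc _ ≤ 2 * √(c * ‖β‖) * (‖S f₀ - testLp ψ‖ + ‖v₅‖) := by gcongr
    _ = 2 * √(c * ‖β‖) * ‖S f₀ - testLp ψ‖ + 2 * √(c * ‖β‖) * ‖v₅‖ := by ring
    _ ≤ (1 * t / (c₁ * ‖ν‖) * ‖gaussLp hβ p‖ + t ^ 2 * M * t / (c₁ * ‖ν‖) * ‖gaussLp hβ u‖ +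
        2 * t * M * t / (c₁ * ‖ν‖) * ‖gaussLp hβ (gaussDeriv β u)‖ +
        η * ‖ν‖ / c₁ * ‖gaussLp hβ (X * u)‖) +
        2 * √(c * ‖β‖) * (t * ‖gaussLp hβ (X * u)‖) := by
      refine add_le_add (hkey2.trans (hGn.trans ?_)) (by gcongr)
      gcongr
    _ = _ := by ring

/-- Bounds on `q` coming from `q(0) = 0`, `q'(0) ≠ 0` and the absence of other zeros. -/
theorem exists_mul_abs_le {q : ℝ → ℝ} {L₁ L₂ : ℝ} (hL₁ : 0 < L₁) (hL₂ : 0 < L₂)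
    (hq : ContinuousOn q (Icc (-L₁) L₂)) (hq0 : q 0 = 0) (hq0' : 0 < deriv q 0)
    (hqne : ∀ x ∈ Icc (-L₁) L₂, x ≠ 0 → q x ≠ 0) :
    (∃ c₁ : ℝ, 0 < c₁ ∧ ∀ x ∈ Icc (-L₁) L₂, c₁ * |x| ≤ |q x|) ∧
      ∀ η : ℝ, 0 < η → ∃ δ : ℝ, 0 < δ ∧ ∀ x, |x| < δ →
        |q x ^ 2 - deriv q 0 ^ 2 * x ^ 2| ≤ η * x ^ 2 := by
  have hd : DifferentiableAt ℝ q 0 := differentiableAt_of_deriv_ne_zero hq0'.ne'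
  have hnhds : Icc (-L₁) L₂ ∈ 𝓝 (0 : ℝ) := Icc_mem_nhds (by linarith) hL₂
  -- The quotient q(x)/x, extended by q'(0), is continuous and does not vanish on the compact
  -- interval. Its minimum modulus is c₁, and its continuity at 0 gives the second claim.
  have hcont : ContinuousOn (dslope q 0) (Icc (-L₁) L₂) :=
    (continuousOn_dslope hnhds).2 ⟨hq, hd⟩
  have hsl : ∀ x, q x = x * dslope q 0 x := fun x => by
    have := sub_smul_dslope q 0 x
    rw [hq0, sub_zero, sub_zero, smul_eq_mul] at this
    exact this.symm
  constructor
  · obtain ⟨y, hy, hmin⟩ := isCompact_Icc.exists_isMinOn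
      (nonempty_of_mem (mem_of_mem_nhds hnhds)) hcont.abs
    have hy0 : dslope q 0 y ≠ 0 := by
      rcases eq_or_ne y 0 with rfl | h
      · rw [dslope_same]; exact hq0'.ne'
      · exact fun h0 => hqne y hy h (by rw [hsl, h0, mul_zero])
    refine ⟨|dslope q 0 y|, abs_pos.2 hy0, fun x hx => ?_⟩
    rw [hsl x, abs_mul, mul_comm]
    exact mul_le_mul_of_nonneg_left (hmin hx) (abs_nonneg _)
  · intro η hη
    have h1 : ContinuousAt (fun x => dslope q 0 x ^ 2) 0 := (hcont.continuousAt hnhds).pow 2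
    obtain ⟨δ, hδ, h⟩ := Metric.continuousAt_iff.1 h1 η hη
    refine ⟨δ, hδ, fun x hx => ?_⟩
    have h2 := h (x := x) (by simpa [Real.dist_eq] using hx)
    rw [Real.dist_eq, dslope_same] at h2
    rw [hsl x, mul_pow, mul_comm (deriv q 0 ^ 2), ← mul_sub, abs_mul, abs_of_nonneg (sq_nonneg x),
      mul_comm]
    exact mul_le_mul_of_nonneg_right h2.le (sq_nonneg x)

end Grushin
end

/-! ### Smallness of the difference, and transfer of the resolvent. -/

noncomputable section

namespace Grushin

open Polynomial Complex Filter
open scoped Topology ContDiff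

/-- The resolvents at `-a ν` differ by `o(1 / |ν|)`. -/
theorem exists_norm_resolvent_sub_le {L₁ L₂ : ℝ} (hL₁ : 0 < L₁) (hL₂ : 0 < L₂) {q : ℝ → ℝ}
    (hq : ContinuousOn q (Icc (-L₁) L₂)) (hq0 : q 0 = 0) (hq0' : 0 < deriv q 0)
    (hqne : ∀ x ∈ Icc (-L₁) L₂, x ≠ 0 → q x ≠ 0)
    {B : L2 (interval L₁ L₂) →L[ℂ] L2 (interval L₁ L₂)} (hB : IsMulBy q B)
    {c τ : ℝ} (hc : 0 < c) (hc1 : c ≤ 1) (hτ : 0 < τ) :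
    ∃ N₁ : ℝ, 1 ≤ N₁ ∧ ∀ ν : ℂ, N₁ ≤ ‖ν‖ →
      c * ‖((deriv q 0 : ℝ) : ℂ) * ν‖ ≤ (((deriv q 0 : ℝ) : ℂ) * ν).re →
      ∀ (S : L2 (interval L₁ L₂) →L[ℂ] L2 (interval L₁ L₂)) (R : L2R →L[ℂ] L2R),
        IsResolventOp (dirichletOp (interval L₁ L₂) q ν) (-(((deriv q 0 : ℝ) : ℂ) * ν)) S →
        IsResolventOp (oscillatorOp (((deriv q 0 : ℝ) : ℂ) * ν)) (-(((deriv q 0 : ℝ) : ℂ) * ν)) R →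
        ‖S ∘L restrictTo (interval L₁ L₂) - restrictTo (interval L₁ L₂) ∘L R‖ ≤ τ / ‖ν‖ := by
  obtain ⟨⟨c₁, hc₁, hqc⟩, hqη⟩ := exists_mul_abs_le hL₁ hL₂ hq hq0 hq0' hqne
  obtain ⟨M, hM0, hM⟩ := exists_cutoff_bound
  set a := deriv q 0 with ha
  set k : ℝ := 3 / c with hk
  have hk0 : 0 < k := by positivity
  have hw : 0 < √c := Real.sqrt_pos.2 hc
  -- A is the coefficient of η in the final bound, so the potential error costs ηA = τ/2. Then δ and
  -- t depend on η, and only afterwards is |ν| taken large.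
  set A : ℝ := k / (2 * √c * c₁ * a ^ 2) with hA
  have hA0 : 0 < A := by positivity
  set η : ℝ := τ / (2 * A) with hη
  have hη0 : 0 < η := by positivity
  obtain ⟨δ, hδ, hδq⟩ := hqη η hη0
  obtain ⟨t, ht, htδ, ht₁, ht₂⟩ : ∃ t : ℝ, 0 < t ∧ 2 / t ≤ δ ∧ 2 / t < L₁ ∧ 2 / t < L₂ := by
    have hm : 0 < min δ (min L₁ L₂) := lt_min hδ (lt_min hL₁ hL₂)
    have h : 2 / (4 / min δ (min L₁ L₂)) < min δ (min L₁ L₂) := by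
      rw [div_div_eq_mul_div, div_lt_iff₀ (by norm_num)]; linarith
    have h2 := lt_min_iff.1 (lt_min_iff.1 h).2
    exact ⟨4 / min δ (min L₁ L₂), by positivity, (lt_min_iff.1 h).1.le, h2.1, h2.2⟩
  -- All terms depending on t carry an extra factor |β|^(-1/2). Ct collects their coefficients; the
  -- last lower bound on |ν| makes Ct/√|β| ≤ τ/2.
  set Ct : ℝ := (t / c₁ * (1 + t ^ 2 * M * k + 2 * t * M * k) + 2 * √c * t * k / a) / (2 * √c)
    with hCt
  have hCt0 : 0 < Ct := by positivity
  refine ⟨max 1 (max (1 / a) ((2 * Ct / τ) ^ 2 / a)), le_max_left _ _,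
    fun ν hν hcν S R hS hR => ?_⟩
  have hN1 : 1 ≤ ‖ν‖ := (le_max_left _ _).trans hν
  have hN2 : 1 / a ≤ ‖ν‖ := (le_max_left _ _).trans ((le_max_right _ _).trans hν)
  have hN3 : (2 * Ct / τ) ^ 2 / a ≤ ‖ν‖ := (le_max_right _ _).trans ((le_max_right _ _).trans hν)
  have hN0 : 0 < ‖ν‖ := one_pos.trans_le hN1
  have hbN : ‖(a : ℂ) * ν‖ = a * ‖ν‖ := by
    rw [norm_mul, norm_real, Real.norm_eq_abs, abs_of_pos hq0']
  have hb1 : 1 ≤ ‖(a : ℂ) * ν‖ := by rwa [hbN, mul_comm, ← div_le_iff₀ hq0']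
  have hb0 : 0 < ‖(a : ℂ) * ν‖ := one_pos.trans_le hb1
  have hβ : 0 < ((a : ℂ) * ν).re := (mul_pos hc hb0).trans_le hcν
  have hs1 : 1 ≤ √‖(a : ℂ) * ν‖ := Real.one_le_sqrt.2 hb1
  have hs0 : 0 < √‖(a : ℂ) * ν‖ := one_pos.trans_le hs1
  have hss : √‖(a : ℂ) * ν‖ * √‖(a : ℂ) * ν‖ = ‖(a : ℂ) * ν‖ := Real.mul_self_sqrt hb0.le
  have hsC : 2 * Ct / τ ≤ √‖(a : ℂ) * ν‖ := by
    refine Real.le_sqrt_of_sq_le ?_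
    rwa [hbN, mul_comm a, ← div_le_iff₀ hq0']
  have hτ0 : 0 ≤ τ / ‖ν‖ := by positivity
  refine ContinuousLinearMap.opNorm_le_bound _ hτ0 fun f => ?_
  refine (denseRange_gaussLp hβ).induction_on (p := fun f : L2R =>
    ‖(S ∘L restrictTo (interval L₁ L₂) - restrictTo (interval L₁ L₂) ∘L R) f‖ ≤
      τ / ‖ν‖ * ‖f‖) f (isClosed_le (by fun_prop) (by fun_prop)) fun p => ?_
  obtain ⟨u, hu⟩ := oscPoly_surjective (neg_ne_odd_mul hβ) p
  have hRu : R (gaussLp hβ p) = gaussLp hβ u := by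
    have hmem := gaussLp_mem_oscillatorGraph hβ u
    rw [← oscillatorOp_graph] at hmem
    have := ((isResolventOp_iff _ _ _).1 hR).1 _ _ hmem
    rwa [← map_smul, ← map_sub, hu] at this
  have hmain := norm_resolvent_sub_le (Ω := interval L₁ L₂) (hq.mono Ioo_subset_Icc_self) hB hβ
    hN0 hc hcν hc₁ (fun x hx => hqc x (Ioo_subset_Icc_self hx)) ht hη0.le
    (fun x hx => ⟨by linarith [hx.1], by linarith [hx.2]⟩)
    (fun x hx => hδq x (by
      rw [abs_mul, abs_of_pos ht, mul_comm, ← lt_div_iff₀ ht] at hx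
      exact hx.trans_le htδ)) hM hS hu
  have hE := ladderBound_of_re_le hβ hc hc1 hcν (re_conj_mul_neg_self _).le u p 0
    (by rw [hu, derivative_zero, add_zero])
  rw [map_zero, norm_zero, mul_zero, add_zero, energyNorm, ← hk] at hE
  change ‖S (restrictTo _ (gaussLp hβ p)) - restrictTo _ (R (gaussLp hβ p))‖ ≤ _
  rw [hRu]
  set D := ‖S (restrictTo _ (gaussLp hβ p)) - restrictTo _ (gaussLp hβ u)‖
  rw [Real.sqrt_mul hc.le] at hmain
  set b := ‖(a : ℂ) * ν‖
  set s := √b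
  set N := ‖ν‖
  set P := ‖gaussLp hβ p‖
  set U := ‖gaussLp hβ u‖
  set V := ‖gaussLp hβ (gaussDeriv ((a : ℂ) * ν) u)‖
  set W := ‖gaussLp hβ (X * u)‖
  have hP : 0 ≤ P := norm_nonneg _
  have hU : 0 ≤ U := norm_nonneg _
  have hV : 0 ≤ V := norm_nonneg _
  have hW : 0 ≤ W := norm_nonneg _
  have hU1 : 0 ≤ b * U := by positivity
  have hV1 : 0 ≤ s * V := by positivity
  have hW1 : 0 ≤ s * (b * W) := by positivity
  have hU2 : U ≤ k * P := by
    have : 1 * U ≤ b * U := by gcongr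
    linarith
  have hV2 : V ≤ k * P := by
    have : 1 * V ≤ s * V := by gcongr
    linarith
  have hW2 : W ≤ k * P / (s * b) := by
    rw [le_div_iff₀ (by positivity)]; linarith
  have h1 : 2 * (√c * s) * D ≤ 2 * (√c * s) * (P / N * (η * A + Ct / s)) := by
    calc _ ≤ t / (c₁ * N) * (P + t ^ 2 * M * (k * P) + 2 * t * M * (k * P)) +
          (η * N / c₁ + 2 * (√c * s) * t) * (k * P / (s * b)) := hmain.trans (by gcongr)
      _ = 2 * (√c * s) * (P / N * (η * A + Ct / s)) := by
        rw [← hss, hA, hCt]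
        have hN : N = s * s / a := by rw [hss, hbN]; field_simp
        rw [hN]
        field_simp
        ring
  have h2 := le_of_mul_le_mul_left h1 (by positivity)
  have h3 : η * A + Ct / s ≤ τ := by
    have e1 : η * A = τ / 2 := by rw [hη]; field_simp
    have e2 : Ct / s ≤ τ / 2 := by
      rw [div_le_iff₀ hs0]
      rw [div_le_iff₀ hτ] at hsC
      linarith
    linarith
  calc D ≤ P / N * (η * A + Ct / s) := h2
    _ ≤ P / N * τ := by gcongr
    _ = _ := by ring

variable {Ω : Opens ℝ}

theorem eq_zero_of_pairing_eq_zero {w : L2 Ω} (h : ∀ f : L2 Ω, pairing _ w f = 0) : w = 0 :=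
  L2_eq_zero w fun φ => by rw [← pairing_testLp, pairing_comm]; exact h _

/-- The potential is complex but the operator is symmetric for the bilinear pairing. This replaces
selfadjointness when injectivity is deduced from surjectivity. -/
theorem pairing_resolvent_comm {q : ℝ → ℝ} {B : L2 Ω →L[ℂ] L2 Ω} (hB : IsMulBy q B) {ν z : ℂ}
    {S : L2 Ω →L[ℂ] L2 Ω} (hS : IsResolventOp (dirichletOp Ω q ν) z S) (f g : L2 Ω) :
    pairing _ (S f) g = pairing _ f (S g) := by
  have h := ((isResolventOp_iff _ _ _).1 hS).2
  rw [dirichletOp_graph] at h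
  have h1 := pairing_dirichletGraph_comm hB (h f) (h g)
  rw [map_add, map_add, map_smul, map_smul, pairing_comm (S g) (S f), add_left_inj] at h1
  rw [← h1, pairing_comm]

/-- The resolvent identity, arranged so that R(w) acts on f + (z - w)R(z)f. -/
theorem apply_add_smul_of_isResolventOp {E : Type*} [NormedAddCommGroup E] [NormedSpace ℂ E]
    {A : E →ₗ.[ℂ] E} {z w : ℂ} {R R' : E →L[ℂ] E} (hR : IsResolventOp A w R)
    (hR' : IsResolventOp A z R') (f : E) : R (f + (z - w) • R' f) = R' f := by
  have h := ((isResolventOp_iff _ _ _).1 hR).1 _ _ (((isResolventOp_iff _ _ _).1 hR').2 f)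
  rwa [add_sub_assoc, ← sub_smul] at h

/-- Transfer of a resolvent from a base point `w` to `z` by comparison with the oscillator. -/
theorem exists_isResolventOp_of_comparison {q : ℝ → ℝ} {B : L2 Ω →L[ℂ] L2 Ω} (hB : IsMulBy q B)
    {ν β z w : ℂ} {S : L2 Ω →L[ℂ] L2 Ω} (hS : IsResolventOp (dirichletOp Ω q ν) w S)
    {R Rz : L2R →L[ℂ] L2R} (hR : IsResolventOp (oscillatorOp β) w R)
    (hRz : IsResolventOp (oscillatorOp β) z Rz) {d Q : ℝ}
    (hd : ‖S ∘L restrictTo Ω - restrictTo Ω ∘L R‖ ≤ d) (hQ : 1 + ‖z - w‖ * ‖Rz‖ ≤ Q)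
    (hsmall : ‖z - w‖ * (d * Q) ≤ 1 / 2) :
    ∃ T : L2 Ω →L[ℂ] L2 Ω, IsResolventOp (dirichletOp Ω q ν) z T ∧
      ‖T - restrictTo Ω ∘L (Rz ∘L extendZero Ω)‖ ≤ 2 * Q ^ 2 * d := by
  have hd0 : 0 ≤ d := (norm_nonneg _).trans hd
  have hQ0 : 0 ≤ Q := le_trans (by positivity) hQ
  set ζ := z - w with hζ
  set D := S ∘L restrictTo Ω - restrictTo Ω ∘L R with hD
  set T₁ := restrictTo Ω ∘L (Rz ∘L extendZero Ω) with hT₁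
  -- With this D', the product (1 - ζS)(1 + ζT₁) equals 1 - ζD'; the smallness hypothesis gives
  -- ‖ζD'‖ ≤ 1/2.
  set D' : L2 Ω →L[ℂ] L2 Ω := D ∘L (extendZero Ω + ζ • (Rz ∘L extendZero Ω)) with hD'
  have hRzn : ∀ f : L2 Ω, ‖Rz (extendZero Ω f)‖ ≤ ‖Rz‖ * ‖f‖ := fun f => by
    rw [← norm_extendZero f]; exact Rz.le_opNorm _
  have hD'n : ∀ f, ‖D' f‖ ≤ d * Q * ‖f‖ := fun f => by
    change ‖D (extendZero Ω f + ζ • Rz (extendZero Ω f))‖ ≤ _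
    refine (D.le_opNorm _).trans ?_
    rw [mul_assoc]
    refine mul_le_mul hd ?_ (norm_nonneg _) hd0
    refine (norm_add_le _ _).trans ?_
    rw [norm_smul, norm_extendZero]
    calc _ ≤ ‖f‖ + ‖ζ‖ * (‖Rz‖ * ‖f‖) := by gcongr; exact hRzn f
      _ = (1 + ‖ζ‖ * ‖Rz‖) * ‖f‖ := by ring
      _ ≤ _ := by gcongr
  have hT₁n : ∀ f, ‖f + ζ • T₁ f‖ ≤ Q * ‖f‖ := fun f => by
    refine (norm_add_le _ _).trans ?_
    rw [norm_smul]
    have h1 : ‖T₁ f‖ ≤ ‖Rz‖ * ‖f‖ := (norm_restrictTo_le _).trans (hRzn f)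
    calc _ ≤ ‖f‖ + ‖ζ‖ * (‖Rz‖ * ‖f‖) := by gcongr
      _ = (1 + ‖ζ‖ * ‖Rz‖) * ‖f‖ := by ring
      _ ≤ _ := by gcongr
  -- `(1 - ζ S) T₁ = S - D'`
  have hkey : ∀ f, T₁ f - ζ • S (T₁ f) = S f - D' f := fun f => by
    have h1 := apply_add_smul_of_isResolventOp hR hRz (extendZero Ω f)
    have h2 : D' f = S (restrictTo Ω (extendZero Ω f + ζ • Rz (extendZero Ω f))) -
      restrictTo Ω (R (extendZero Ω f + ζ • Rz (extendZero Ω f))) := rfl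
    rw [h2, h1, map_add, map_smul, restrictTo_extendZero, map_add, map_smul]
    change T₁ f - ζ • S (T₁ f) = S f - (S f + ζ • S (T₁ f) - T₁ f)
    abel
  have hE : ‖ζ • D'‖ ≤ 1 / 2 := by
    rw [norm_smul]
    refine le_trans ?_ hsmall
    gcongr
    exact D'.opNorm_le_bound (by positivity) hD'n
  obtain ⟨W, hW⟩ := (isUnit_one_sub_of_norm_lt_one (hE.trans_lt (by norm_num))).exists_right_inv
  have hWf : ∀ f, W f - ζ • D' (W f) = f := fun f => by
    have := congrArg (fun Z : L2 Ω →L[ℂ] L2 Ω => Z f) hW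
    simpa using this
  have hWn : ∀ f, ‖W f‖ ≤ 2 * ‖f‖ := fun f => by
    have h1 : ‖W f‖ ≤ ‖f‖ + ‖ζ • D' (W f)‖ := by
      conv_lhs => rw [sub_eq_iff_eq_add.1 (hWf f)]
      exact norm_add_le _ _
    have h2 : ‖ζ • D' (W f)‖ ≤ 1 / 2 * ‖W f‖ :=
      ((ζ • D').le_opNorm (W f)).trans (by gcongr)
    linarith
  -- M = (1 + ζT₁)(1 - ζD')⁻¹ is an exact right inverse of 1 - ζS, of norm at most 2Q.
  set M : L2 Ω →L[ℂ] L2 Ω := W + ζ • (T₁ ∘L W) with hM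
  have hMf : ∀ f, M f - ζ • S (M f) = f := fun f => by
    have e : M f = W f + ζ • T₁ (W f) := rfl
    rw [e, map_add, map_smul]
    calc _ = W f - ζ • S (W f) + ζ • (T₁ (W f) - ζ • S (T₁ (W f))) := by module
      _ = W f - ζ • D' (W f) := by rw [hkey]; module
      _ = f := hWf f
  have hMn : ∀ f, ‖M f‖ ≤ 2 * Q * ‖f‖ := fun f => by
    calc _ ≤ Q * ‖W f‖ := hT₁n (W f)
      _ ≤ Q * (2 * ‖f‖) := by gcongr; exact hWn f
      _ = _ := by ring
  -- By symmetry of S, a kernel vector pairs to zero with the range of 1 - ζS, which is everything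
  -- by M.
  have hinj : ∀ v, v - ζ • S v = 0 → v = 0 := fun v hv => by
    refine eq_zero_of_pairing_eq_zero fun f => ?_
    rw [← hMf f, map_sub, map_smul, ← pairing_resolvent_comm hB hS, ← smul_apply,
      ← map_smul, ← sub_apply, ← map_sub, hv, map_zero, zero_apply]
  have hinj' : ∀ u v, u - ζ • S u = v - ζ • S v → u = v := fun u v h =>
    sub_eq_zero.1 (hinj _ (by rw [map_sub, smul_sub, sub_sub_sub_comm, h, sub_self]))
  obtain ⟨hS1, hS2⟩ := (isResolventOp_iff _ _ _).1 hS
  refine ⟨S ∘L M, (isResolventOp_iff _ _ _).2 ⟨fun u f huf => ?_, fun f => ?_⟩, ?_⟩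
  · change S (M (f - z • u)) = u
    have h1 := hS1 _ _ huf
    rw [map_sub, map_smul, sub_eq_iff_eq_add] at h1
    refine hinj' _ _ ?_
    rw [← map_smul, ← map_sub, hMf, map_sub, map_smul, h1, hζ]
    module
  · change (S (M f), f + z • S (M f)) ∈ _
    have h1 := hS2 (M f)
    have e : M f + w • S (M f) = f + z • S (M f) := by
      have h2 := sub_eq_iff_eq_add.1 (hMf f)
      generalize S (M f) = y at h2 ⊢
      rw [h2, hζ]
      module
    rwa [e] at h1
  · refine ContinuousLinearMap.opNorm_le_bound _ (by positivity) fun f => ?_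
    -- Applying 1 - ζS to both sides gives D'f, so injectivity identifies them. The factors 2Q and
    -- dQ give the stated bound.
    have e : (S ∘L M - T₁) f = M (D' f) := by
      refine hinj' _ _ ?_
      rw [hMf]
      change S (M f) - T₁ f - ζ • S (S (M f) - T₁ f) = D' f
      calc _ = S (M f - ζ • S (M f)) - (T₁ f - ζ • S (T₁ f)) := by
            simp only [map_sub, map_smul]; module
        _ = D' f := by rw [hMf, hkey]; abel
    rw [e]
    calc _ ≤ 2 * Q * ‖D' f‖ := hMn _
      _ ≤ 2 * Q * (d * Q * ‖f‖) := by gcongr; exact hD'n f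
      _ = _ := by ring

end Grushin
end

/-! ### Uniform constants on the sector and conclusion. -/

theorem Grushin.mul_norm_le_re_of_mem_sector {θ₀ a : ℝ} (hθ₀ : θ₀ < Real.pi / 2) (ha : 0 < a) {ν : ℂ}
    (hν : ν ∈ Grushin.sector θ₀) :
    Real.cos θ₀ * ‖(a : ℂ) * ν‖ ≤ ((a : ℂ) * ν).re := by
  have h1 : Real.cos θ₀ ≤ Real.cos ν.arg := by
    rw [← Real.cos_abs ν.arg]
    exact Real.cos_le_cos_of_nonneg_of_le_pi (abs_nonneg _) (by linarith [Real.pi_pos]) hν.2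
  rw [norm_mul, Complex.norm_real, Real.norm_eq_abs, abs_of_pos ha, Complex.re_ofReal_mul,
    ← Complex.norm_mul_cos_arg ν]
  calc _ = a * (‖ν‖ * Real.cos θ₀) := by ring
    _ ≤ _ := by gcongr

theorem Grushin.le_norm_sub_of_mem_spectralRegion {β z : ℂ} {ε γ : ℝ} (hβ : 0 < β.re)
    (hz : z ∈ Grushin.spectralRegion β ε γ) (k : ℕ) : ε * ‖β‖ ≤ ‖z - (2 * k + 1) * β‖ := by
  have h := hz.2.trans (Metric.infEDist_le_edist_of_mem (Grushin.odd_mul_mem_opSpectrum hβ k))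
  rw [edist_dist, dist_eq_norm] at h
  exact (ENNReal.ofReal_le_ofReal_iff (norm_nonneg _)).1 h

theorem proposition4p1
    (Lminus Lplus : ℝ) (hLminus : 0 < Lminus) (hLplus : 0 < Lplus)
    (q : ℝ → ℝ) (hq : ContDiffOn ℝ 2 q (Icc (-Lminus) Lplus))
    (hq0 : q 0 = 0) (hq0' : 0 < deriv q 0)
    (hqne : ∀ x ∈ Icc (-Lminus) Lplus, x ≠ 0 → q x ≠ 0)
    (θ₀ : ℝ) (hθ₀ : 0 ≤ θ₀) (hθ₀' : θ₀ < Real.pi / 2)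
    (γ ε : ℝ) (hγ : 0 < γ) (hε : 0 < ε) :
    ∃ ν₀ : ℝ, 1 ≤ ν₀ ∧
      (∀ ν ∈ Grushin.sector θ₀, ν₀ ≤ ‖ν‖ →
        ∀ z ∈ Grushin.spectralRegion (((deriv q 0 : ℝ) : ℂ) * ν) ε γ,
          z ∈ Grushin.opResolventSet
            (Grushin.dirichletOp (Grushin.interval Lminus Lplus) q ν)) ∧
      (∀ η : ℝ, 0 < η → ∃ ν₁ : ℝ, ν₀ ≤ ν₁ ∧
        ∀ ν ∈ Grushin.sector θ₀, ν₁ ≤ ‖ν‖ →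
          ∀ z ∈ Grushin.spectralRegion (((deriv q 0 : ℝ) : ℂ) * ν) ε γ,
            ‖Grushin.opResolvent (Grushin.dirichletOp (Grushin.interval Lminus Lplus) q ν) z -
              (Grushin.restrictTo (Grushin.interval Lminus Lplus)).comp
                ((Grushin.opResolvent (Grushin.oscillatorOp (((deriv q 0 : ℝ) : ℂ) * ν)) z).comp
                  (Grushin.extendZero (Grushin.interval Lminus Lplus)))‖ ≤ η / ‖ν‖) := by
  have hc : 0 < Real.cos θ₀ := Real.cos_pos_of_mem_Ioo ⟨by linarith [Real.pi_pos], hθ₀'⟩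
  have hc1 : Real.cos θ₀ ≤ 1 := Real.cos_le_one θ₀
  obtain ⟨B, hB⟩ := Grushin.exists_isMulBy (Ω := Grushin.interval Lminus Lplus) isCompact_Icc
    Ioo_subset_Icc_self hq.continuousOn
  obtain ⟨K, hK, hladder⟩ := Grushin.exists_ladderBound hc hc1 hε hγ
  -- Q bounds 1 + |z + β|‖(H - z)⁻¹‖, because |z + β| ≤ (γ + 1)|β| and the resolvent norm is at most
  -- K/|β|.
  set Q : ℝ := 1 + (γ + 1) * K with hQ
  have hQ0 : 0 < Q := by positivity
  -- Chosen so that |z + β| times dQ with d = τ₀/|ν| is at most 1/2: the factor |β| = q'(0)|ν|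
  -- cancels |ν|.
  set τ₀ : ℝ := 1 / (2 * ((γ + 1) * deriv q 0 * Q)) with hτ₀
  have hτ₀0 : 0 < τ₀ := by positivity
  have key : ∀ τ : ℝ, 0 < τ → τ ≤ τ₀ → ∃ N₁ : ℝ, 1 ≤ N₁ ∧ ∀ ν ∈ Grushin.sector θ₀, N₁ ≤ ‖ν‖ →
      ∀ z ∈ Grushin.spectralRegion (((deriv q 0 : ℝ) : ℂ) * ν) ε γ, ∃ T,
        Grushin.IsResolventOp (Grushin.dirichletOp (Grushin.interval Lminus Lplus) q ν) z T ∧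
        ‖T - (Grushin.restrictTo (Grushin.interval Lminus Lplus)).comp
          ((Grushin.opResolvent (Grushin.oscillatorOp (((deriv q 0 : ℝ) : ℂ) * ν)) z).comp
            (Grushin.extendZero (Grushin.interval Lminus Lplus)))‖ ≤ 2 * Q ^ 2 * (τ / ‖ν‖) := by
    intro τ hτ hττ₀
    obtain ⟨N₁, hN₁, hcomp⟩ := Grushin.exists_norm_resolvent_sub_le hLminus hLplus hq.continuousOn
      hq0 hq0' hqne hB hc hc1 hτ
    refine ⟨N₁, hN₁, fun ν hν hνN z hz => ?_⟩
    have hcν := Grushin.mul_norm_le_re_of_mem_sector hθ₀' hq0' hν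
    have hN0 : 0 < ‖ν‖ := one_pos.trans_le (hN₁.trans hνN)
    have hbN : ‖((deriv q 0 : ℝ) : ℂ) * ν‖ = deriv q 0 * ‖ν‖ := by
      rw [norm_mul, Complex.norm_real, Real.norm_eq_abs, abs_of_pos hq0']
    have hb0 : 0 < ‖((deriv q 0 : ℝ) : ℂ) * ν‖ := by rw [hbN]; positivity
    have hβ : 0 < (((deriv q 0 : ℝ) : ℂ) * ν).re := (mul_pos hc hb0).trans_le hcν
    have hsp := Grushin.le_norm_sub_of_mem_spectralRegion hβ hz
    obtain ⟨S, hS⟩ := Grushin.exists_isResolventOp_dirichletOp hB hb0 hc hcν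
    obtain ⟨R, hR, -⟩ := Grushin.LadderBound.exists_isResolventOp hβ (by positivity)
      (Grushin.ladderBound_of_re_le hβ hc hc1 hcν (Grushin.re_conj_mul_neg_self _).le)
      (Grushin.neg_ne_odd_mul hβ)
    obtain ⟨Rz, hRz, hRzK⟩ := Grushin.LadderBound.exists_isResolventOp hβ hK
      (hladder hβ z hcν hz.1 hsp) (fun k h => by
        have := hsp k
        rw [h, sub_self, norm_zero] at this
        exact absurd this (not_le.2 (mul_pos hε hb0)))
    rw [hRz.opResolvent_eq]
    set β : ℂ := ((deriv q 0 : ℝ) : ℂ) * ν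
    have hζ : ‖z - -β‖ ≤ (γ + 1) * ‖β‖ := by
      rw [sub_neg_eq_add]
      exact (norm_add_le _ _).trans (by linarith [hz.1])
    refine Grushin.exists_isResolventOp_of_comparison hB hS hR hRz (hcomp ν hνN hcν S R hS hR) ?_ ?_
    · have : ‖z - -β‖ * ‖Rz‖ ≤ (γ + 1) * ‖β‖ * (K / ‖β‖) := by gcongr
      have e : (γ + 1) * ‖β‖ * (K / ‖β‖) = (γ + 1) * K := by field_simp
      rw [hQ]
      linarith
    · calc _ ≤ (γ + 1) * ‖β‖ * (τ₀ / ‖ν‖ * Q) := by gcongr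
        _ = 1 / 2 := by rw [hbN, hτ₀]; field_simp
  obtain ⟨ν₀, hν₀, h0⟩ := key τ₀ hτ₀0 le_rfl
  refine ⟨ν₀, hν₀, fun ν hν hνN z hz => ?_, fun η hη => ?_⟩
  · obtain ⟨T, hT, -⟩ := h0 ν hν hνN z hz
    exact ⟨T, hT⟩
  · obtain ⟨N₁, hN₁, h1⟩ := key (min τ₀ (η / (2 * Q ^ 2))) (by positivity) (min_le_left _ _)
    refine ⟨max ν₀ N₁, le_max_left _ _, fun ν hν hνN z hz => ?_⟩
    obtain ⟨T, hT, hTn⟩ := h1 ν hν ((le_max_right _ _).trans hνN) z hz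
    rw [hT.opResolvent_eq]
    refine hTn.trans ?_
    calc _ ≤ 2 * Q ^ 2 * (η / (2 * Q ^ 2) / ‖ν‖) := by gcongr; exact min_le_right _ _
      _ = _ := by field_simp
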